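/- Fix any exponent $a\in\mathbb{N}$. There are a randomized sequential algorithm $\mathcal{A}$ and a constant $C$, both depending only on $a$, such that the following holds for every $\epsilon\in(0,1)$ and every simple graph $G$ with $n\ge 1$ vertices, $m$ edges and maximum degree $\Delta \ge 500\log n/\epsilon$, where $\log$ is the natural logarithm. Given $n$, $m$, the list of the edges of $G$ (in any order) and the number $q=\lfloor(1+\epsilon)\Delta\rfloor$ of available colors, with probability at least $1-n^{-a}$ the algorithm $\mathcal{A}$ halts after at most $C\,m\log^3 n/\epsilon^3$ time steps and outputs a proper $q$-edge-coloring of $G$, that is, a function $\phi\colon E(G)\to\{0,\dots,q-1\}$ with $\phi(e)\ne\phi(f)$ for all distinct edges $e,f$ that share an endpoint. Here a randomized sequential algorithm is a program for a randomized word RAM: the vertices are named $0,\dots,n-1$, memory is initially zero outside the input, machine words have $O(\log n)$ bits (with a constant that depends only on $a$), and arithmetic operations and comparisons on words, accesses to memory, and drawing a uniformly random element of $\{0,\dots,k-1\}$ for a word $k\geq 1$ take unit time. -/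

import Mathlib

namespace WordRAM

/-- Arithmetic and comparison operations on machine words. -/
inductive Op
  | add | sub | mul | div | mod | lt | eq

/-- Value of an operation, before reduction to the word size. Subtraction is truncated at `0`,
the quotient by `0` is `0`, and comparisons return `1` for true and `0` for false. -/
def Op.apply : Op → ℕ → ℕ → ℕ
  | .add, x, y => x + y
  | .sub, x, y => x - y
  | .mul, x, y => x * y
  | .div, x, y => x / y
  | .mod, x, y => x % y
  | .lt, x, y => if x < y then 1 else 0
  | .eq, x, y => if x = y then 1 else 0

/-- Expressions. Registers and arrays are named by fixed numerals of the program; only the index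
into an array is computed. -/
inductive Expr
  | const (k : ℕ)
  | reg (x : ℕ)
  | load (a : ℕ) (i : Expr)
  | op (o : Op) (e f : Expr)

/-- Commands of a randomized random-access machine with structured control flow. -/
inductive Cmd
  | skip
  | assign (x : ℕ) (e : Expr)
  | store (a : ℕ) (i e : Expr)
  | rand (x : ℕ) (e : Expr)
  | seq (p q : Cmd)
  | ite (e : Expr) (p q : Cmd)
  | loop (e : Expr) (p : Cmd)

/-- Memory: registers, and arrays of random-access cells. -/
structure Store where
  reg : ℕ → ℕ
  arr : ℕ → ℕ → ℕ

/-- Assign a value to a register. -/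
def Store.setReg (s : Store) (x v : ℕ) : Store :=
  { s with reg := Function.update s.reg x v }

/-- Write a value into a cell of an array. -/
def Store.setArr (s : Store) (a i v : ℕ) : Store :=
  { s with arr := Function.update s.arr a (Function.update (s.arr a) i v) }

/-- Evaluation of an expression. All results are reduced modulo `W`, the number of distinct
machine words, so that addresses and computed values are machine words. -/
def Expr.eval (W : ℕ) (s : Store) : Expr → ℕ
  | .const k => k % W
  | .reg x => s.reg x
  | .load a i => s.arr a (i.eval W s)
  | .op o e f => o.apply (e.eval W s) (f.eval W s) % W

/-- A uniformly random element of `{0, …, k - 1}` (and `0` if `k = 0`). -/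
noncomputable def uniformBelow : ℕ → PMF ℕ
  | 0 => PMF.pure 0
  | k + 1 => PMF.uniformOfFinset (Finset.range (k + 1)) ⟨0, by simp⟩

/-- A configuration: the commands still to be executed, and the memory. The machine has halted
when no command is left. -/
structure Config where
  todo : List Cmd
  mem : Store

/-- One time step of the machine: it executes the first command that is left, where a `seq` or
one test of an `ite` or a `loop` is one time step too. A program is a fixed finite object, so
each time step consists of boundedly many elementary operations on machine words, with a bound
that depends only on the program. -/
noncomputable def step (W : ℕ) : Config → PMF Config
  | ⟨[], s⟩ => PMF.pure ⟨[], s⟩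
  | ⟨.skip :: k, s⟩ => PMF.pure ⟨k, s⟩
  | ⟨.assign x e :: k, s⟩ => PMF.pure ⟨k, s.setReg x (e.eval W s)⟩
  | ⟨.store a i e :: k, s⟩ => PMF.pure ⟨k, s.setArr a (i.eval W s) (e.eval W s)⟩
  | ⟨.rand x e :: k, s⟩ => (uniformBelow (e.eval W s)).map fun v => ⟨k, s.setReg x v⟩
  | ⟨.seq p q :: k, s⟩ => PMF.pure ⟨p :: q :: k, s⟩
  | ⟨.ite e p q :: k, s⟩ => PMF.pure (if e.eval W s ≠ 0 then ⟨p :: k, s⟩ else ⟨q :: k, s⟩)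
  | ⟨.loop e p :: k, s⟩ =>
      PMF.pure (if e.eval W s ≠ 0 then ⟨p :: .loop e p :: k, s⟩ else ⟨k, s⟩)

/-- The random configuration after `t` time steps. -/
noncomputable def run (W : ℕ) : ℕ → Config → PMF Config
  | 0, c => PMF.pure c
  | t + 1, c => (step W c).bind (run W t)

/-- The number of distinct machine words on inputs of size parameter `n`:
words have `c * (⌊log₂ n⌋ + 1) = O(log n)` bits. -/
def wordBound (c n : ℕ) : ℕ := 2 ^ (c * (Nat.log 2 n + 1))

end WordRAM

namespace EdgeColoringProblem

/-- `es` lists every edge of `G` exactly once, each as an ordered pair of its endpoints; the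
order of the list and the orientations are arbitrary. -/
def IsEdgeList {n m : ℕ} (G : SimpleGraph (Fin n)) (es : Fin m → Fin n × Fin n) : Prop :=
  Function.Injective (fun i => s((es i).1, (es i).2)) ∧
    Set.range (fun i => s((es i).1, (es i).2)) = G.edgeSet

/-- The initial memory: registers `0`, `1`, `2` hold the number `n` of vertices, the number `m`
of edges and the number `q` of available colors; cell `i` of array `0` (of array `1`) holds the
first (second) endpoint of the `i`-th edge; everything else is `0`. -/
def input {n m : ℕ} (q : ℕ) (es : Fin m → Fin n × Fin n) : WordRAM.Store where
  reg x := if x = 0 then n else if x = 1 then m else if x = 2 then q else 0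
  arr a i :=
    if h : i < m then
      if a = 0 then (es ⟨i, h⟩).1 else if a = 1 then (es ⟨i, h⟩).2 else 0
    else 0

/-- The memory `s` holds in array `2` a proper `q`-edge-coloring of `G` with colors
`0, …, q - 1`: cell `i` contains the color of the `i`-th edge of the list. -/
def IsOutput {n m : ℕ} (G : SimpleGraph (Fin n)) (q : ℕ) (es : Fin m → Fin n × Fin n)
    (s : WordRAM.Store) : Prop :=
  ∃ φ : G.edgeSet → Fin q,
    (∀ e f : G.edgeSet, e ≠ f → (∃ v, v ∈ (e : Sym2 (Fin n)) ∧ v ∈ (f : Sym2 (Fin n))) →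
      φ e ≠ φ f) ∧
    ∀ (i : Fin m) (e : G.edgeSet), (e : Sym2 (Fin n)) = s((es i).1, (es i).2) →
      s.arr 2 i = φ e

/-- The probability that the program `P`, run with words of `c * (⌊log₂ n⌋ + 1)` bits on the
graph `G` given by the edge list `es` and on the number `q` of colors, halts within `t` time steps
and leaves a proper `q`-edge-coloring of `G` in the memory. -/
noncomputable def successProb (P : WordRAM.Cmd) (c : ℕ) {n m : ℕ} (G : SimpleGraph (Fin n))
    (q : ℕ) (es : Fin m → Fin n × Fin n) (t : ℕ) : ℝ :=
  ((WordRAM.run (WordRAM.wordBound c n) t ⟨[P], input q es⟩).toOuterMeasure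
    {r | r.todo = [] ∧ IsOutput G q es r.mem}).toReal

end EdgeColoringProblem

/-! The program colors one more edge at a time, as in Vizing's proof, with random choices. Let `D`
be the maximum degree, `κ = q - D` and `ρ = q / κ`, which is at most `4 / ε`. Under any proper
partial coloring every vertex misses at least `κ` colors (`Valid.le_card_miss`), so rejection
sampling finds a uniformly random missing color in `O(ρ)` expected draws. One augmentation picks a
random uncolored edge, its first endpoint `x`, and a random color `α` missing at `x`. It then grows
a fan at `x`, drawing at the current last leaf a random color `β` missing there. If `β` is present
at `x` and missing at no earlier leaf, the `β`-edge at `x` becomes the next fan edge. Otherwise the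
walk from `x` that alternates between `β` and `α` is flipped, and the colors of the fan are shifted
up to the first or the last leaf missing `β`, whichever the flip leaves without `β` (`Fan.flip`,
`Shiftable.step`).

Fans are short in expectation: either at least half of the colors missing at the new leaf end the
fan, or at least `κ / 2` of them were missing at no earlier leaf, which can happen only `O(ρ)` times
(`fanValue_drift`). Walks are short on average: a vertex on a walk together with the next color and
the other color determines where the walk started, so all walks from all `(x, α, β)` with `α`
missing at `x` have total length at most `2 * m * q` (`sum_walkLen_le`). With `k` uncolored edges,
the choice of the edge contributes weight `1 / k`, the choice of `α` at most `1 / κ`, and the choice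
of `β` at most `1 / κ` in each of `O(ρ)` fan steps. As `x` is the first endpoint of at most `D`
uncolored edges, the expected walk cost is `O(ρ * D * m * q / (k * κ ^ 2))`, which is `O(ρ ^ 3 * m /
k)`. Summing over `k` bounds the expected time by some `B` of order `m * log n / ε ^ 3`.

High probability needs more than Markov's inequality. The calculus `wp` becomes infinite as soon as
the bound exceeds `B` anywhere along a run, so a finite value certifies expected remaining time at
most `B` from every reachable configuration. The failure probability then decays like `(1 + 1 / (2 *
B)) ^ (-t)` (`toOuterMeasure_run_mul_pow_le`), and `t = 3 * B * (a + 1) * log n` steps suffice. -/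

namespace WordRAM
open scoped ENNReal

/-! ### Capped expected running time and the tail of the halting time -/

/-- Identity up to the threshold `B`, and `⊤` beyond it. -/
noncomputable def cap (B : ℝ) (x : ℝ≥0∞) : ℝ≥0∞ := if x ≤ ENNReal.ofReal B then x else ⊤

theorem cap_mono (B : ℝ) : Monotone (cap B) := by
  intro x y h
  unfold cap
  split_ifs with h1 h2 h2
  · exact h
  · simp
  · exact absurd (h.trans h2) h1
  · simp

theorem cap_le {B X : ℝ} {x : ℝ≥0∞} (h : x ≤ ENNReal.ofReal X) (hX : X ≤ B) :
    cap B x ≤ ENNReal.ofReal X := by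
  unfold cap
  rw [if_pos (h.trans (ENNReal.ofReal_le_ofReal hX))]
  exact h

/-- Upper bound on the expected number of steps of a command plus the expected value of `f` in
the final memory, which is infinite as soon as the bound exceeds `B` at a reachable
configuration. Loops are interpreted by least fixed points. -/
noncomputable def wp (W : ℕ) (B : ℝ) : Cmd → (Store → ℝ≥0∞) → Store → ℝ≥0∞
  | .skip, f, s => cap B (1 + f s)
  | .assign x e, f, s => cap B (1 + f (s.setReg x (e.eval W s)))
  | .store a i e, f, s => cap B (1 + f (s.setArr a (i.eval W s) (e.eval W s)))
  | .rand x e, f, s => cap B (1 + ∑' v, uniformBelow (e.eval W s) v * f (s.setReg x v))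
  | .seq p q, f, s => cap B (1 + wp W B p (wp W B q f) s)
  | .ite e p q, f, s => cap B (1 + if e.eval W s ≠ 0 then wp W B p f s else wp W B q f s)
  | .loop e p, f, s =>
      sInf {X : Store → ℝ≥0∞ | ∀ s,
        cap B (1 + if e.eval W s ≠ 0 then wp W B p X s else f s) ≤ X s} s

variable {W : ℕ} {B : ℝ}

theorem wp_mono (p : Cmd) {f g : Store → ℝ≥0∞} (h : f ≤ g) : wp W B p f ≤ wp W B p g := by
  induction p generalizing f g with
  | skip => intro s; exact cap_mono B (add_le_add le_rfl (h _))
  | assign x e => intro s; exact cap_mono B (add_le_add le_rfl (h _))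
  | store a i e => intro s; exact cap_mono B (add_le_add le_rfl (h _))
  | rand x e =>
    intro s
    exact cap_mono B (add_le_add le_rfl (ENNReal.tsum_le_tsum fun v => mul_le_mul_right (h _) _))
  | seq p q hp hq => intro s; exact cap_mono B (add_le_add le_rfl (hp (hq h) s))
  | ite e p q hp hq =>
    intro s
    refine cap_mono B (add_le_add le_rfl ?_)
    split_ifs
    · exact hp h s
    · exact hq h s
  | loop e p hp =>
    refine sInf_le_sInf ?_
    intro X hX s
    refine le_trans (cap_mono B (add_le_add le_rfl ?_)) (hX s)
    split_ifs
    · exact le_rfl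
    · exact h s

theorem wp_loop_le {e : Expr} {p : Cmd} {f I : Store → ℝ≥0∞}
    (hI : ∀ s, cap B (1 + if e.eval W s ≠ 0 then wp W B p I s else f s) ≤ I s) :
    wp W B (.loop e p) f ≤ I :=
  sInf_le hI

/-- Together with `wp_loop_unfold` this is Knaster–Tarski: by monotonicity the infimum of the
prefixed points is prefixed, and its unfolding is prefixed as well, hence not smaller than the
infimum. -/
theorem wp_loop_ge (e : Expr) (p : Cmd) (f : Store → ℝ≥0∞) (s : Store) :
    cap B (1 + if e.eval W s ≠ 0 then wp W B p (wp W B (.loop e p) f) s else f s) ≤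
      wp W B (.loop e p) f s := by
  conv_rhs => rw [wp]
  rw [sInf_apply]
  refine le_iInf fun X => ?_
  refine le_trans (cap_mono B (add_le_add le_rfl ?_)) (X.2 s)
  split_ifs
  · exact wp_mono p (sInf_le X.2) s
  · exact le_rfl

theorem wp_loop_unfold (e : Expr) (p : Cmd) (f : Store → ℝ≥0∞) (s : Store) :
    wp W B (.loop e p) f s ≤
      cap B (1 + if e.eval W s ≠ 0 then wp W B p (wp W B (.loop e p) f) s else f s) := by
  refine wp_loop_le (I := fun s => cap B (1 + if e.eval W s ≠ 0 then
    wp W B p (wp W B (.loop e p) f) s else f s)) (fun s => ?_) s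
  refine cap_mono B (add_le_add le_rfl ?_)
  split_ifs
  · exact wp_mono p (wp_loop_ge e p f) s
  · exact le_rfl

/-- The bound `wp` for a list of commands. -/
noncomputable def wpList (W : ℕ) (B : ℝ) (f : Store → ℝ≥0∞) : List Cmd → Store → ℝ≥0∞
  | [] => f
  | p :: k => wp W B p (wpList W B f k)

theorem tsum_pure_mul {α : Type*} (a : α) (g : α → ℝ≥0∞) :
    ∑' x, (PMF.pure a) x * g x = g a := by
  rw [tsum_eq_single a]
  · simp
  · intro b hb; simp [PMF.pure_apply, hb]

theorem tsum_map_mul {α β : Type*} (p : PMF α) (h : α → β) (g : β → ℝ≥0∞) :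
    ∑' y, (p.map h) y * g y = ∑' x, p x * g (h x) := by
  simp_rw [PMF.map_apply, ← ENNReal.tsum_mul_right]
  rw [ENNReal.tsum_comm]
  refine tsum_congr fun x => ?_
  rw [tsum_eq_single (h x)]
  · simp
  · intro b hb; simp [hb]

/-- The link between the calculus and the machine: the bound decreases by at least one in
expectation at every step, and the cap is passed at every configuration. -/
theorem step_le_wpList (f : Store → ℝ≥0∞) (p : Cmd) (k : List Cmd) (s : Store) :
    cap B (1 + ∑' c, step W ⟨p :: k, s⟩ c * wpList W B f c.todo c.mem) ≤
      wpList W B f (p :: k) s := by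
  cases p with
  | skip => simp only [step, tsum_pure_mul, wpList, wp, le_refl]
  | assign x e => simp only [step, tsum_pure_mul, wpList, wp, le_refl]
  | store a i e => simp only [step, tsum_pure_mul, wpList, wp, le_refl]
  | rand x e => simp only [step, tsum_map_mul, wpList, wp, le_refl]
  | seq p q => simp only [step, tsum_pure_mul, wpList, wp, le_refl]
  | ite e p q =>
    simp only [step, tsum_pure_mul, wpList, wp]
    split_ifs <;> simp [wpList]
  | loop e p =>
    refine le_trans (cap_mono B (add_le_add le_rfl ?_)) (wp_loop_ge e p _ s)
    simp only [step, tsum_pure_mul]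
    split_ifs <;> simp [wpList]

theorem run_halted (t : ℕ) (s : Store) : run W t ⟨[], s⟩ = PMF.pure ⟨[], s⟩ := by
  induction t with
  | zero => rfl
  | succ t ih => rw [run, step, PMF.pure_bind, ih]

/-- Exponential tail of the halting time from a bound on the expected halting time that holds at
all reachable configurations. -/
theorem toOuterMeasure_run_mul_pow_le (hB : 0 < B) (Q : Store → Prop) (f : Store → ℝ≥0∞)
    (hf : ∀ s, ¬ Q s → f s = ⊤) (t : ℕ) (c : Config) :
    (run W t c).toOuterMeasure {r | r.todo = [] ∧ Q r.mem}ᶜ * ENNReal.ofReal (1 + 1 / (2 * B)) ^ t ≤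
      1 + wpList W B f c.todo c.mem / ENNReal.ofReal B := by
  induction t generalizing c with
  | zero =>
    rw [pow_zero, mul_one]
    refine le_trans ?_ le_self_add
    rw [PMF.toOuterMeasure_apply, ← PMF.tsum_coe (run W 0 c)]
    exact ENNReal.tsum_le_tsum fun x => Set.indicator_le_self _ _ x
  | succ t ih =>
    obtain ⟨k, s⟩ := c
    cases k with
    | nil =>
      -- A halted run fails only if the memory violates `Q`, and there `f` makes the right-hand side
      -- infinite.
      by_cases hQ : Q s
      · rw [run_halted, PMF.toOuterMeasure_pure_apply]
        simp [hQ]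
      · simp only [wpList, hf s hQ]
        rw [ENNReal.top_div_of_ne_top ENNReal.ofReal_ne_top]
        simp
    | cons p k =>
      have hstep := step_le_wpList (W := W) (B := B) f p k s
      set X := wpList W B f (p :: k) s with hX
      set Y := ∑' c, step W ⟨p :: k, s⟩ c * wpList W B f c.todo c.mem with hY
      have hb0 : ENNReal.ofReal B ≠ 0 := by simpa using hB
      have hbt : ENNReal.ofReal B ≠ ⊤ := ENNReal.ofReal_ne_top
      by_cases hXt : X = ⊤
      · change _ ≤ 1 + X / _
        rw [hXt, ENNReal.top_div_of_ne_top hbt]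
        simp
      -- Finiteness of `X` rules out the second branch of `cap`; this is where the uniform bound `1
      -- + Y ≤ B` comes from.
      have hcap : 1 + Y ≤ ENNReal.ofReal B ∧ 1 + Y ≤ X := by
        unfold cap at hstep
        split_ifs at hstep with h
        · exact ⟨h, hstep⟩
        · exact absurd (top_le_iff.1 hstep) hXt
      have key : (run W (t + 1) ⟨p :: k, s⟩).toOuterMeasure {r | r.todo = [] ∧ Q r.mem}ᶜ *
          ENNReal.ofReal (1 + 1 / (2 * B)) ^ t ≤ 1 + Y / ENNReal.ofReal B := by
        rw [run, PMF.toOuterMeasure_bind_apply, ← ENNReal.tsum_mul_right]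
        calc _ ≤ ∑' c, step W ⟨p :: k, s⟩ c *
              (1 + wpList W B f c.todo c.mem / ENNReal.ofReal B) := by
              refine ENNReal.tsum_le_tsum fun c => ?_
              rw [mul_assoc]
              exact mul_le_mul_right (ih c) _
          _ = 1 + Y / ENNReal.ofReal B := by
              simp_rw [mul_add, mul_one, ENNReal.tsum_add, PMF.tsum_coe, div_eq_mul_inv,
                ← mul_assoc, ENNReal.tsum_mul_right, hY]
      rw [pow_succ, ← mul_assoc]
      refine le_trans (mul_le_mul_left key _) ?_
      change _ ≤ 1 + X / _
      have hYt : Y ≠ ⊤ := by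
        intro h; rw [h] at hcap; simp at hcap
      obtain ⟨y, hy0, hyy⟩ : ∃ y : ℝ, 0 ≤ y ∧ Y = ENNReal.ofReal y :=
        ⟨Y.toReal, ENNReal.toReal_nonneg, (ENNReal.ofReal_toReal hYt).symm⟩
      obtain ⟨x, hx0, hxx⟩ : ∃ x : ℝ, 0 ≤ x ∧ X = ENNReal.ofReal x :=
        ⟨X.toReal, ENNReal.toReal_nonneg, (ENNReal.ofReal_toReal hXt).symm⟩
      rw [hxx, hyy] at hcap
      rw [hxx, hyy]
      rw [← ENNReal.ofReal_one, ← ENNReal.ofReal_add zero_le_one hy0] at hcap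
      rw [ENNReal.ofReal_le_ofReal_iff hB.le, ENNReal.ofReal_le_ofReal_iff hx0] at hcap
      rw [← ENNReal.ofReal_div_of_pos hB, ← ENNReal.ofReal_div_of_pos hB, ← ENNReal.ofReal_one,
        ← ENNReal.ofReal_add zero_le_one (by positivity),
        ← ENNReal.ofReal_add zero_le_one (by positivity), ← ENNReal.ofReal_mul (by positivity)]
      refine ENNReal.ofReal_le_ofReal ?_
      -- Since `y ≤ B`, the extra factor costs at most `2 / (2 * B) = 1 / B`, which the unit of time
      -- in `1 + y ≤ x` pays for.
      have h1 : y / B ≤ 1 := by rw [div_le_one hB]; linarith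
      have h2 : (1 + y / B) * (1 / (2 * B)) ≤ 2 * (1 / (2 * B)) :=
        mul_le_mul_of_nonneg_right (by linarith) (by positivity)
      have h3 : (2 : ℝ) * (1 / (2 * B)) = 1 / B := by field_simp
      have h4 : (1 + y) / B ≤ x / B := div_le_div_of_nonneg_right hcap.2 hB.le
      rw [add_div] at h4
      nlinarith [h1, h2, h3, h4]

/-! ### Rules for commands of bounded running time -/

/-- From the memory `s`, the command `p` takes at most `K` steps and ends in `Q`. -/
def Det (W : ℕ) (B : ℝ) (p : Cmd) (s : Store) (K : ℝ) (Q : Store → Prop) : Prop :=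
  ∀ (f : Store → ℝ≥0∞) (X : ℝ), 0 ≤ X → (∀ s', Q s' → f s' ≤ ENNReal.ofReal X) → X + K ≤ B →
    wp W B p f s ≤ ENNReal.ofReal (X + K)

theorem one_add_ofReal_le {x : ℝ≥0∞} {X Y : ℝ} (h : x ≤ ENNReal.ofReal X) (h0 : 0 ≤ X)
    (hY : X + 1 ≤ Y) : 1 + x ≤ ENNReal.ofReal Y := by
  calc 1 + x ≤ ENNReal.ofReal 1 + ENNReal.ofReal X := by
        rw [ENNReal.ofReal_one]; exact add_le_add le_rfl h
    _ = ENNReal.ofReal (1 + X) := (ENNReal.ofReal_add zero_le_one h0).symm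
    _ ≤ _ := ENNReal.ofReal_le_ofReal (by linarith)

theorem Det.mono {p : Cmd} {s : Store} {K K' : ℝ} {Q Q' : Store → Prop}
    (h : Det W B p s K Q) (hK : K ≤ K') (hQ : ∀ s', Q s' → Q' s') :
    Det W B p s K' Q' := by
  intro f X hX hf hB
  exact (h f X hX (fun s' h' => hf s' (hQ s' h')) (by linarith)).trans
    (ENNReal.ofReal_le_ofReal (by linarith))

theorem Det.assign (x : ℕ) (e : Expr) (s : Store) :
    Det W B (.assign x e) s 1 (· = s.setReg x (e.eval W s)) := by
  intro f X hX hf hB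
  exact cap_le (one_add_ofReal_le (hf _ rfl) hX le_rfl) hB

theorem Det.store (a : ℕ) (i e : Expr) (s : Store) :
    Det W B (.store a i e) s 1 (· = s.setArr a (i.eval W s) (e.eval W s)) := by
  intro f X hX hf hB
  exact cap_le (one_add_ofReal_le (hf _ rfl) hX le_rfl) hB

theorem wp_seq_le {p q : Cmd} {f : Store → ℝ≥0∞} {s : Store} {X : ℝ} (hX : 0 ≤ X)
    (h : wp W B p (wp W B q f) s ≤ ENNReal.ofReal X) (hB : X + 1 ≤ B) :
    wp W B (.seq p q) f s ≤ ENNReal.ofReal (X + 1) :=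
  cap_le (one_add_ofReal_le h hX le_rfl) hB

theorem Det.seq {p q : Cmd} {s : Store} {K K' : ℝ} {Q Q' : Store → Prop}
    (hK : 0 ≤ K) (hK' : 0 ≤ K') (hp : Det W B p s K Q) (hq : ∀ s', Q s' → Det W B q s' K' Q') :
    Det W B (.seq p q) s (K + K' + 1) Q' := by
  intro f X hX hf hB
  have := wp_seq_le (W := W) (B := B) (p := p) (q := q) (f := f) (s := s) (X := X + K' + K)
    (by linarith) (hp _ _ (by linarith)
      (fun s' hs' => hq s' hs' f X hX hf (by linarith)) (by linarith)) (by linarith)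
  exact this.trans (ENNReal.ofReal_le_ofReal (by linarith))

theorem Det.ite {e : Expr} {p q : Cmd} {s : Store} {K : ℝ} {Q : Store → Prop} (hK : 0 ≤ K)
    (hp : e.eval W s ≠ 0 → Det W B p s K Q) (hq : e.eval W s = 0 → Det W B q s K Q) :
    Det W B (.ite e p q) s (K + 1) Q := by
  intro f X hX hf hB
  rw [wp]
  refine cap_le (one_add_ofReal_le (X := X + K) ?_ (by linarith) (by linarith)) (by linarith)
  split_ifs with h
  · exact hp h f X hX hf (by linarith)
  · exact hq (not_not.1 h) f X hX hf (by linarith)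

/-- A loop that is executed exactly `N` times. -/
theorem Det.loop {e : Expr} {p : Cmd} {K : ℝ} (hK : 0 ≤ K) (Inv : ℕ → Store → Prop) (N : ℕ)
    (hbody : ∀ t < N, ∀ s, Inv t s → e.eval W s ≠ 0 ∧ Det W B p s K (Inv (t + 1)))
    (hexit : ∀ s, Inv N s → e.eval W s = 0) {s : Store} (hs : Inv 0 s) :
    Det W B (.loop e p) s ((K + 1) * N + 1) (Inv N) := by
  intro f X hX hf hB
  have main : ∀ d t, t + d = N → ∀ s, Inv t s →
      wp W B (.loop e p) f s ≤ ENNReal.ofReal (X + ((K + 1) * d + 1)) := by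
    intro d
    induction d with
    | zero =>
      intro t ht s hs
      obtain rfl : t = N := by omega
      refine (wp_loop_unfold e p f s).trans ?_
      have hN : 0 ≤ (K + 1) * (t : ℝ) := by positivity
      refine cap_le (one_add_ofReal_le (X := X) ?_ hX (by simp)) (by simp; linarith)
      rw [if_neg (by simp [hexit s hs])]
      exact hf s hs
    | succ d ih =>
      intro t ht s hs
      refine (wp_loop_unfold e p f s).trans ?_
      obtain ⟨h1, h2⟩ := hbody t (by omega) s hs
      have hd0 : 0 ≤ (K + 1) * (d : ℝ) := by positivity
      have hdN : (K + 1) * ((d : ℝ) + 1) ≤ (K + 1) * N := by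
        refine mul_le_mul_of_nonneg_left ?_ (by linarith)
        exact_mod_cast (by omega : d + 1 ≤ N)
      push_cast
      refine cap_le (one_add_ofReal_le (X := X + ((K + 1) * d + 1) + K) ?_ (by linarith)
        (by linarith)) (by linarith)
      rw [if_pos h1]
      exact h2 _ _ (by linarith) (fun s' hs' => ih (t + 1) (by omega) s' hs') (by linarith)
  exact main N 0 (by omega) s hs

/-! ### Random choices: potentials and rejection sampling -/

/-- Bound for a loop by a potential that decreases in expectation. -/
theorem wp_loop_le_of_potential {e : Expr} {p : Cmd} {f : Store → ℝ≥0∞} (Inv : Store → Prop)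
    (pot : Store → ℝ) (hpot : ∀ s, Inv s → pot s ≤ B)
    (hbody : ∀ s, Inv s → e.eval W s ≠ 0 → ∀ g : Store → ℝ≥0∞,
      (∀ s', Inv s' → g s' ≤ ENNReal.ofReal (pot s')) →
        ∃ Y, 0 ≤ Y ∧ Y + 1 ≤ pot s ∧ wp W B p g s ≤ ENNReal.ofReal Y)
    (hexit : ∀ s, Inv s → e.eval W s = 0 →
      ∃ Y, 0 ≤ Y ∧ Y + 1 ≤ pot s ∧ f s ≤ ENNReal.ofReal Y)
    {s : Store} (hs : Inv s) : wp W B (.loop e p) f s ≤ ENNReal.ofReal (pot s) := by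
  classical
  -- The potential, extended by `⊤` outside the invariant, is a prefixed point; nothing has to be
  -- checked where it is infinite.
  have := wp_loop_le (W := W) (B := B) (e := e) (p := p) (f := f)
    (I := fun s => if Inv s then ENNReal.ofReal (pot s) else ⊤) (fun s => ?_) s
  · simpa [hs] using this
  · by_cases hI : Inv s
    · simp only [hI, if_true]
      by_cases he : e.eval W s = 0
      · obtain ⟨Y, h0, h1, h2⟩ := hexit s hI he
        rw [if_neg (by simp [he])]
        exact cap_le (one_add_ofReal_le h2 h0 h1) (hpot s hI)
      · obtain ⟨Y, h0, h1, h2⟩ := hbody s hI he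
          (fun s => if Inv s then ENNReal.ofReal (pot s) else ⊤) (fun s' hs' => by simp [hs'])
        rw [if_pos he]
        exact cap_le (one_add_ofReal_le h2 h0 h1) (hpot s hI)
    · simp [hI]

theorem tsum_uniformBelow_mul {N : ℕ} (hN : 0 < N) (g : ℕ → ℝ≥0∞) :
    ∑' v, uniformBelow N v * g v = (N : ℝ≥0∞)⁻¹ * ∑ v ∈ Finset.range N, g v := by
  obtain ⟨k, rfl⟩ : ∃ k, N = k + 1 := ⟨N - 1, by omega⟩
  rw [tsum_eq_sum (s := Finset.range (k + 1)), Finset.mul_sum]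
  · refine Finset.sum_congr rfl fun v hv => ?_
    have h := PMF.uniformOfFinset_apply_of_mem (s := Finset.range (k + 1)) ⟨0, by simp⟩ hv
    rw [Finset.card_range] at h
    exact congrArg (· * g v) h
  · intro v hv
    have h := PMF.uniformOfFinset_apply_of_notMem (s := Finset.range (k + 1)) ⟨0, by simp⟩ hv
    exact (congrArg (· * g v) h).trans (zero_mul _)

theorem wp_rand_le {x : ℕ} {e : Expr} {f : Store → ℝ≥0∞} {s : Store} {N : ℕ}
    (hN : 0 < N) (he : e.eval W s = N) (X : ℕ → ℝ) (hX : ∀ v < N, 0 ≤ X v)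
    (hf : ∀ v < N, f (s.setReg x v) ≤ ENNReal.ofReal (X v)) {Y : ℝ}
    (hY : (∑ v ∈ Finset.range N, X v) / N + 1 ≤ Y) (hYB : Y ≤ B) :
    wp W B (.rand x e) f s ≤ ENNReal.ofReal Y := by
  have hN' : (0 : ℝ) < N := by exact_mod_cast hN
  have hS : 0 ≤ ∑ v ∈ Finset.range N, X v :=
    Finset.sum_nonneg fun v hv => hX v (Finset.mem_range.1 hv)
  rw [wp, he, tsum_uniformBelow_mul hN]
  refine cap_le (one_add_ofReal_le ?_ (div_nonneg hS hN'.le) hY) hYB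
  rw [ENNReal.ofReal_div_of_pos hN', ENNReal.ofReal_natCast, mul_comm, div_eq_mul_inv]
  refine mul_le_mul_left ?_ _
  rw [ENNReal.ofReal_sum_of_nonneg fun v hv => hX v (Finset.mem_range.1 hv)]
  exact Finset.sum_le_sum fun v hv => hf v (Finset.mem_range.1 hv)

/-- Draw an element until the test expression evaluates to `0`. -/
def sample (x : ℕ) (e test : Expr) : Cmd := .seq (.rand x e) (.loop test (.rand x e))

/-- A draw is accepted with probability `S.card / N`, so `N / S.card` draws are expected, each
costing two steps (the draw, and a `seq` or a loop test). The accepted value is uniform on `S`. -/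
theorem wp_sample_le {x : ℕ} {e test : Expr} {f : Store → ℝ≥0∞} {s : Store} {N : ℕ}
    (he : ∀ v < N, e.eval W (s.setReg x v) = N) (he' : e.eval W s = N) (S : Finset ℕ)
    (hS : S.Nonempty) (hSN : S ⊆ Finset.range N)
    (htest : ∀ v < N, test.eval W (s.setReg x v) = 0 ↔ v ∈ S)
    (X : ℕ → ℝ) (hX : ∀ v ∈ S, 0 ≤ X v)
    (hf : ∀ v ∈ S, f (s.setReg x v) ≤ ENNReal.ofReal (X v)) (hXB : ∀ v ∈ S, X v + 1 ≤ B)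
    {Y : ℝ} (hY : (∑ v ∈ S, X v) / S.card + 2 * (N : ℝ) / S.card + 1 ≤ Y) (hYB : Y ≤ B) :
    wp W B (sample x e test) f s ≤ ENNReal.ofReal Y := by
  classical
  obtain ⟨v0, hv0⟩ := hS
  have hN : 0 < N := lt_of_le_of_lt (Nat.zero_le _) (Finset.mem_range.1 (hSN hv0))
  have hg : (0 : ℝ) < S.card := by exact_mod_cast Finset.card_pos.2 ⟨v0, hv0⟩
  have hN' : (0 : ℝ) < N := by exact_mod_cast hN
  have hgN : (S.card : ℝ) ≤ N := by
    exact_mod_cast (Finset.card_le_card hSN).trans (by simp)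
  set A := ∑ v ∈ S, X v with hA
  have hA0 : 0 ≤ A := Finset.sum_nonneg hX
  set D := A / S.card + 2 * (N : ℝ) / S.card + 1 with hD
  have hD0 : 0 ≤ D := by positivity
  have hDB : D ≤ B := hY.trans hYB
  -- The cost after a draw: an accepted value pays for the last loop test, and a rejected value
  -- starts afresh at `D`. The value of `D` solves the resulting linear equation `hsum`.
  let X' : ℕ → ℝ := fun v => if v ∈ S then X v + 1 else D
  have hX' : ∀ v < N, 0 ≤ X' v := by
    intro v hv
    simp only [X']
    split_ifs with h
    · have := hX v h; linarith
    · exact hD0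
  have hsum : (∑ v ∈ Finset.range N, X' v) / N + 2 = D := by
    have h1 : ∑ v ∈ Finset.range N, X' v = (A + S.card) + (N - S.card) * D := by
      rw [← Finset.sum_sdiff hSN, add_comm]
      congr 1
      · rw [Finset.sum_congr rfl (g := fun v => X v + 1) (fun v hv => by simp [X', hv]),
          Finset.sum_add_distrib]
        simp [hA]
      · rw [Finset.sum_congr rfl (g := fun v => D)
          (fun v hv => by simp [X', (Finset.mem_sdiff.1 hv).2]), Finset.sum_const,
          Finset.card_sdiff_of_subset hSN, nsmul_eq_mul, Nat.cast_sub (Finset.card_le_card hSN)]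
        simp
    rw [h1, hD]
    field_simp
    ring
  have hsetset : ∀ v w, (s.setReg x v).setReg x w = s.setReg x w := by
    intro v w; simp [Store.setReg]
  have hloop : ∀ v < N, wp W B (.loop test (.rand x e)) f (s.setReg x v) ≤
      ENNReal.ofReal (X' v) := by
    let pot : Store → ℝ := fun s' => X' (s'.reg x)
    have hpoteq : ∀ v, pot (s.setReg x v) = X' v := by
      intro v; simp [pot, Store.setReg]
    intro v hv
    rw [← hpoteq v]
    refine wp_loop_le_of_potential (fun s' => ∃ v < N, s' = s.setReg x v) pot ?_ ?_ ?_
      ⟨v, hv, rfl⟩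
    · rintro _ ⟨v, hv, rfl⟩
      rw [hpoteq]
      simp only [X']
      split_ifs with h
      · exact hXB v h
      · exact hDB
    · rintro _ ⟨v, hv, rfl⟩ hne g hg'
      rw [hpoteq]
      have hvS : v ∉ S := fun h => hne ((htest v hv).2 h)
      refine ⟨D - 1, by simp [hD]; positivity, by simp [X', hvS], ?_⟩
      refine wp_rand_le hN (he v hv) X' hX' (fun w hw => ?_) (by linarith) (by linarith)
      rw [hsetset, ← hpoteq]
      exact hg' _ ⟨w, hw, rfl⟩
    · rintro _ ⟨v, hv, rfl⟩ heq
      have hvS : v ∈ S := (htest v hv).1 heq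
      rw [hpoteq]
      exact ⟨X v, hX v hvS, by simp [X', hvS], hf v hvS⟩
  refine le_trans ?_ (ENNReal.ofReal_le_ofReal hY)
  rw [← sub_add_cancel D 1]
  refine wp_seq_le (by simp [hD]; positivity) ?_ (by linarith)
  exact wp_rand_le hN he' X' hX' hloop (by linarith) (by linarith)

/-! ### Straight-line code -/

/-- Straight-line programs: assignments to registers, and stores into arrays. -/
inductive Instr
  | assign (x : ℕ) (e : Expr)
  | store (a : ℕ) (i e : Expr)

/-- The command of an instruction. -/
def Instr.toCmd : Instr → Cmd
  | .assign x e => .assign x e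
  | .store a i e => .store a i e

/-- The effect of an instruction. -/
def Instr.exec (W : ℕ) : Instr → Store → Store
  | .assign x e, s => s.setReg x (e.eval W s)
  | .store a i e, s => s.setArr a (i.eval W s) (e.eval W s)

/-- The command that executes a list of instructions. -/
def block : List Instr → Cmd
  | [] => .skip
  | i :: l => .seq i.toCmd (block l)

/-- The effect of a list of instructions. -/
def execBlock (W : ℕ) : List Instr → Store → Store
  | [], s => s
  | i :: l, s => execBlock W l (i.exec W s)

theorem Det.block (l : List Instr) (s : Store) :
    Det W B (block l) s (2 * l.length + 1) (· = execBlock W l s) := by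
  induction l generalizing s with
  | nil =>
    intro f X hX hf hB
    simp only [List.length_nil, Nat.cast_zero, mul_zero, zero_add] at hB ⊢
    exact cap_le (one_add_ofReal_le (hf _ rfl) hX le_rfl) hB
  | cons i l ih =>
    have hi : Det W B i.toCmd s 1 (· = i.exec W s) := by
      cases i
      · exact Det.assign _ _ _
      · exact Det.store _ _ _ _
    refine (Det.seq zero_le_one (by positivity) hi (fun s' hs' => ?_)).mono
      (K := 1 + (2 * l.length + 1) + 1) ?_ (fun _ h => h)
    · subst hs'; exact ih _
    · push_cast [List.length_cons]; linarith

end WordRAM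

/-! ### Partial edge colorings stored as tables -/

namespace EdgeColoringProblem
open Finset

/-- `e` is an edge at `v`, where `eu` and `ev` list the endpoints. -/
def Inc (eu ev : ℕ → ℕ) (v e : ℕ) : Prop := eu e = v ∨ ev e = v

/-- The other endpoint of an edge `e` at `v`. -/
def other (eu ev : ℕ → ℕ) (v e : ℕ) : ℕ := eu e + ev e - v

/-- `eu` and `ev` list the endpoints of the `m` edges of a simple graph on `n` vertices with maximum
degree at most `D`. -/
structure Net (n m D : ℕ) (eu ev : ℕ → ℕ) : Prop where
  eu_lt : ∀ e < m, eu e < n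
  ev_lt : ∀ e < m, ev e < n
  ne : ∀ e < m, eu e ≠ ev e
  simple : ∀ e < m, ∀ f < m,
    (eu e = eu f ∧ ev e = ev f) ∨ (eu e = ev f ∧ ev e = eu f) → e = f
  deg : ∀ v < n, ∀ S ⊆ range m, (∀ e ∈ S, Inc eu ev v e) → S.card ≤ D

/-- `E` is the table of the edges by vertex and color (shifted by one, with `0` for none), and `col`
lists the colors (shifted by one, with `0` for none) of a proper partial edge coloring. -/
structure Valid (n m q : ℕ) (eu ev : ℕ → ℕ) (E : ℕ → ℕ → ℕ) (col : ℕ → ℕ) : Prop where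
  le : ∀ e < m, col e ≤ q
  iff : ∀ v < n, ∀ c < q, ∀ e, E v c = e + 1 ↔ e < m ∧ Inc eu ev v e ∧ col e = c + 1

/-- The colors missing at `v`. -/
def miss (q : ℕ) (E : ℕ → ℕ → ℕ) (v : ℕ) : Finset ℕ := (range q).filter fun c => E v c = 0

/-- The uncolored edges. -/
def uncolored (m : ℕ) (col : ℕ → ℕ) : Finset ℕ := (range m).filter fun e => col e = 0

section
variable {n m q D : ℕ} {eu ev : ℕ → ℕ} {E : ℕ → ℕ → ℕ} {col : ℕ → ℕ}

theorem mem_miss {v c : ℕ} : c ∈ miss q E v ↔ c < q ∧ E v c = 0 := by simp [miss]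

theorem mem_uncolored {e : ℕ} : e ∈ uncolored m col ↔ e < m ∧ col e = 0 := by simp [uncolored]

theorem other_cases {v e : ℕ} (h : Inc eu ev v e) :
    (eu e = v ∧ ev e = other eu ev v e) ∨ (ev e = v ∧ eu e = other eu ev v e) := by
  unfold Inc other at *; omega

theorem inc_other {v e : ℕ} (h : Inc eu ev v e) : Inc eu ev (other eu ev v e) e := by
  unfold Inc other at *; omega

theorem other_other {v e : ℕ} (h : Inc eu ev v e) : other eu ev (other eu ev v e) e = v := by
  unfold Inc other at *; omega

theorem eq_or_eq_other {v w e : ℕ} (h : Inc eu ev v e) (hw : Inc eu ev w e) :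
    w = v ∨ w = other eu ev v e := by
  unfold Inc other at *; omega

namespace Net
theorem lt_of_inc (hN : Net n m D eu ev) {v e : ℕ} (he : e < m) (h : Inc eu ev v e) : v < n := by
  rcases h with h | h
  · exact h ▸ hN.eu_lt e he
  · exact h ▸ hN.ev_lt e he

theorem other_lt (hN : Net n m D eu ev) {v e : ℕ} (he : e < m) (h : Inc eu ev v e) :
    other eu ev v e < n :=
  hN.lt_of_inc he (inc_other h)

theorem other_ne (hN : Net n m D eu ev) {v e : ℕ} (he : e < m) (h : Inc eu ev v e) :
    other eu ev v e ≠ v := by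
  have := hN.ne e he
  unfold Inc other at *; omega

theorem other_inj (hN : Net n m D eu ev) {v e f : ℕ} (he : e < m) (hf : f < m) (h : Inc eu ev v e)
    (h' : Inc eu ev v f) (heq : other eu ev v e = other eu ev v f) : e = f := by
  apply hN.simple e he f hf
  rcases other_cases h with h1 | h1 <;> rcases other_cases h' with h2 | h2 <;> omega

end Net

namespace Valid
theorem inj (hV : Valid n m q eu ev E col) {v e f : ℕ} (hv : v < n) (he : e < m) (hf : f < m)
    (h : Inc eu ev v e) (h' : Inc eu ev v f) (h0 : col e ≠ 0) (heq : col e = col f) : e = f := by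
  have hq := hV.le e he
  have h1 := (hV.iff v hv (col e - 1) (by omega) e).2 ⟨he, h, by omega⟩
  have h2 := (hV.iff v hv (col e - 1) (by omega) f).2 ⟨hf, h', by omega⟩
  omega

theorem spec (hN : Net n m D eu ev) (hV : Valid n m q eu ev E col) {v c : ℕ}
    (hv : v < n) (hc : c < q) (h : E v c ≠ 0) :
    E v c - 1 < m ∧ Inc eu ev v (E v c - 1) ∧ col (E v c - 1) = c + 1 ∧
      E (other eu ev v (E v c - 1)) c = E v c ∧ other eu ev v (E v c - 1) < n := by
  obtain ⟨h1, h2, h3⟩ := (hV.iff v hv c hc (E v c - 1)).1 (by omega)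
  have h4 := hN.other_lt h1 h2
  refine ⟨h1, h2, h3, ?_, h4⟩
  rw [(hV.iff _ h4 c hc (E v c - 1)).2 ⟨h1, inc_other h2, h3⟩]
  omega

/-- Distinct colors present at `v` sit on distinct edges at `v`, of which there are at most `D`. -/
theorem le_card_miss (hN : Net n m D eu ev) (hV : Valid n m q eu ev E col) {v : ℕ}
    (hv : v < n) : q ≤ D + (miss q E v).card := by
  classical
  have h1 := Finset.card_filter_add_card_filter_not (s := range q) (fun c => E v c = 0)
  rw [card_range] at h1
  have h2 : ((range q).filter fun c => ¬ E v c = 0).card ≤ D := by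
    rw [← Finset.card_image_of_injOn (f := fun c => E v c - 1)]
    · refine hN.deg v hv _ ?_ ?_
      · intro e he
        obtain ⟨c, hc, rfl⟩ := Finset.mem_image.1 he
        simp only [mem_filter, mem_range] at hc
        exact mem_range.2 (spec hN hV hv hc.1 hc.2).1
      · intro e he
        obtain ⟨c, hc, rfl⟩ := Finset.mem_image.1 he
        simp only [mem_filter, mem_range] at hc
        exact (spec hN hV hv hc.1 hc.2).2.1
    · intro c hc d hd hcd
      simp only [coe_filter, mem_range, Set.mem_ofPred_eq] at hc hd hcd
      have h3 := (spec hN hV hv hc.1 hc.2).2.2.1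
      have h4 := (spec hN hV hv hd.1 hd.2).2.2.1
      rw [hcd] at h3
      omega
  unfold miss
  omega

/-- The handshake argument: a nonzero entry at `(v, c)` is a colored edge together with one of its
two ends, recorded by the Boolean that tells whether `v` is the first endpoint. -/
theorem sum_card_le (hN : Net n m D eu ev) (hV : Valid n m q eu ev E col) :
    ∑ v ∈ range n, ((range q).filter fun c => E v c ≠ 0).card ≤ 2 * m := by
  classical
  rw [← Finset.card_sigma]
  have : (range m ×ˢ (univ : Finset Bool)).card = 2 * m := by simp [mul_comm]
  rw [← this]
  refine Finset.card_le_card_of_injOn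
    (fun p => (E p.1 p.2 - 1, decide (eu (E p.1 p.2 - 1) = p.1))) ?_ ?_
  · rintro ⟨v, c⟩ h
    simp only [coe_sigma, Set.mem_sigma_iff, coe_range, Set.mem_Iio, coe_filter, mem_range,
      Set.mem_ofPred_eq] at h
    simp [(spec hN hV h.1 h.2.1 h.2.2).1, Classical.em]
  · rintro ⟨v, c⟩ h ⟨w, d⟩ h' heq
    simp only [coe_sigma, Set.mem_sigma_iff, coe_range, Set.mem_Iio, coe_filter, mem_range,
      Set.mem_ofPred_eq] at h h'
    obtain ⟨a1, a2, a3, -, -⟩ := spec hN hV h.1 h.2.1 h.2.2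
    obtain ⟨b1, b2, b3, -, -⟩ := spec hN hV h'.1 h'.2.1 h'.2.2
    simp only [Prod.mk.injEq, decide_eq_decide] at heq
    rw [← heq.1] at b2 b3
    have hcd : c = d := by omega
    have hvw : v = w := by
      rw [← heq.1] at heq
      have h2 := heq.2
      unfold Inc at a2 b2
      by_cases h3 : eu (E v c - 1) = v
      · rw [← h3, h2.1 h3]
      · have h4 : eu (E v c - 1) ≠ w := fun h => h3 (h2.2 h)
        rw [← a2.resolve_left h3, ← b2.resolve_left h4]
    subst hcd hvw
    rfl

end Valid

/-- Change one entry of a table. -/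
def upd (E : ℕ → ℕ → ℕ) (v c z : ℕ) : ℕ → ℕ → ℕ :=
  fun v' c' => if v' = v ∧ c' = c then z else E v' c'

theorem Valid.uncolor (hN : Net n m D eu ev) (hV : Valid n m q eu ev E col) {x e c : ℕ}
    (he : e < m) (hx : Inc eu ev x e) (hc : col e = c + 1) :
    Valid n m q eu ev (upd (upd E x c 0) (other eu ev x e) c 0) (Function.update col e 0) := by
  have hcq := hV.le e he
  have hxn := hN.lt_of_inc he hx
  have hyn := hN.other_lt he hx
  refine ⟨fun f hf => ?_, fun v hv d hd f => ?_⟩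
  · rw [Function.update_apply]; split_ifs
    · omega
    · exact hV.le f hf
  · have key := hV.iff v hv d hd f
    have hEx := (hV.iff x hxn c (by omega) e).2 ⟨he, hx, hc⟩
    have hEy := (hV.iff _ hyn c (by omega) e).2 ⟨he, inc_other hx, hc⟩
    unfold upd
    rw [Function.update_apply]
    by_cases h1 : v = other eu ev x e ∧ d = c
    · obtain ⟨rfl, rfl⟩ := h1
      simp only [and_self, if_true]
      refine iff_of_false (by omega) ?_
      rintro ⟨h1, h2, h3⟩
      split_ifs at h3 with h4
      have := key.2 ⟨h1, h2, h3⟩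
      omega
    · rw [if_neg h1]
      by_cases h2 : v = x ∧ d = c
      · obtain ⟨rfl, rfl⟩ := h2
        simp only [and_self, if_true]
        refine iff_of_false (by omega) ?_
        rintro ⟨h1, h2, h3⟩
        split_ifs at h3 with h4
        have := key.2 ⟨h1, h2, h3⟩
        omega
      · rw [if_neg h2, key]
        refine and_congr_right fun hf => and_congr_right fun hvf => ?_
        split_ifs with h3
        · subst h3
          refine iff_of_false (fun h => ?_) (by simp)
          rcases eq_or_eq_other hx hvf with h4 | h4
          · exact h2 ⟨h4, by omega⟩
          · exact h1 ⟨h4, by omega⟩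
        · rfl

theorem Valid.color (hV : Valid n m q eu ev E col) {x e c : ℕ}
    (he : e < m) (hx : Inc eu ev x e) (hcq : c < q) (h0 : col e = 0)
    (hEx : E x c = 0) (hEy : E (other eu ev x e) c = 0) :
    Valid n m q eu ev (upd (upd E x c (e + 1)) (other eu ev x e) c (e + 1))
      (Function.update col e (c + 1)) := by
  refine ⟨fun f hf => ?_, fun v hv d hd f => ?_⟩
  · rw [Function.update_apply]; split_ifs
    · omega
    · exact hV.le f hf
  · have key := hV.iff v hv d hd f
    unfold upd
    rw [Function.update_apply]
    by_cases h1 : v = other eu ev x e ∧ d = c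
    · obtain ⟨rfl, rfl⟩ := h1
      simp only [and_self, if_true]
      constructor
      · intro h
        obtain rfl : e = f := by omega
        exact ⟨he, inc_other hx, by simp⟩
      · rintro ⟨h1, h2, h3⟩
        split_ifs at h3 with h4
        · rw [h4]
        · have := key.2 ⟨h1, h2, h3⟩
          omega
    · rw [if_neg h1]
      by_cases h2 : v = x ∧ d = c
      · obtain ⟨rfl, rfl⟩ := h2
        simp only [and_self, if_true]
        constructor
        · intro h
          obtain rfl : e = f := by omega
          exact ⟨he, hx, by simp⟩
        · rintro ⟨h1, h2, h3⟩
          split_ifs at h3 with h4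
          · rw [h4]
          · have := key.2 ⟨h1, h2, h3⟩
            omega
      · rw [if_neg h2, key]
        refine and_congr_right fun hf => and_congr_right fun hvf => ?_
        split_ifs with h3
        · subst h3
          refine iff_of_false (by omega) (fun h => ?_)
          rcases eq_or_eq_other hx hvf with h4 | h4
          · exact h2 ⟨h4, by omega⟩
          · exact h1 ⟨h4, by omega⟩
        · rfl

/-! ### Alternating walks and their total length -/

/-- The color of the `t`-th edge of the walk that alternates between `β` and `α`. -/
def walkColor (α β t : ℕ) : ℕ := if t % 2 = 0 then β else α

/-- The `t`-th vertex of the walk from `x` that alternates between the colors `β` and `α`. -/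
def walkVertex (eu ev : ℕ → ℕ) (E : ℕ → ℕ → ℕ) (x α β : ℕ) : ℕ → ℕ
  | 0 => x
  | t + 1 => other eu ev (walkVertex eu ev E x α β t)
      (E (walkVertex eu ev E x α β t) (walkColor α β t) - 1)

/-- The table entry for the `t`-th edge of the walk. -/
def walkEntry (eu ev : ℕ → ℕ) (E : ℕ → ℕ → ℕ) (x α β t : ℕ) : ℕ :=
  E (walkVertex eu ev E x α β t) (walkColor α β t)

/-- The length of the walk. -/
noncomputable def walkLen (eu ev : ℕ → ℕ) (E : ℕ → ℕ → ℕ) (x α β : ℕ) : ℕ :=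
  sInf {t | walkEntry eu ev E x α β t = 0}

theorem walkColor_succ_succ (α β t : ℕ) : walkColor α β (t + 2) = walkColor α β t := by
  unfold walkColor; simp

theorem walkColor_lt {α β : ℕ} (hα : α < q) (hβ : β < q) (t : ℕ) : walkColor α β t < q := by
  unfold walkColor; split_ifs <;> assumption

theorem swap_walkColor (α β t : ℕ) :
    Equiv.swap α β (walkColor α β t) = walkColor α β (t + 1) := by
  unfold walkColor
  rcases Nat.mod_two_eq_zero_or_one t with h | h
  · rw [if_pos h, if_neg (by omega), Equiv.swap_apply_right]
  · rw [if_neg (by omega), if_pos (by omega), Equiv.swap_apply_left]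

section walk
variable {x α β : ℕ}

theorem walkVertex_lt (hN : Net n m D eu ev) (hV : Valid n m q eu ev E col) (hx : x < n)
    (hα : α < q) (hβ : β < q) {t : ℕ} (h : ∀ s < t, walkEntry eu ev E x α β s ≠ 0) :
    walkVertex eu ev E x α β t < n := by
  induction t with
  | zero => exact hx
  | succ t ih =>
    exact (Valid.spec hN hV (ih fun s hs => h s (by omega)) (walkColor_lt hα hβ t)
      (h t (by omega))).2.2.2.2

theorem walk_spec (hN : Net n m D eu ev) (hV : Valid n m q eu ev E col) (hx : x < n)
    (hα : α < q) (hβ : β < q) {t : ℕ} (h : ∀ s ≤ t, walkEntry eu ev E x α β s ≠ 0) :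
    walkEntry eu ev E x α β t - 1 < m ∧
    Inc eu ev (walkVertex eu ev E x α β t) (walkEntry eu ev E x α β t - 1) ∧
    col (walkEntry eu ev E x α β t - 1) = walkColor α β t + 1 ∧
    E (walkVertex eu ev E x α β (t + 1)) (walkColor α β t) = walkEntry eu ev E x α β t ∧
    walkVertex eu ev E x α β (t + 1) =
      other eu ev (walkVertex eu ev E x α β t) (walkEntry eu ev E x α β t - 1) ∧
    other eu ev (walkVertex eu ev E x α β (t + 1)) (walkEntry eu ev E x α β t - 1) =
      walkVertex eu ev E x α β t ∧
    walkVertex eu ev E x α β (t + 1) ≠ walkVertex eu ev E x α β t := by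
  have h1 := walkVertex_lt hN hV hx hα hβ (t := t) fun s hs => h s hs.le
  obtain ⟨a1, a2, a3, a4, a5⟩ := Valid.spec hN hV h1 (walkColor_lt hα hβ t) (h t le_rfl)
  exact ⟨a1, a2, a3, a4, rfl, other_other a2, hN.other_ne a1 a2⟩

/-- The edges of colors `α` and `β` form paths and cycles, and `x`, missing `α`, is an end of a
path. So the walk never returns to a vertex. -/
theorem walkVertex_injOn (hN : Net n m D eu ev) (hV : Valid n m q eu ev E col) (hx : x < n)
    (hα : α < q) (hβ : β < q) (hαx : E x α = 0) {t : ℕ}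
    (h : ∀ s < t, walkEntry eu ev E x α β s ≠ 0) :
    ∀ b ≤ t, ∀ a < b, walkVertex eu ev E x α β a ≠ walkVertex eu ev E x α β b := by
  intro b
  induction b using Nat.strong_induction_on with
  | _ b ih =>
  intro hb a hab heq
  obtain ⟨t', rfl⟩ : ∃ t', b = t' + 1 := ⟨b - 1, by omega⟩
  obtain ⟨s1, s2, s3, s4, s5, s6, s7⟩ := walk_spec hN hV hx hα hβ (t := t')
    fun s hs => h s (by omega)
  have hdist : ∀ a' b', a' ≤ t' → b' ≤ t' →
      walkVertex eu ev E x α β a' = walkVertex eu ev E x α β b' → a' = b' := by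
    intro a' b' ha' hb' he
    by_contra hne
    rcases lt_or_gt_of_ne hne with hlt | hlt
    · exact ih b' (by omega) (by omega) a' hlt he
    · exact ih a' (by omega) (by omega) b' hlt he.symm
  rw [← heq] at s4 s6 s7
  -- At a first repetition, the edge from `t'` enters the vertex `a`. Its color is either that of
  -- the edge leaving `a` or that of the edge entering `a` (for `a = 0`, the missing color `α`). By
  -- properness it would be that very edge, so `t'` would coincide with a neighbor of `a` on the
  -- walk.
  by_cases hpar : a % 2 = t' % 2
  · have hcc : walkColor α β a = walkColor α β t' := by unfold walkColor; rw [hpar]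
    have hee : walkEntry eu ev E x α β a = walkEntry eu ev E x α β t' := by
      rw [← s4, ← hcc]; rfl
    have hv : walkVertex eu ev E x α β (a + 1) = walkVertex eu ev E x α β t' := by
      rw [← s6, ← hee]; rfl
    by_cases hat : a = t'
    · subst hat; exact s7 rfl
    · have := hdist (a + 1) t' (by omega) le_rfl hv
      omega
  · obtain rfl | ⟨a', rfl⟩ : a = 0 ∨ ∃ a', a = a' + 1 := by
      rcases a with _ | a'
      · exact Or.inl rfl
      · exact Or.inr ⟨a', rfl⟩
    · have : walkColor α β t' = α := by unfold walkColor; rw [if_neg (by omega)]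
      rw [this] at s4
      exact h t' (by omega) (s4 ▸ hαx)
    · have hcc : walkColor α β a' = walkColor α β t' := by
        unfold walkColor
        rw [show a' % 2 = t' % 2 by omega]
      obtain ⟨-, -, -, r4, -, r6, -⟩ := walk_spec hN hV hx hα hβ (t := a')
        fun s hs => h s (by omega)
      have hee : walkEntry eu ev E x α β a' = walkEntry eu ev E x α β t' := by
        rw [← s4, ← hcc, r4]
      have := hdist a' t' (by omega) le_rfl (by rw [← r6, ← s6, hee])
      omega

theorem walkEntry_injOn (hN : Net n m D eu ev) (hV : Valid n m q eu ev E col) (hx : x < n)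
    (hα : α < q) (hβ : β < q) (hαx : E x α = 0) {t : ℕ}
    (h : ∀ s < t, walkEntry eu ev E x α β s ≠ 0) :
    ∀ b < t, ∀ a < b, walkEntry eu ev E x α β a ≠ walkEntry eu ev E x α β b := by
  intro b hb a hab heq
  have hinj := walkVertex_injOn hN hV hx hα hβ hαx h
  obtain ⟨-, r2, -⟩ := walk_spec hN hV hx hα hβ (t := a) fun s hs => h s (by omega)
  obtain ⟨-, s2, -, -, s5, -, -⟩ := walk_spec hN hV hx hα hβ (t := b) fun s hs => h s (by omega)
  rw [heq] at r2
  rcases eq_or_eq_other s2 r2 with h1 | h1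
  · exact hinj b hb.le a hab h1
  · exact hinj (b + 1) hb a (by omega) (h1.trans s5.symm)

theorem le_of_walkEntry_ne (hN : Net n m D eu ev) (hV : Valid n m q eu ev E col) (hx : x < n)
    (hα : α < q) (hβ : β < q) (hαx : E x α = 0) {t : ℕ}
    (h : ∀ s < t, walkEntry eu ev E x α β s ≠ 0) : t ≤ m := by
  have hinj := walkEntry_injOn hN hV hx hα hβ hαx h
  have : ((range t).image fun s => walkEntry eu ev E x α β s - 1) ⊆ range m := by
    intro e he
    obtain ⟨s, hs, rfl⟩ := Finset.mem_image.1 he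
    exact mem_range.2 (walk_spec hN hV hx hα hβ (t := s) fun s' hs' =>
      h s' (by have := mem_range.1 hs; omega)).1
  have h2 := card_le_card this
  rw [card_image_of_injOn, card_range, card_range] at h2
  · exact h2
  · intro a ha b hb heq
    simp only [coe_range, Set.mem_Iio] at ha hb heq
    have h3 := h a ha
    have h4 := h b hb
    by_contra hne
    rcases lt_or_gt_of_ne hne with hlt | hlt
    · exact hinj b hb a hlt (by omega)
    · exact hinj a ha b hlt (by omega)

/-- The `sInf` in `walkLen` is taken over a nonempty set: a walk that never ends would use `m + 1`
distinct edges. -/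
theorem walkLen_spec (hN : Net n m D eu ev) (hV : Valid n m q eu ev E col) (hx : x < n)
    (hα : α < q) (hβ : β < q) (hαx : E x α = 0) :
    walkEntry eu ev E x α β (walkLen eu ev E x α β) = 0 := by
  have : {t | walkEntry eu ev E x α β t = 0}.Nonempty := by
    by_contra hne
    rw [Set.not_nonempty_iff_eq_empty] at hne
    have h : ∀ s, walkEntry eu ev E x α β s ≠ 0 := by
      intro s hs
      have : s ∈ {t | walkEntry eu ev E x α β t = 0} := hs
      rw [hne] at this
      exact this
    have := le_of_walkEntry_ne hN hV hx hα hβ hαx (t := m + 1) fun s _ => h s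
    omega
  exact Nat.sInf_mem this

theorem walkEntry_ne_of_lt {s : ℕ} (hs : s < walkLen eu ev E x α β) :
    walkEntry eu ev E x α β s ≠ 0 := fun h => Nat.notMem_of_lt_sInf hs h

theorem walkLen_le (hN : Net n m D eu ev) (hV : Valid n m q eu ev E col) (hx : x < n)
    (hα : α < q) (hβ : β < q) (hαx : E x α = 0) : walkLen eu ev E x α β ≤ m :=
  le_of_walkEntry_ne hN hV hx hα hβ hαx fun _ hs => walkEntry_ne_of_lt hs

end walk

/-- A vertex of a walk, with the color ahead and the other color, determines the edge by which it
was entered, because that edge has the other color. Tracing back stops exactly where the other color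
is missing, which is the start. -/
theorem walk_start_unique (hN : Net n m D eu ev) (hV : Valid n m q eu ev E col) (t : ℕ) :
    ∀ t' x α β x' α' β', x < n → x' < n → α < q → β < q → α' < q → β' < q →
      E x α = 0 → E x' α' = 0 → t ≤ t' →
      t < walkLen eu ev E x α β → t' < walkLen eu ev E x' α' β' →
      walkVertex eu ev E x α β t = walkVertex eu ev E x' α' β' t' →
      walkColor α β t = walkColor α' β' t' →
      walkColor α β (t + 1) = walkColor α' β' (t' + 1) →
      x = x' ∧ α = α' ∧ β = β' ∧ t = t' := by
  induction t with
  | zero =>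
    intro t' x α β x' α' β' hx hx' hα hβ hα' hβ' h0 h0' htt ht ht' hv hc hd
    rcases t' with _ | t'
    · exact ⟨hv, hd, hc, rfl⟩
    · exfalso
      obtain ⟨-, -, -, r4, -⟩ := walk_spec hN hV hx' hα' hβ' (t := t')
        fun s hs => walkEntry_ne_of_lt (by omega)
      rw [← hv, ← walkColor_succ_succ, ← hd] at r4
      exact walkEntry_ne_of_lt (by omega : t' < _) (r4 ▸ h0)
  | succ t ih =>
    intro t' x α β x' α' β' hx hx' hα hβ hα' hβ' h0 h0' htt ht ht' hv hc hd
    rcases t' with _ | t'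
    · omega
    · obtain ⟨-, -, -, r4, -, r6, -⟩ := walk_spec hN hV hx hα hβ (t := t)
        fun s hs => walkEntry_ne_of_lt (by omega)
      obtain ⟨-, -, -, s4, -, s6, -⟩ := walk_spec hN hV hx' hα' hβ' (t := t')
        fun s hs => walkEntry_ne_of_lt (by omega)
      rw [walkColor_succ_succ, walkColor_succ_succ] at hd
      have hee : walkEntry eu ev E x α β t = walkEntry eu ev E x' α' β' t' := by
        rw [← r4, ← s4, hv, hd]
      obtain ⟨a1, a2, a3, a4⟩ := ih t' x α β x' α' β' hx hx' hα hβ hα' hβ' h0 h0' (by omega)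
        (by omega) (by omega) (by rw [← r6, ← s6, hv, hee]) hd hc
      exact ⟨a1, a2, a3, by omega⟩

/-- The total length of all alternating walks that start at a vertex where one of the two colors is
missing. -/
theorem sum_walkLen_le (hN : Net n m D eu ev) (hV : Valid n m q eu ev E col) :
    ∑ x ∈ range n, ∑ α ∈ miss q E x, ∑ β ∈ range q, walkLen eu ev E x α β ≤ 2 * m * q := by
  classical
  have e1 : ∑ x ∈ range n, ∑ α ∈ miss q E x, ∑ β ∈ range q, walkLen eu ev E x α β =
      ((range n).sigma fun x => (miss q E x).sigma fun α => (range q).sigma fun β =>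
        range (walkLen eu ev E x α β)).card := by
    simp [Finset.card_sigma]
  have e2 : (((range n).sigma fun v => (range q).filter fun c => E v c ≠ 0) ×ˢ range q).card ≤
      2 * m * q := by
    rw [card_product, card_sigma, card_range]
    exact Nat.mul_le_mul_right _ (Valid.sum_card_le hN hV)
  rw [e1]
  refine le_trans ?_ e2
  -- A position on a walk is mapped to its vertex and color ahead, a nonzero table entry (at most `2
  -- * m` of these), and to the other color (at most `q`). Injectivity is `walk_start_unique`.
  refine Finset.card_le_card_of_injOn
    (fun p => (⟨walkVertex eu ev E p.1 p.2.1 p.2.2.1 p.2.2.2,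
      walkColor p.2.1 p.2.2.1 p.2.2.2⟩, walkColor p.2.1 p.2.2.1 (p.2.2.2 + 1))) ?_ ?_
  · rintro ⟨x, α, β, t⟩ h
    simp only [coe_sigma, Set.mem_sigma_iff, mem_coe, mem_range, mem_miss] at h
    obtain ⟨hx, ⟨hα, h0⟩, hβ, ht⟩ := h
    simp only [coe_product, coe_sigma, Set.mem_prod, Set.mem_sigma_iff, mem_coe, mem_range,
      mem_filter]
    exact ⟨⟨walkVertex_lt hN hV hx hα hβ fun s hs => walkEntry_ne_of_lt (hs.trans ht),
      walkColor_lt hα hβ t, walkEntry_ne_of_lt ht⟩, walkColor_lt hα hβ _⟩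
  · rintro ⟨x, α, β, t⟩ h ⟨x', α', β', t'⟩ h' heq
    simp only [coe_sigma, Set.mem_sigma_iff, mem_coe, mem_range, mem_miss] at h h'
    obtain ⟨hx, ⟨hα, h0⟩, hβ, ht⟩ := h
    obtain ⟨hx', ⟨hα', h0'⟩, hβ', ht'⟩ := h'
    simp only [Prod.mk.injEq, Sigma.mk.injEq, heq_eq_eq] at heq
    obtain ⟨⟨a1, a2⟩, a3⟩ := heq
    rcases le_total t t' with htt | htt
    · obtain ⟨rfl, rfl, rfl, rfl⟩ := walk_start_unique hN hV t t' x α β x' α' β' hx hx' hα hβ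
        hα' hβ' h0 h0' htt ht ht' a1 a2 a3
      rfl
    · obtain ⟨rfl, rfl, rfl, rfl⟩ := walk_start_unique hN hV t' t x' α' β' x α β hx' hx hα' hβ'
        hα hβ h0' h0 htt ht' ht a1.symm a2.symm a3.symm
      rfl

/-- A vertex is the first endpoint of at most `D` uncolored edges. This turns an average over
uncolored edges into a sum over vertices. -/
theorem sum_uncolored_le (hN : Net n m D eu ev) (g : ℕ → ℕ) :
    ∑ e ∈ uncolored m col, g (eu e) ≤ D * ∑ x ∈ range n, g x := by
  classical
  rw [← Finset.sum_fiberwise_of_maps_to (s := uncolored m col) (t := range n) (g := eu)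
    (fun e he => mem_range.2 (hN.eu_lt e (mem_uncolored.1 he).1)), mul_sum]
  refine sum_le_sum fun x hx => ?_
  rw [sum_congr rfl (g := fun _ => g x) (fun e he => by rw [(mem_filter.1 he).2]), sum_const,
    smul_eq_mul]
  refine Nat.mul_le_mul_right _ (hN.deg x (mem_range.1 hx) _ ?_ ?_)
  · intro e he
    exact mem_range.2 (mem_uncolored.1 (mem_filter.1 he).1).1
  · intro e he
    exact Or.inl (mem_filter.1 he).2

/-! ### Flipping an alternating walk -/

/-- The table after exchanging `α` and `β` at the first `t` vertices of the walk. -/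
noncomputable def flipTable (eu ev : ℕ → ℕ) (E : ℕ → ℕ → ℕ) (x α β t : ℕ) : ℕ → ℕ → ℕ :=
  open Classical in fun v c =>
    if ∃ s < t, v = walkVertex eu ev E x α β s then E v (Equiv.swap α β c) else E v c

/-- The colors after exchanging `α` and `β` on the first `t` edges of the walk. -/
noncomputable def flipCol (eu ev : ℕ → ℕ) (E : ℕ → ℕ → ℕ) (col : ℕ → ℕ) (x α β t : ℕ) : ℕ → ℕ :=
  open Classical in fun e =>
    if ∃ s < t, e + 1 = walkEntry eu ev E x α β s then Equiv.swap α β (col e - 1) + 1 else col e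

theorem flipCol_eq_zero_iff (hN : Net n m D eu ev) (hV : Valid n m q eu ev E col) {x α β t e : ℕ}
    (hx : x < n) (hα : α < q) (hβ : β < q) (ht : t ≤ walkLen eu ev E x α β) :
    flipCol eu ev E col x α β t e = 0 ↔ col e = 0 := by
  unfold flipCol
  split_ifs with h
  · obtain ⟨s, hs, he⟩ := h
    have := (walk_spec hN hV hx hα hβ (t := s)
      fun s' hs' => walkEntry_ne_of_lt (by omega)).2.2.1
    rw [← he, Nat.add_sub_cancel] at this
    exact iff_of_false (by simp) (by omega)
  · rfl

theorem swap_lt {a b c : ℕ} (ha : a < q) (hb : b < q) (hc : c < q) : Equiv.swap a b c < q := by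
  rw [Equiv.swap_apply_def]; split_ifs <;> assumption

/-- An edge at a vertex of the walk with one of the two colors belongs to the walk. -/
theorem exists_walkEntry (hN : Net n m D eu ev) (hV : Valid n m q eu ev E col) {x α β t e c : ℕ}
    (hx : x < n) (hα : α < q) (hβ : β < q) (hαx : E x α = 0) (ht : t ≤ walkLen eu ev E x α β)
    (he : E (walkVertex eu ev E x α β t) c = e + 1) (hc : c = α ∨ c = β) :
    ∃ s < walkLen eu ev E x α β, e + 1 = walkEntry eu ev E x α β s := by
  have hc' : c = walkColor α β t ∨ c = walkColor α β (t + 1) := by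
    unfold walkColor
    rcases Nat.mod_two_eq_zero_or_one t with h | h
    · rw [if_pos h, if_neg (by omega)]; tauto
    · rw [if_neg (by omega), if_pos (by omega)]; tauto
  rcases hc' with rfl | rfl
  · refine ⟨t, lt_of_le_of_ne ht ?_, he.symm⟩
    rintro rfl
    have := walkLen_spec hN hV hx hα hβ hαx
    unfold walkEntry at this
    omega
  · rcases t with _ | t
    · simp [walkColor, walkVertex, hαx] at he
    · rw [walkColor_succ_succ] at he
      obtain ⟨-, -, -, r4, -⟩ := walk_spec hN hV hx hα hβ (t := t)
        fun s hs => walkEntry_ne_of_lt (by omega)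
      exact ⟨t, by omega, by rw [← r4, he]⟩

/-- The walk is a whole component of the edges colored `α` or `β`: every such edge at a vertex of
the walk belongs to it (`exists_walkEntry`). A walk with `L` edges has `L + 1` vertices, hence the
different arguments of `flipTable` and `flipCol`. -/
theorem Valid.flip (hN : Net n m D eu ev) (hV : Valid n m q eu ev E col) {x α β : ℕ}
    (hx : x < n) (hα : α < q) (hβ : β < q) (hαx : E x α = 0) :
    Valid n m q eu ev (flipTable eu ev E x α β (walkLen eu ev E x α β + 1))
      (flipCol eu ev E col x α β (walkLen eu ev E x α β)) := by
  have hedge : ∀ e s, s < walkLen eu ev E x α β → e + 1 = walkEntry eu ev E x α β s →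
      e < m ∧ Inc eu ev (walkVertex eu ev E x α β s) e ∧ col e = walkColor α β s + 1 ∧
        walkVertex eu ev E x α β (s + 1) = other eu ev (walkVertex eu ev E x α β s) e := by
    intro e s hs he
    obtain ⟨h1, h2, h3, -, h5, -⟩ := walk_spec hN hV hx hα hβ (t := s)
      fun s' hs' => walkEntry_ne_of_lt (by omega)
    rw [← he, Nat.add_sub_cancel] at h1 h2 h3 h5
    exact ⟨h1, h2, h3, h5⟩
  refine ⟨fun e he => ?_, fun v hv c hc e => ?_⟩
  · unfold flipCol
    split_ifs with h
    · have hle := hV.le e he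
      exact swap_lt hα hβ (by omega)
    · exact hV.le e he
  · by_cases hvS : ∃ s < walkLen eu ev E x α β + 1, v = walkVertex eu ev E x α β s
    · have key := hV.iff v hv (Equiv.swap α β c) (swap_lt hα hβ hc) e
      unfold flipTable flipCol
      rw [if_pos hvS, key]
      refine and_congr_right fun he => and_congr_right fun hve => ?_
      split_ifs with hf
      · obtain ⟨s, hs, hes⟩ := hf
        obtain ⟨-, -, h3, -⟩ := hedge e s hs hes
        rw [h3, Nat.add_sub_cancel, add_left_inj, add_left_inj]
        constructor
        · intro h; rw [h, Equiv.swap_apply_self]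
        · intro h; rw [← h, Equiv.swap_apply_self]
      -- An edge off the walk at a vertex of the walk has neither of the two colors, so the exchange
      -- does not affect it.
      · have hnot : ∀ d, d < q → col e = d + 1 → d ≠ α ∧ d ≠ β := by
          intro d hd hcol
          obtain ⟨t, ht, rfl⟩ := hvS
          have := (hV.iff _ hv d hd e).2 ⟨he, hve, hcol⟩
          constructor
          · intro h
            exact hf (exists_walkEntry hN hV hx hα hβ hαx (by omega) this (Or.inl h))
          · intro h
            exact hf (exists_walkEntry hN hV hx hα hβ hαx (by omega) this (Or.inr h))
        constructor
        · intro h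
          obtain ⟨h1, h2⟩ := hnot _ (swap_lt hα hβ hc) h
          have : Equiv.swap α β c = c := by
            rw [Equiv.swap_apply_def] at h1 h2 ⊢
            split_ifs at h1 h2 ⊢ <;> simp_all
          rw [h, this]
        · intro h
          obtain ⟨h1, h2⟩ := hnot _ hc h
          rw [Equiv.swap_apply_of_ne_of_ne h1 h2, h]
    · have key := hV.iff v hv c hc e
      unfold flipTable flipCol
      rw [if_neg hvS, key]
      refine and_congr_right fun he => and_congr_right fun hve => ?_
      rw [if_neg]
      rintro ⟨s, hs, hes⟩
      obtain ⟨-, h2, -, h4⟩ := hedge e s hs hes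
      rcases eq_or_eq_other h2 hve with h | h
      · exact hvS ⟨s, by omega, h⟩
      · exact hvS ⟨s + 1, by omega, h.trans h4.symm⟩

/-! ### Fans and shifting their colors -/

/-- `F 0, …, F j` is a fan at `x`: the first edge is uncolored, and the color of each later edge is
missing at the leaf of its predecessor and at no earlier leaf. -/
structure Fan (m : ℕ) (eu ev : ℕ → ℕ) (E : ℕ → ℕ → ℕ) (col : ℕ → ℕ) (x : ℕ) (F : ℕ → ℕ) (j : ℕ) :
    Prop where
  lt : ∀ l ≤ j, F l < m
  inc : ∀ l ≤ j, Inc eu ev x (F l)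
  zero : col (F 0) = 0
  ne_zero : ∀ l < j, col (F (l + 1)) ≠ 0
  miss : ∀ l < j, E (other eu ev x (F l)) (col (F (l + 1)) - 1) = 0
  first : ∀ l < j, ∀ i < l, E (other eu ev x (F i)) (col (F (l + 1)) - 1) ≠ 0

namespace Fan
variable {x j : ℕ} {F : ℕ → ℕ}

/-- If a colored edge occurred twice, its color would be missing at the leaf before its first
occurrence, contrary to `first` at the second one. The edge `F 0` is uncolored and cannot recur. -/
theorem inj (h : Fan m eu ev E col x F j) : ∀ b ≤ j, ∀ a < b, F a ≠ F b := by
  intro b hb a hab heq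
  obtain ⟨b, rfl⟩ : ∃ b', b = b' + 1 := ⟨b - 1, by omega⟩
  rcases a with _ | a
  · exact h.ne_zero b (by omega) (heq ▸ h.zero)
  · have h1 := h.miss a (by omega)
    have h2 := h.first b (by omega) a (by omega)
    rw [heq] at h1
    exact h2 h1

theorem lt_card (h : Fan m eu ev E col x F j) : j < m := by
  have : ((range (j + 1)).image F) ⊆ range m := by
    intro e he
    obtain ⟨s, hs, rfl⟩ := Finset.mem_image.1 he
    exact mem_range.2 (h.lt s (by have := mem_range.1 hs; omega))
  have h2 := card_le_card this
  rw [card_image_of_injOn, card_range, card_range] at h2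
  · exact h2
  · intro a ha b hb heq
    simp only [coe_range, Set.mem_Iio] at ha hb heq
    by_contra hne
    rcases lt_or_gt_of_ne hne with hlt | hlt
    · exact h.inj b (by omega) a hlt heq
    · exact h.inj a (by omega) b hlt heq.symm

theorem extend (hN : Net n m D eu ev) (hV : Valid n m q eu ev E col)
    (h : Fan m eu ev E col x F j) {β : ℕ} (hβ : β < q) (hj : E (other eu ev x (F j)) β = 0)
    (hlt : ∀ i < j, E (other eu ev x (F i)) β ≠ 0) (hx : E x β ≠ 0) :
    Fan m eu ev E col x (Function.update F (j + 1) (E x β - 1)) (j + 1) := by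
  have hxn := hN.lt_of_inc (h.lt 0 (by omega)) (h.inc 0 (by omega))
  obtain ⟨h1, h2, h3, -, -⟩ := Valid.spec hN hV hxn hβ hx
  have hold : ∀ l ≤ j, Function.update F (j + 1) (E x β - 1) l = F l := fun l hl =>
    Function.update_of_ne (by omega) _ _
  have hnew : Function.update F (j + 1) (E x β - 1) (j + 1) = E x β - 1 :=
    Function.update_self _ _ _
  refine ⟨fun l hl => ?_, fun l hl => ?_, ?_, fun l hl => ?_, fun l hl => ?_, fun l hl i hi => ?_⟩
  · rcases Nat.lt_or_ge j l with hc | hc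
    · obtain rfl : l = j + 1 := by omega
      rw [hnew]; exact h1
    · rw [hold l hc]; exact h.lt l hc
  · rcases Nat.lt_or_ge j l with hc | hc
    · obtain rfl : l = j + 1 := by omega
      rw [hnew]; exact h2
    · rw [hold l hc]; exact h.inc l hc
  · rw [hold 0 (by omega)]; exact h.zero
  · rcases Nat.lt_or_ge l j with hc | hc
    · rw [hold (l + 1) hc]; exact h.ne_zero l hc
    · obtain rfl : l = j := by omega
      rw [hnew, h3]; omega
  · rw [hold l (by omega)]
    rcases Nat.lt_or_ge l j with hc | hc
    · rw [hold (l + 1) hc]; exact h.miss l hc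
    · obtain rfl : l = j := by omega
      rw [hnew, h3]; exact hj
  · rw [hold i (by omega)]
    rcases Nat.lt_or_ge l j with hc | hc
    · rw [hold (l + 1) hc]; exact h.first l hc i hi
    · obtain rfl : l = j := by omega
      rw [hnew, h3]; exact hlt i hi

end Fan

/-- `F l, …, F h` are edges at `x` whose colors can be shifted down by one, so that the last edge
can take the color `β`. -/
structure Shiftable (m : ℕ) (eu ev : ℕ → ℕ) (E : ℕ → ℕ → ℕ) (col : ℕ → ℕ) (x : ℕ) (F : ℕ → ℕ)
    (β l h : ℕ) : Prop where
  lt : ∀ i, l ≤ i → i ≤ h → F i < m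
  inc : ∀ i, l ≤ i → i ≤ h → Inc eu ev x (F i)
  inj : ∀ i i', l ≤ i → i < i' → i' ≤ h → F i ≠ F i'
  zero : col (F l) = 0
  ne_zero : ∀ i, l ≤ i → i < h → col (F (i + 1)) ≠ 0
  miss : ∀ i, l ≤ i → i < h → E (other eu ev x (F i)) (col (F (i + 1)) - 1) = 0
  center : E x β = 0
  last : E (other eu ev x (F h)) β = 0

/-- After the flip of the alternating walk, the fan up to `h` can be shifted. -/
theorem Fan.flip {x j i h α β : ℕ} {F : ℕ → ℕ} (hN : Net n m D eu ev)
    (hV : Valid n m q eu ev E col) (hF : Fan m eu ev E col x F j)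
    (hα : α < q) (hβ : β < q) (hαx : E x α = 0) (hij : i ≤ j)
    (hi : E (other eu ev x (F i)) β = 0) (hj : E (other eu ev x (F j)) β = 0)
    (hlt : ∀ i' < i, E (other eu ev x (F i')) β ≠ 0) (hends : i < j ∨ E x β = 0)
    (hh : h = if walkVertex eu ev E x α β (walkLen eu ev E x α β) = other eu ev x (F i)
      then j else i) :
    Shiftable m eu ev (flipTable eu ev E x α β (walkLen eu ev E x α β + 1))
      (flipCol eu ev E col x α β (walkLen eu ev E x α β)) x F β 0 h := by
  have hxn := hN.lt_of_inc (hF.lt 0 (by omega)) (hF.inc 0 (by omega))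
  have hV' := Valid.flip hN hV hxn hα hβ hαx
  have hhj : h ≤ j := by rw [hh]; split_ifs <;> omega
  set L := walkLen eu ev E x α β with hL
  have hx0 : x = walkVertex eu ev E x α β 0 := rfl
  -- a vertex other than `x` on the walk that misses `β` is the end of the walk
  have hend : ∀ y, y ≠ x → E y β = 0 → (∃ s < L + 1, y = walkVertex eu ev E x α β s) →
      y = walkVertex eu ev E x α β L := by
    rintro y hyx hy ⟨s, hs, rfl⟩
    by_contra hne
    have hsL : s < L := by
      rcases Nat.lt_or_ge s L with h | h
      · exact h
      · obtain rfl : s = L := by omega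
        exact absurd rfl hne
    rcases s with _ | s
    · exact hyx rfl
    · have h1 : walkEntry eu ev E x α β (s + 1) ≠ 0 := walkEntry_ne_of_lt hsL
      obtain ⟨-, -, -, r4, -⟩ := walk_spec hN hV hxn hα hβ (t := s)
        fun s' hs' => walkEntry_ne_of_lt (by omega)
      have h2 : walkEntry eu ev E x α β s ≠ 0 := walkEntry_ne_of_lt (by omega)
      have hc : walkColor α β s = β ∨ walkColor α β (s + 1) = β := by
        unfold walkColor
        rcases Nat.mod_two_eq_zero_or_one s with h | h
        · rw [if_pos h]; exact Or.inl rfl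
        · rw [if_pos (by omega : (s + 1) % 2 = 0)]; exact Or.inr rfl
      rcases hc with hc | hc
      · rw [hc] at r4; exact h2 (r4 ▸ hy)
      · unfold walkEntry at h1; rw [hc] at h1; exact h1 hy
  have hyx : ∀ l ≤ j, other eu ev x (F l) ≠ x := fun l hl => hN.other_ne (hF.lt l hl) (hF.inc l hl)
  -- colors of the edges at `x` are exchanged
  have hcolx : ∀ e < m, Inc eu ev x e → col e ≠ 0 →
      flipCol eu ev E col x α β L e = Equiv.swap α β (col e - 1) + 1 := by
    intro e he hxe h0
    have hle := hV.le e he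
    have h1 := (hV.iff x hxn (col e - 1) (by omega) e).2 ⟨he, hxe, by omega⟩
    have h2 : flipTable eu ev E x α β (L + 1) x (Equiv.swap α β (col e - 1)) = e + 1 := by
      unfold flipTable
      rw [if_pos ⟨0, by omega, hx0⟩, Equiv.swap_apply_self, h1]
    exact ((hV'.iff x hxn _ (swap_lt hα hβ (by omega)) e).1 h2).2.2
  have hlast : E (other eu ev x (F h)) β = 0 := by rw [hh]; split_ifs <;> assumption
  refine ⟨fun l _ hl => hF.lt l (by omega), fun l _ hl => hF.inc l (by omega),
    fun a b _ hab hb => hF.inj b (by omega) a hab,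
    (flipCol_eq_zero_iff hN hV hxn hα hβ le_rfl).2 hF.zero,
    fun l _ hl => (flipCol_eq_zero_iff hN hV hxn hα hβ le_rfl).not.2 (hF.ne_zero l (by omega)),
    fun l _ hl => ?_, ?_, ?_⟩
  · rw [hcolx _ (hF.lt _ (by omega)) (hF.inc _ (by omega)) (hF.ne_zero l (by omega)),
      Nat.add_sub_cancel]
    unfold flipTable
    split_ifs with hS
    -- On the walk, the exchange at the leaf and the exchange of the color at `x` cancel.
    · rw [Equiv.swap_apply_self]; exact hF.miss l (by omega)
    -- Off the walk, the color to be moved must be neither `α` nor `β`. It is present at `x`, so it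
    -- is not `α`. If it were `β`, then `l = i` because `i` is the first leaf missing `β`; but `l <
    -- h` forces `h = j`, which was chosen only if the walk ends at that leaf.
    · have hm := hF.miss l (by omega)
      have hne := hF.ne_zero l (by omega)
      have hle := hV.le _ (hF.lt (l + 1) (by omega))
      have hxc := (hV.iff x hxn (col (F (l + 1)) - 1) (by omega) (F (l + 1))).2
        ⟨hF.lt _ (by omega), hF.inc _ (by omega), by omega⟩
      have h1 : col (F (l + 1)) - 1 ≠ α := by
        intro h'; rw [h'] at hxc; omega
      have h2 : col (F (l + 1)) - 1 ≠ β := by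
        intro h'
        have hli : l ≤ i → l = i := by
          intro hle
          by_contra hne
          exact hlt l (by omega) (h' ▸ hm)
        have hil : i ≤ l → l = i := by
          intro hle
          by_contra hne
          exact hF.first l (by omega) i (by omega) (by rw [h']; exact hi)
        have hl' : l = i := by rcases le_total l i with h | h <;> tauto
        subst hl'
        split_ifs at hh with hw
        · exact hS ⟨L, by omega, hw.symm⟩
        · omega
      rw [Equiv.swap_apply_of_ne_of_ne h1 h2]
      exact hm
  · unfold flipTable
    rw [if_pos ⟨0, by omega, hx0⟩, Equiv.swap_apply_right, hαx]
  -- The last leaf misses `β`, so it could lie on the walk only as its end. For `h = j` the end is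
  -- the leaf `i`, which differs from it, or the walk is trivial; for `h = i` the end is by choice
  -- another vertex.
  · unfold flipTable
    rw [if_neg, hlast]
    intro hS
    have he := hend _ (hyx h hhj) hlast hS
    split_ifs at hh with hw
    · rcases hends with hlt' | hxβ
      · have := hN.other_inj (hF.lt h hhj) (hF.lt i hij) (hF.inc h hhj) (hF.inc i hij)
          (he.trans hw)
        exact hF.inj j le_rfl i hlt' (by rw [← this, hh])
      · have hL0 : L = 0 := by
          have : walkEntry eu ev E x α β 0 = 0 := by
            simp [walkEntry, walkColor, walkVertex, hxβ]
          exact Nat.le_zero.1 (Nat.sInf_le this)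
        rw [hL0] at he
        exact hyx h hhj he
    · rw [hh] at he
      exact hw he.symm

theorem card_uncolored_update_zero {e : ℕ} (he : e < m) (h0 : col e ≠ 0) :
    (uncolored m (Function.update col e 0)).card = (uncolored m col).card + 1 := by
  classical
  have : uncolored m (Function.update col e 0) = insert e (uncolored m col) := by
    ext f
    rw [mem_insert, mem_uncolored, mem_uncolored, Function.update_apply]
    split_ifs with h
    · simp [h, he]
    · simp [h]
  rw [this, card_insert_of_notMem]
  rw [mem_uncolored]; tauto

theorem card_uncolored_update_ne {e c : ℕ} (he : e < m) (h0 : col e = 0) :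
    (uncolored m (Function.update col e (c + 1))).card + 1 = (uncolored m col).card := by
  classical
  have : uncolored m (Function.update col e (c + 1)) = (uncolored m col).erase e := by
    ext f
    rw [mem_erase, mem_uncolored, mem_uncolored, Function.update_apply]
    split_ifs with h
    · simp [h]
    · simp [h]
  rw [this, card_erase_of_mem (mem_uncolored.2 ⟨he, h0⟩)]
  have := card_pos.2 ⟨e, mem_uncolored.2 ⟨he, h0⟩⟩
  omega

/-- Moving a color from `F (l + 1)` to `F l`. -/
theorem Shiftable.step {x β l h c : ℕ} {F : ℕ → ℕ} (hN : Net n m D eu ev)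
    (hV : Valid n m q eu ev E col) (hF : Shiftable m eu ev E col x F β l h) (hl : l < h)
    (hc : col (F (l + 1)) = c + 1) {E' : ℕ → ℕ → ℕ} {col' : ℕ → ℕ}
    (hE' : E' = upd (upd (upd (upd E x c 0) (other eu ev x (F (l + 1))) c 0) x c (F l + 1))
      (other eu ev x (F l)) c (F l + 1))
    (hcol' : col' = Function.update (Function.update col (F (l + 1)) 0) (F l) (c + 1)) :
    Valid n m q eu ev E' col' ∧ Shiftable m eu ev E' col' x F β (l + 1) h ∧
      (uncolored m col').card = (uncolored m col).card := by
  have a1 := hF.lt l le_rfl (by omega)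
  have a2 := hF.inc l le_rfl (by omega)
  have b1 := hF.lt (l + 1) (by omega) (by omega)
  have b2 := hF.inc (l + 1) (by omega) (by omega)
  have hne := hF.inj l (l + 1) le_rfl (by omega) (by omega)
  have hyy : ∀ i i', l ≤ i → i < i' → i' ≤ h →
      other eu ev x (F i) ≠ other eu ev x (F i') := fun i i' hi hii hi' h' =>
    hF.inj i i' hi hii hi' (hN.other_inj (hF.lt i hi (by omega)) (hF.lt i' (by omega) hi')
      (hF.inc i hi (by omega)) (hF.inc i' (by omega) hi') h')
  have hyx : ∀ i, l ≤ i → i ≤ h → other eu ev x (F i) ≠ x := fun i hi hi' =>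
    hN.other_ne (hF.lt i hi hi') (hF.inc i hi hi')
  have hcq := hV.le _ b1
  have hxn := hN.lt_of_inc a1 a2
  have hm := hF.miss l le_rfl hl
  rw [hc, Nat.add_sub_cancel] at hm
  -- Once `F (l + 1)` is uncolored, `c` is free at `x`; it is also free at the leaf of `F l`. The
  -- uncolored edge thus moves one place along the fan.
  have hV1 := Valid.uncolor hN hV b1 b2 hc
  have hV2 := Valid.color hV1 a1 a2 (by omega : c < q)
    (by rw [Function.update_of_ne hne]; exact hF.zero)
    (by simp [upd]) (by
      unfold upd
      rw [if_neg (fun h' => hyy l (l + 1) le_rfl (by omega) (by omega) h'.1),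
        if_neg (fun h' => hyx l le_rfl (by omega) h'.1), hm])
  have hEc : E x c = F (l + 1) + 1 := (hV.iff x hxn c (by omega) _).2 ⟨b1, b2, hc⟩
  -- The color `c` is present at `x` while `β` is missing there, so the shift does not touch the
  -- entries for `β`.
  have hβc : β ≠ c := by
    rintro rfl; have := hF.center; omega
  have hcol : ∀ i, l + 1 < i → i ≤ h → col' (F i) = col (F i) := by
    intro i hi hi'
    rw [hcol', Function.update_of_ne (hF.inj l i le_rfl (by omega) hi').symm,
      Function.update_of_ne (hF.inj (l + 1) i (by omega) hi hi').symm]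
  have hEz : ∀ y d, y ≠ other eu ev x (F l) → y ≠ x → E y d = 0 → E' y d = 0 := by
    intro y d hy hy' h0
    rw [hE']
    simp only [upd]
    rw [if_neg (fun h' => hy h'.1), if_neg (fun h' => hy' h'.1)]
    split_ifs <;> simp_all
  have hEd : ∀ y d, d ≠ c → E' y d = E y d := by
    intro y d hd
    rw [hE']; simp [upd, hd]
  refine ⟨by rw [hE', hcol']; exact hV2, ⟨fun i hi hi' => hF.lt i (by omega) hi',
    fun i hi hi' => hF.inc i (by omega) hi', fun i i' hi => hF.inj i i' (by omega), ?_,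
    fun i hi hi' => ?_, fun i hi hi' => ?_, ?_, ?_⟩, ?_⟩
  · rw [hcol', Function.update_of_ne hne.symm, Function.update_self]
  · rw [hcol _ (by omega) (by omega)]; exact hF.ne_zero i (by omega) hi'
  · rw [hcol _ (by omega) (by omega)]
    exact hEz _ _ (hyy l i le_rfl (by omega) (by omega)).symm (hyx i (by omega) (by omega))
      (hF.miss i (by omega) hi')
  · rw [hEd _ _ hβc]; exact hF.center
  · rw [hEd _ _ hβc]; exact hF.last
  · have h1 := card_uncolored_update_zero (m := m) (col := col) b1 (by omega)
    have h2 := card_uncolored_update_ne (m := m) (c := c)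
      (col := Function.update col (F (l + 1)) 0) a1
      (by rw [Function.update_of_ne hne]; exact hF.zero)
    rw [hcol']
    omega

end
end EdgeColoringProblem

/-! ### Memory layout and the deterministic subroutines -/

namespace EdgeColoringProblem
open Finset WordRAM

/-- The address of the table entry of a vertex and a color. -/
def idx (v c : Expr) : Expr := .op .add (.op .mul v (.reg 2)) c

/-- The table entry of a vertex and a color. -/
def tab (v c : Expr) : Expr := .load 4 (idx v c)

/-- The other endpoint of the edge `f` at `v`. -/
def oth (v f : Expr) : Expr := .op .sub (.op .add (.load 0 f) (.load 1 f)) v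

/-- The words are large enough for all the values that occur. -/
structure Sizes (W n m q : ℕ) : Prop where
  one : 1 < W
  vert : 2 * n < W
  edge : m < W
  color : q < W
  table : n * q ≤ W

/-- The memory contains the numbers of edges and of colors, and the list of edges. -/
structure Base (m q : ℕ) (eu ev : ℕ → ℕ) (s : Store) : Prop where
  reg1 : s.reg 1 = m
  reg2 : s.reg 2 = q
  arr0 : ∀ e < m, s.arr 0 e = eu e
  arr1 : ∀ e < m, s.arr 1 e = ev e

/-- The memory contains the table `E` and the colors `col`. -/
structure Rep (n m q : ℕ) (E : ℕ → ℕ → ℕ) (col : ℕ → ℕ) (s : Store) : Prop where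
  table : ∀ v < n, ∀ c < q, s.arr 4 (v * q + c) = E v c
  colors : ∀ e < m, s.arr 3 e = col e
  out : ∀ e < m, col e ≠ 0 → s.arr 2 e + 1 = col e

section
variable {W n m q D : ℕ} {eu ev : ℕ → ℕ} {E : ℕ → ℕ → ℕ} {col : ℕ → ℕ} {s : Store} {B : ℝ}

theorem table_index_lt {v c : ℕ} (hv : v < n) (hc : c < q) : v * q + c < n * q := by
  calc v * q + c < v * q + q := by omega
    _ = (v + 1) * q := by ring
    _ ≤ n * q := Nat.mul_le_mul_right _ hv

theorem table_index_inj {v c w d : ℕ} (hc : c < q) (hd : d < q) :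
    v * q + c = w * q + d ↔ v = w ∧ c = d := by
  constructor
  · intro h
    have hq : 0 < q := by omega
    have h1 : (v * q + c) / q = v := by
      rw [mul_comm, Nat.mul_add_div hq, Nat.div_eq_of_lt hc, add_zero]
    have h2 : (w * q + d) / q = w := by
      rw [mul_comm, Nat.mul_add_div hq, Nat.div_eq_of_lt hd, add_zero]
    have : v = w := by rw [← h1, ← h2, h]
    subst this
    exact ⟨rfl, by omega⟩
  · rintro ⟨rfl, rfl⟩; rfl

theorem idx_mod (hW : Sizes W n m q) {v c : ℕ} (hv : v < n) (hc : c < q) :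
    (v * q % W + c) % W = v * q + c := by
  have h := (table_index_lt hv hc).trans_le hW.table
  rw [Nat.mod_eq_of_lt (by omega : v * q < W), Nat.mod_eq_of_lt h]

theorem oth_mod (hW : Sizes W n m q) (hN : Net n m D eu ev) {v e : ℕ} (he : e < m) :
    ((eu e + ev e) % W - v) % W = other eu ev v e := by
  have h1 := hN.eu_lt e he
  have h2 := hN.ev_lt e he
  have h3 := hW.vert
  rw [Nat.mod_eq_of_lt (by omega : eu e + ev e < W), Nat.mod_eq_of_lt (by omega)]
  rfl

theorem eval_tab (hW : Sizes W n m q) (h2 : s.reg 2 = q) {v c : Expr} {a b : ℕ}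
    (hv : v.eval W s = a) (hc : c.eval W s = b) (ha : a < n) (hb : b < q) :
    (tab v c).eval W s = s.arr 4 (a * q + b) := by
  simp only [tab, idx, Expr.eval, Op.apply, hv, hc, h2, idx_mod hW ha hb]

theorem eval_oth (hW : Sizes W n m q) (hN : Net n m D eu ev) (hb : Base m q eu ev s) {v f : Expr}
    {a e : ℕ} (hv : v.eval W s = a) (hf : f.eval W s = e) (he : e < m) :
    (oth v f).eval W s = other eu ev a e := by
  simp only [oth, Expr.eval, Op.apply, hv, hf, hb.arr0 e he, hb.arr1 e he, oth_mod hW hN he]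

/-- Find the first fan leaf that misses the color in register `10`. -/
def search : Cmd :=
  .seq (.assign 11 (.const 0))
    (.loop (tab (oth (.reg 5) (.load 5 (.reg 11))) (.reg 10))
      (.assign 11 (.op .add (.reg 11) (.const 1))))

theorem Base.setReg (hb : Base m q eu ev s) {r v : ℕ} (h1 : r ≠ 1) (h2 : r ≠ 2) :
    Base m q eu ev (s.setReg r v) := by
  refine ⟨?_, ?_, hb.arr0, hb.arr1⟩
  · simp [Store.setReg, h1.symm, hb.reg1]
  · simp [Store.setReg, h2.symm, hb.reg2]

theorem setReg_reg (s : Store) (x v y : ℕ) :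
    (s.setReg x v).reg y = if y = x then v else s.reg y := by
  simp [Store.setReg, Function.update_apply]

theorem setReg_arr (s : Store) (x v : ℕ) : (s.setReg x v).arr = s.arr := rfl

theorem setArr_reg (s : Store) (a i v : ℕ) : (s.setArr a i v).reg = s.reg := rfl

theorem setArr_arr (s : Store) (a i v b : ℕ) :
    (s.setArr a i v).arr b = if b = a then Function.update (s.arr a) i v else s.arr b := by
  simp only [Store.setArr, Function.update_apply]

theorem setReg_setReg (s : Store) (x v w : ℕ) : (s.setReg x v).setReg x w = s.setReg x w := by
  simp [Store.setReg]

theorem det_search (hW : Sizes W n m q) (hN : Net n m D eu ev) (hb : Base m q eu ev s)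
    (hR : Rep n m q E col s) {x j β : ℕ} {F : ℕ → ℕ} (hF : Fan m eu ev E col x F j)
    (h5 : s.reg 5 = x) (h10 : s.reg 10 = β) (hβ : β < q) (ha : ∀ l ≤ j, s.arr 5 l = F l)
    (hj : E (other eu ev x (F j)) β = 0) :
    Det W B search s (2 * j + 3) fun s' => ∃ i ≤ j, E (other eu ev x (F i)) β = 0 ∧
      (∀ i' < i, E (other eu ev x (F i')) β ≠ 0) ∧ s' = s.setReg 11 i := by
  classical
  have hex : ∃ i, E (other eu ev x (F i)) β = 0 := ⟨j, hj⟩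
  set i := Nat.find hex with hi
  have hij : i ≤ j := Nat.find_min' hex hj
  have hjm := hF.lt_card
  have hWm := hW.edge
  have hguard : ∀ t ≤ j,
      (tab (oth (.reg 5) (.load 5 (.reg 11))) (.reg 10)).eval W (s.setReg 11 t) =
        E (other eu ev x (F t)) β := by
    intro t ht
    have hb' : Base m q eu ev (s.setReg 11 t) := hb.setReg (by norm_num) (by norm_num)
    rw [eval_tab hW hb'.reg2 (a := other eu ev x (F t)) (b := β) _ _
      (hN.other_lt (hF.lt t ht) (hF.inc t ht)) hβ]
    · exact hR.table _ (hN.other_lt (hF.lt t ht) (hF.inc t ht)) _ hβ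
    · refine eval_oth hW hN hb' (by simp [Expr.eval, setReg_reg, h5]) ?_ (hF.lt t ht)
      simp [Expr.eval, setReg_reg, setReg_arr, ha t ht]
    · simp [Expr.eval, setReg_reg, h10]
  refine (Det.seq (K := 1) (K' := (1 + 1) * (i : ℝ) + 1) zero_le_one (by positivity)
    (Det.assign _ _ _) (Q' := fun s' => s' = s.setReg 11 i) ?_).mono ?_ ?_
  · rintro _ rfl
    have h0 : (Expr.const 0).eval W s = 0 := by simp [Expr.eval]
    rw [h0]
    refine Det.loop zero_le_one (fun t s' => s' = s.setReg 11 t) i ?_ ?_ rfl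
    · rintro t ht _ rfl
      refine ⟨?_, ?_⟩
      · rw [hguard t (by omega)]
        exact Nat.find_min hex ht
      · refine (Det.assign _ _ _).mono le_rfl ?_
        rintro _ rfl
        rw [setReg_setReg]
        congr 1
        simp only [Expr.eval, Op.apply, setReg_reg, if_true]
        rw [Nat.mod_eq_of_lt hW.one, Nat.mod_eq_of_lt (by omega)]
    · rintro _ rfl
      rw [hguard i hij]
      exact Nat.find_spec hex
  · have : (i : ℝ) ≤ j := by exact_mod_cast hij
    linarith
  · rintro _ rfl
    exact ⟨i, hij, Nat.find_spec hex, fun i' hi' => Nat.find_min hex hi', rfl⟩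

/-- One step of the flip of an alternating walk: registers `12`, `13` and `14` contain the current
vertex, the color of the next edge, and the other color. -/
def flipBody : List Instr :=
  [.assign 15 (tab (.reg 12) (.reg 13)),
   .store 4 (idx (.reg 12) (.reg 13)) (tab (.reg 12) (.reg 14)),
   .store 4 (idx (.reg 12) (.reg 14)) (.reg 15),
   .assign 15 (.op .sub (.reg 15) (.const 1)),
   .store 2 (.reg 15) (.reg 14),
   .store 3 (.reg 15) (.op .add (.reg 14) (.const 1)),
   .assign 12 (oth (.reg 12) (.reg 15)),
   .assign 16 (.reg 13),
   .assign 13 (.reg 14),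
   .assign 14 (.reg 16)]

/-- Symbolic execution; `Sizes` makes the reductions modulo `W` disappear. -/
theorem exec_flipBody (hW : Sizes W n m q) (hN : Net n m D eu ev) (hb : Base m q eu ev s)
    {v c d e : ℕ} (h12 : s.reg 12 = v) (h13 : s.reg 13 = c) (h14 : s.reg 14 = d) (hv : v < n)
    (hc : c < q) (hd : d < q) (he : s.arr 4 (v * q + c) = e + 1) (hem : e < m) :
    (∀ r < 12, (execBlock W flipBody s).reg r = s.reg r) ∧
    (execBlock W flipBody s).reg 12 = other eu ev v e ∧
    (execBlock W flipBody s).reg 13 = d ∧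
    (execBlock W flipBody s).reg 14 = c ∧
    (∀ a, a = 0 ∨ a = 1 ∨ a = 5 → (execBlock W flipBody s).arr a = s.arr a) ∧
    (execBlock W flipBody s).arr 2 = Function.update (s.arr 2) e d ∧
    (execBlock W flipBody s).arr 3 = Function.update (s.arr 3) e (d + 1) ∧
    (execBlock W flipBody s).arr 4 = Function.update (Function.update (s.arr 4) (v * q + c)
      (s.arr 4 (v * q + d))) (v * q + d) (e + 1) := by
  have i1 := idx_mod hW hv hc
  have i2 := idx_mod hW hv hd
  have i3 := oth_mod hW hN (v := v) hem
  have i4 : 1 % W = 1 := Nat.mod_eq_of_lt hW.one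
  have i5 : e % W = e := Nat.mod_eq_of_lt (hem.trans hW.edge)
  have i6 : (d + 1) % W = d + 1 := Nat.mod_eq_of_lt (by have := hW.color; omega)
  have hr2 := hb.reg2
  have ha0 := hb.arr0 e hem
  have ha1 := hb.arr1 e hem
  simp only [flipBody, execBlock, Instr.exec, tab, idx, oth, Expr.eval, Op.apply, setReg_reg,
    setReg_arr, setArr_reg, setArr_arr, h12, h13, h14, hr2, i1, i2, i3, i4, i5, i6, he, ha0, ha1,
    Nat.reduceEqDiff, if_true, if_false, Nat.add_sub_cancel, and_true, true_and]
  refine ⟨fun r hr => ?_, ?_⟩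
  · repeat rw [if_neg (by omega)]
  · simp

theorem flipTable_succ (x α β t : ℕ) :
    flipTable eu ev E x α β (t + 1) = fun w b =>
      if w = walkVertex eu ev E x α β t then E w (Equiv.swap α β b)
      else flipTable eu ev E x α β t w b := by
  funext w b
  unfold flipTable
  by_cases h : w = walkVertex eu ev E x α β t
  · rw [if_pos ⟨t, by omega, h⟩, if_pos h]
  · rw [if_neg h]
    refine if_congr ⟨?_, ?_⟩ rfl rfl
    · rintro ⟨s, hs, rfl⟩
      refine ⟨s, ?_, rfl⟩
      by_contra hst
      obtain rfl : s = t := by omega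
      exact h rfl
    · rintro ⟨s, hs, hw⟩; exact ⟨s, by omega, hw⟩

theorem flipCol_succ (x α β t : ℕ) :
    flipCol eu ev E col x α β (t + 1) = fun e =>
      if e + 1 = walkEntry eu ev E x α β t then Equiv.swap α β (col e - 1) + 1
      else flipCol eu ev E col x α β t e := by
  funext e
  unfold flipCol
  by_cases h : e + 1 = walkEntry eu ev E x α β t
  · rw [if_pos ⟨t, by omega, h⟩, if_pos h]
  · rw [if_neg h]
    refine if_congr ⟨?_, ?_⟩ rfl rfl
    · rintro ⟨s, hs, hw⟩
      refine ⟨s, ?_, hw⟩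
      by_contra hst
      obtain rfl : s = t := by omega
      exact h hw
    · rintro ⟨s, hs, hw⟩; exact ⟨s, by omega, hw⟩

/-- Exchanging two entries in memory exchanges the two colors in the table at that vertex. -/
theorem swap_entries {A : ℕ → ℕ} {T E : ℕ → ℕ → ℕ} {v c d z : ℕ} (hc : c < q) (hd : d < q)
    (hA : ∀ w < n, ∀ b < q, A (w * q + b) = T w b) (hv : v < n) (hT : ∀ b, T v b = E v b)
    (hz : z = E v c) :
    ∀ w < n, ∀ b < q, Function.update (Function.update A (v * q + c) (A (v * q + d)))
      (v * q + d) z (w * q + b) = if w = v then E w (Equiv.swap c d b) else T w b := by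
  intro w hw b hb
  simp only [Function.update_apply, table_index_inj hb hd, table_index_inj hb hc]
  by_cases hwv : w = v
  · subst hwv
    simp only [true_and, if_true]
    by_cases hbd : b = d
    · rw [if_pos hbd, hbd, Equiv.swap_apply_right, hz]
    · rw [if_neg hbd]
      by_cases hbc : b = c
      · rw [if_pos hbc, hbc, Equiv.swap_apply_left, hA _ hw _ hd, hT]
      · rw [if_neg hbc, Equiv.swap_apply_of_ne_of_ne hbc hbd, hA _ hw _ hb, hT]
  · simp [hwv, hA w hw b hb]

theorem swap_walkColor_eq (α β t : ℕ) :
    Equiv.swap (walkColor α β t) (walkColor α β (t + 1)) = Equiv.swap α β := by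
  unfold walkColor
  rcases Nat.mod_two_eq_zero_or_one t with h | h
  · rw [if_pos h, if_neg (by omega), Equiv.swap_comm]
  · rw [if_neg (by omega), if_pos (by omega)]

/-- Registers below `12` and the input and fan arrays agree. -/
def SameLow (s s' : Store) : Prop :=
  (∀ r < 12, s'.reg r = s.reg r) ∧ ∀ a, a = 0 ∨ a = 1 ∨ a = 5 → s'.arr a = s.arr a

theorem Base.sameLow {s' : Store} (hb : Base m q eu ev s) (h : SameLow s s') :
    Base m q eu ev s' := by
  refine ⟨?_, ?_, ?_, ?_⟩
  · rw [h.1 1 (by norm_num)]; exact hb.reg1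
  · rw [h.1 2 (by norm_num)]; exact hb.reg2
  · rw [h.2 0 (by norm_num)]; exact hb.arr0
  · rw [h.2 1 (by norm_num)]; exact hb.arr1

/-- This is why the walk can be flipped while it is being followed: its vertices are distinct, so
the next one still shows its original entries. -/
theorem flipTable_walkVertex {x α β t : ℕ}
    (h : ∀ a < t, walkVertex eu ev E x α β a ≠ walkVertex eu ev E x α β t) (b : ℕ) :
    flipTable eu ev E x α β t (walkVertex eu ev E x α β t) b =
      E (walkVertex eu ev E x α β t) b := by
  unfold flipTable
  rw [if_neg]
  rintro ⟨a, ha, he⟩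
  exact h a ha he.symm

/-- Flip the alternating walk from the vertex in register `5` with the colors in registers `10` and
`6`; register `12` contains the end of the walk afterwards. -/
def flipWalk : Cmd :=
  .seq (block [.assign 12 (.reg 5), .assign 13 (.reg 10), .assign 14 (.reg 6)])
    (.seq (.loop (tab (.reg 12) (.reg 13)) (block flipBody))
      (block [.store 4 (idx (.reg 12) (.reg 13)) (tab (.reg 12) (.reg 14)),
        .store 4 (idx (.reg 12) (.reg 14)) (.const 0)]))

theorem det_flipWalk (hW : Sizes W n m q) (hN : Net n m D eu ev) (hb : Base m q eu ev s)
    (hR : Rep n m q E col s) (hV : Valid n m q eu ev E col) {x α β : ℕ} (hx : x < n)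
    (hα : α < q) (hβ : β < q) (hαx : E x α = 0)
    (h5 : s.reg 5 = x) (h6 : s.reg 6 = α) (h10 : s.reg 10 = β) :
    Det W B flipWalk s (22 * walkLen eu ev E x α β + 15) fun s' => SameLow s s' ∧
      s'.reg 12 = walkVertex eu ev E x α β (walkLen eu ev E x α β) ∧
      Rep n m q (flipTable eu ev E x α β (walkLen eu ev E x α β + 1))
        (flipCol eu ev E col x α β (walkLen eu ev E x α β)) s' := by
  set L := walkLen eu ev E x α β with hL
  have halive : ∀ s < L, walkEntry eu ev E x α β s ≠ 0 := fun s hs => walkEntry_ne_of_lt hs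
  have hinj := walkVertex_injOn hN hV hx hα hβ hαx halive
  have hlt : ∀ t ≤ L, walkVertex eu ev E x α β t < n := fun t ht =>
    walkVertex_lt hN hV hx hα hβ fun s hs => halive s (by omega)
  let Inv : ℕ → Store → Prop := fun t s' => SameLow s s' ∧
    s'.reg 12 = walkVertex eu ev E x α β t ∧ s'.reg 13 = walkColor α β t ∧
    s'.reg 14 = walkColor α β (t + 1) ∧
    Rep n m q (flipTable eu ev E x α β t) (flipCol eu ev E col x α β t) s'
  have hentry : ∀ t ≤ L, ∀ s', Inv t s' →
      s'.arr 4 (walkVertex eu ev E x α β t * q + walkColor α β t) =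
        walkEntry eu ev E x α β t := by
    rintro t ht s' ⟨-, -, -, -, hR'⟩
    rw [hR'.table _ (hlt t ht) _ (walkColor_lt hα hβ t), flipTable_walkVertex (hinj t ht)]
    rfl
  have hguard : ∀ t ≤ L, ∀ s', Inv t s' →
      (tab (.reg 12) (.reg 13)).eval W s' = walkEntry eu ev E x α β t := by
    intro t ht s' hI
    have hI' := hI
    obtain ⟨hs, h12, h13, -, -⟩ := hI'
    rw [eval_tab hW (hb.sameLow hs).reg2 (v := .reg 12) (c := .reg 13) h12 h13 (hlt t ht)
      (walkColor_lt hα hβ t), hentry t ht s' hI]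
  have hstart : Inv 0 (execBlock W
      [.assign 12 (.reg 5), .assign 13 (.reg 10), .assign 14 (.reg 6)] s) := by
    simp only [Inv, execBlock, Instr.exec, Expr.eval, setReg_reg]
    refine ⟨⟨fun r hr => ?_, fun a _ => rfl⟩, ?_, ?_, ?_, ⟨?_, ?_, ?_⟩⟩
    · simp only [setReg_reg]
      repeat rw [if_neg (by omega)]
    · simp [h5, walkVertex]
    · simp [h10, walkColor]
    · simp [h6, walkColor]
    · intro v hv c hc
      simpa [flipTable, setReg_arr] using hR.table v hv c hc
    · intro e he
      simpa [flipCol, setReg_arr] using hR.colors e he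
    · intro e he
      simpa [flipCol, setReg_arr] using hR.out e he
  -- Each edge of the walk costs 21 steps for the ten instructions of `flipBody` and one loop test;
  -- the blocks before and after the loop cost 7 and 5.
  refine (Det.seq (K := 7) (K' := (21 + 1) * (L : ℝ) + 1 + 5 + 1) (by norm_num) (by positivity)
    ((Det.block _ _).mono (by norm_num) fun _ h => h) (fun s1 hs1 => ?_)).mono (by linarith)
    (fun _ h => h)
  subst hs1
  refine Det.seq (by positivity) (by norm_num) (Det.loop (by norm_num) Inv L ?_ ?_ hstart) ?_
  · intro t ht s' hI
    rw [hguard t ht.le s' hI]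
    refine ⟨halive t ht, (Det.block _ _).mono (by norm_num [flipBody]) ?_⟩
    rintro _ rfl
    have hent := hentry t ht.le s' hI
    obtain ⟨hs, h12, h13, h14, hR'⟩ := hI
    obtain ⟨w1, w2, w3, w4, w5, w6, w7⟩ := walk_spec hN hV hx hα hβ (t := t)
      fun s hs => halive s (by omega)
    obtain ⟨e, he⟩ : ∃ e, walkEntry eu ev E x α β t = e + 1 :=
      ⟨walkEntry eu ev E x α β t - 1, by have := halive t ht; omega⟩
    rw [he, Nat.add_sub_cancel] at w1 w2 w3 w5
    rw [he] at hent
    obtain ⟨x1, x2, x3, x4, x5, x6, x7, x8⟩ := exec_flipBody hW hN (hb.sameLow hs) h12 h13 h14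
      (hlt t ht.le) (walkColor_lt hα hβ t) (walkColor_lt hα hβ (t + 1)) hent w1
    refine ⟨⟨fun r hr => (x1 r hr).trans (hs.1 r hr), fun a ha => (x5 a ha).trans (hs.2 a ha)⟩,
      x2.trans w5.symm, x3, by rw [x4, walkColor_succ_succ], ⟨?_, ?_, ?_⟩⟩
    · rw [x8, flipTable_succ, ← swap_walkColor_eq α β t]
      exact swap_entries (walkColor_lt hα hβ t) (walkColor_lt hα hβ (t + 1)) hR'.table
        (hlt t ht.le) (flipTable_walkVertex (hinj t ht.le)) he.symm
    · intro f hf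
      rw [x7, flipCol_succ, Function.update_apply, he]
      beta_reduce
      by_cases hfe : f = e
      · rw [if_pos hfe, if_pos (by omega), hfe, w3, Nat.add_sub_cancel, swap_walkColor]
      · rw [if_neg hfe, if_neg (by omega), hR'.colors f hf]
    · intro f hf
      rw [x6, flipCol_succ, Function.update_apply, he]
      beta_reduce
      by_cases hfe : f = e
      · rw [if_pos hfe, if_pos (by omega), hfe, w3, Nat.add_sub_cancel, swap_walkColor]
        exact fun _ => rfl
      · rw [if_neg hfe, if_neg (by omega)]
        exact hR'.out f hf
  · intro s' hI
    rw [hguard L le_rfl s' hI]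
    exact walkLen_spec hN hV hx hα hβ hαx
  -- The terminal vertex has no edge of the next color, so its two entries are exchanged with the
  -- constant `0` in place of a saved entry.
  · intro s' hI
    refine (Det.block _ _).mono (by norm_num) ?_
    rintro _ rfl
    obtain ⟨hs, h12, h13, h14, hR'⟩ := hI
    have hr2 := (hb.sameLow hs).reg2
    have i1 := idx_mod hW (hlt L le_rfl) (walkColor_lt hα hβ L)
    have i2 := idx_mod hW (hlt L le_rfl) (walkColor_lt hα hβ (L + 1))
    simp only [execBlock, Instr.exec, tab, idx, Expr.eval, Op.apply, setArr_reg, h12, h13, h14,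
      hr2, i1, i2]
    refine ⟨⟨fun r hr => hs.1 r hr, fun a ha => ?_⟩, trivial, ⟨?_, ?_, ?_⟩⟩
    · have h4 : a ≠ 4 := by omega
      simp only [setArr_arr, if_neg h4]
      exact hs.2 a ha
    · rw [flipTable_succ, ← swap_walkColor_eq α β L]
      simp only [setArr_arr, if_true, Nat.zero_mod]
      exact swap_entries (walkColor_lt hα hβ L) (walkColor_lt hα hβ (L + 1)) hR'.table
        (hlt L le_rfl) (flipTable_walkVertex (hinj L le_rfl))
        (walkLen_spec hN hV hx hα hβ hαx).symm
    · intro e he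
      simp only [setArr_arr]
      exact hR'.colors e he
    · intro e he
      simp only [setArr_arr]
      exact hR'.out e he

/-- Move the color of the fan edge after the one in register `18` to the latter. -/
def shiftBody : List Instr :=
  [.assign 15 (.load 5 (.reg 18)),
   .assign 9 (oth (.reg 5) (.reg 15)),
   .assign 12 (.load 5 (.op .add (.reg 18) (.const 1))),
   .assign 13 (.op .sub (.load 3 (.reg 12)) (.const 1)),
   .store 4 (idx (.reg 5) (.reg 13)) (.const 0),
   .store 4 (idx (oth (.reg 5) (.reg 12)) (.reg 13)) (.const 0),
   .store 3 (.reg 12) (.const 0),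
   .store 4 (idx (.reg 5) (.reg 13)) (.op .add (.reg 15) (.const 1)),
   .store 4 (idx (.reg 9) (.reg 13)) (.op .add (.reg 15) (.const 1)),
   .store 3 (.reg 15) (.op .add (.reg 13) (.const 1)),
   .store 2 (.reg 15) (.reg 13),
   .assign 18 (.op .add (.reg 18) (.const 1))]

theorem exec_shiftBody (hW : Sizes W n m q) (hN : Net n m D eu ev) (hb : Base m q eu ev s)
    {x l a b c : ℕ} (h5 : s.reg 5 = x) (h18 : s.reg 18 = l) (ha : s.arr 5 l = a)
    (hb' : s.arr 5 (l + 1) = b) (hlm : l + 1 < m) (ham : a < m) (hbm : b < m)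
    (hxa : Inc eu ev x a) (hxb : Inc eu ev x b) (hc : s.arr 3 b = c + 1) (hcq : c < q) :
    (∀ r, r < 9 ∨ r = 10 ∨ r = 17 → (execBlock W shiftBody s).reg r = s.reg r) ∧
    (execBlock W shiftBody s).reg 18 = l + 1 ∧
    (∀ i, i = 0 ∨ i = 1 ∨ i = 5 → (execBlock W shiftBody s).arr i = s.arr i) ∧
    (execBlock W shiftBody s).arr 2 = Function.update (s.arr 2) a c ∧
    (execBlock W shiftBody s).arr 3 =
      Function.update (Function.update (s.arr 3) b 0) a (c + 1) ∧
    (execBlock W shiftBody s).arr 4 = Function.update (Function.update (Function.update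
      (Function.update (s.arr 4) (x * q + c) 0) (other eu ev x b * q + c) 0)
        (x * q + c) (a + 1)) (other eu ev x a * q + c) (a + 1) := by
  have hx := hN.lt_of_inc ham hxa
  have i1 := idx_mod hW hx hcq
  have i2 := idx_mod hW (hN.other_lt ham hxa) hcq
  have i3 := idx_mod hW (hN.other_lt hbm hxb) hcq
  have i4 := oth_mod hW hN (v := x) ham
  have i5 := oth_mod hW hN (v := x) hbm
  have hWm := hW.edge
  have hWq := hW.color
  have i6 : 1 % W = 1 := Nat.mod_eq_of_lt hW.one
  have i7 : c % W = c := Nat.mod_eq_of_lt (by omega)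
  have i8 : (c + 1) % W = c + 1 := Nat.mod_eq_of_lt (by omega)
  have i9 : (a + 1) % W = a + 1 := Nat.mod_eq_of_lt (by omega)
  have i10 : (l + 1) % W = l + 1 := Nat.mod_eq_of_lt (by omega)
  have hr2 := hb.reg2
  have a0 := hb.arr0 a ham
  have a1 := hb.arr1 a ham
  have b0 := hb.arr0 b hbm
  have b1 := hb.arr1 b hbm
  simp only [shiftBody, execBlock, Instr.exec, idx, oth, Expr.eval, Op.apply, setReg_reg,
    setReg_arr, setArr_reg, setArr_arr, h5, h18, ha, hb', hc, hr2, i1, i2, i3, i4, i5, i6, i7, i8,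
    i9, i10, a0, a1, b0, b1, Nat.reduceEqDiff, if_true, if_false, Nat.add_sub_cancel,
    Nat.zero_mod]
  refine ⟨fun r hr => ?_, ?_⟩
  · repeat rw [if_neg (by omega)]
  · simp

theorem table_update {A : ℕ → ℕ} {T : ℕ → ℕ → ℕ}
    (hA : ∀ w < n, ∀ b < q, A (w * q + b) = T w b) {v c : ℕ} (hc : c < q) (z : ℕ) :
    ∀ w < n, ∀ b < q, Function.update A (v * q + c) z (w * q + b) = upd T v c z w b := by
  intro w hw b hb
  simp only [Function.update_apply, table_index_inj hb hc, hA w hw b hb, upd]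

/-- Color the fan edge in position `reg 17` with the color in register `10`. -/
def colorLast : List Instr :=
  [.assign 15 (.load 5 (.reg 17)),
   .assign 9 (oth (.reg 5) (.reg 15)),
   .store 4 (idx (.reg 5) (.reg 10)) (.op .add (.reg 15) (.const 1)),
   .store 4 (idx (.reg 9) (.reg 10)) (.op .add (.reg 15) (.const 1)),
   .store 3 (.reg 15) (.op .add (.reg 10) (.const 1)),
   .store 2 (.reg 15) (.reg 10),
   .assign 3 (.op .sub (.reg 3) (.const 1))]

theorem exec_colorLast (hW : Sizes W n m q) (hN : Net n m D eu ev) (hb : Base m q eu ev s)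
    {x h a c k : ℕ} (h5 : s.reg 5 = x) (h17 : s.reg 17 = h) (h10 : s.reg 10 = c)
    (h3 : s.reg 3 = k) (hk : k ≤ m) (ha : s.arr 5 h = a) (ham : a < m)
    (hxa : Inc eu ev x a) (hcq : c < q) :
    (execBlock W colorLast s).reg 1 = s.reg 1 ∧
    (execBlock W colorLast s).reg 2 = s.reg 2 ∧
    (execBlock W colorLast s).reg 3 = k - 1 ∧
    (∀ i, i = 0 ∨ i = 1 → (execBlock W colorLast s).arr i = s.arr i) ∧
    (execBlock W colorLast s).arr 2 = Function.update (s.arr 2) a c ∧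
    (execBlock W colorLast s).arr 3 = Function.update (s.arr 3) a (c + 1) ∧
    (execBlock W colorLast s).arr 4 = Function.update (Function.update (s.arr 4)
        (x * q + c) (a + 1)) (other eu ev x a * q + c) (a + 1) := by
  have hx := hN.lt_of_inc ham hxa
  have i1 := idx_mod hW hx hcq
  have i2 := idx_mod hW (hN.other_lt ham hxa) hcq
  have i4 := oth_mod hW hN (v := x) ham
  have hWm := hW.edge
  have hWq := hW.color
  have i6 : 1 % W = 1 := Nat.mod_eq_of_lt hW.one
  have i8 : (c + 1) % W = c + 1 := Nat.mod_eq_of_lt (by omega)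
  have i9 : (a + 1) % W = a + 1 := Nat.mod_eq_of_lt (by omega)
  have i10 : (k - 1) % W = k - 1 := Nat.mod_eq_of_lt (by omega)
  have hr2 := hb.reg2
  have a0 := hb.arr0 a ham
  have a1 := hb.arr1 a ham
  simp only [colorLast, execBlock, Instr.exec, idx, oth, Expr.eval, Op.apply, setReg_reg,
    setReg_arr, setArr_reg, setArr_arr, h5, h17, h10, h3, ha, hr2, i1, i2, i4, i6, i8,
    i9, i10, a0, a1, Nat.reduceEqDiff, if_true, if_false]
  simp

/-- The state between two augmentations, with `k` uncolored edges. -/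
def Ready (n m q : ℕ) (eu ev : ℕ → ℕ) (k : ℕ) (s : Store) : Prop :=
  ∃ E col, Base m q eu ev s ∧ Rep n m q E col s ∧ Valid n m q eu ev E col ∧
    s.reg 3 = k ∧ (uncolored m col).card = k

/-- Shift the colors of the fan and color its last edge. -/
def shiftFan : Cmd :=
  .seq (.assign 18 (.const 0))
    (.seq (.loop (.op .lt (.reg 18) (.reg 17)) (block shiftBody)) (block colorLast))

/-- Each round moves the uncolored edge one place along the fan without changing the number of
uncolored edges; only coloring the last edge with `β` decreases it. `Rep.out` is silent about
uncolored edges, whose output cells may hold old colors. -/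
theorem det_shiftFan (hW : Sizes W n m q) (hN : Net n m D eu ev) (hb : Base m q eu ev s)
    (hR : Rep n m q E col s) (hV : Valid n m q eu ev E col) {x β h k : ℕ} {F : ℕ → ℕ}
    (hβ : β < q) (hhm : h < m) (hS : Shiftable m eu ev E col x F β 0 h)
    (h5 : s.reg 5 = x) (h10 : s.reg 10 = β) (h17 : s.reg 17 = h)
    (hF : ∀ l ≤ h, s.arr 5 l = F l) (h3 : s.reg 3 = k) (hk : (uncolored m col).card = k) :
    Det W B shiftFan s (26 * h + 20) (Ready n m q eu ev (k - 1)) := by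
  let Inv : ℕ → Store → Prop := fun l s' => ∃ E col, Base m q eu ev s' ∧ Rep n m q E col s' ∧
    Valid n m q eu ev E col ∧ Shiftable m eu ev E col x F β l h ∧ s'.reg 5 = x ∧ s'.reg 10 = β ∧
    s'.reg 17 = h ∧ s'.reg 18 = l ∧ (∀ l ≤ h, s'.arr 5 l = F l) ∧ s'.reg 3 = k ∧
    (uncolored m col).card = k
  have hkm : k ≤ m := by
    rw [← hk]
    exact (card_le_card (filter_subset _ _)).trans (by simp)
  refine (Det.seq (K := 1) (K' := (25 + 1) * (h : ℝ) + 1 + 15 + 1) zero_le_one (by positivity)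
    (Det.assign _ _ _) (fun s1 hs1 => ?_)).mono (by linarith) (fun _ h => h)
  subst hs1
  refine Det.seq (by positivity) (by norm_num)
    (Det.loop (by norm_num) Inv h ?_ ?_ ?_) ?_
  · rintro l hl s' ⟨E, col, hb, hR, hV, hS, h5, h10, h17, h18, hF, h3, hk⟩
    refine ⟨?_, ?_⟩
    · simp only [Expr.eval, Op.apply, h17, h18, if_pos hl]
      rw [Nat.mod_eq_of_lt hW.one]
      exact one_ne_zero
    · refine (Det.block _ _).mono (by norm_num [shiftBody]) ?_
      rintro _ rfl
      have a1 := hS.lt l le_rfl hl.le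
      have a2 := hS.inc l le_rfl hl.le
      have b1 := hS.lt (l + 1) (by omega) (by omega)
      have b2 := hS.inc (l + 1) (by omega) (by omega)
      obtain ⟨c, hc⟩ : ∃ c, col (F (l + 1)) = c + 1 :=
        ⟨col (F (l + 1)) - 1, by have := hS.ne_zero l le_rfl hl; omega⟩
      have hcq : c < q := by have := hV.le _ b1; omega
      obtain ⟨x1, x2, x3, x4, x5, x6⟩ := exec_shiftBody hW hN hb h5 h18 (hF l hl.le)
        (hF (l + 1) hl) (by omega) a1 b1 a2 b2 (by rw [hR.colors _ b1, hc]) hcq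
      obtain ⟨y1, y2, y3⟩ := hS.step hN hV hl hc rfl rfl
      refine ⟨_, _, ⟨?_, ?_, ?_, ?_⟩, ⟨?_, ?_, ?_⟩, y1, y2, ?_, ?_, ?_, x2, ?_, ?_, y3.trans hk⟩
      · rw [x1 1 (by norm_num)]; exact hb.reg1
      · rw [x1 2 (by norm_num)]; exact hb.reg2
      · rw [x3 0 (by norm_num)]; exact hb.arr0
      · rw [x3 1 (by norm_num)]; exact hb.arr1
      · rw [x6]
        exact table_update (table_update (table_update (table_update hR.table hcq _) hcq _) hcq _)
          hcq _
      · intro e he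
        rw [x5]
        simp only [Function.update_apply]
        split_ifs <;> simp [hR.colors e he]
      · intro e he
        rw [x4]
        simp only [Function.update_apply]
        split_ifs
        · exact fun _ => rfl
        · simp
        · exact hR.out e he
      · rw [x1 5 (by norm_num)]; exact h5
      · rw [x1 10 (by norm_num)]; exact h10
      · rw [x1 17 (by norm_num)]; exact h17
      · rw [x3 5 (by norm_num)]; exact hF
      · rw [x1 3 (by norm_num)]; exact h3
  · rintro s' ⟨E, col, hb, hR, hV, hS, h5, h10, h17, h18, hF, h3, hk⟩
    simp [Expr.eval, Op.apply, h17, h18]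
  · refine ⟨E, col, hb.setReg (by norm_num) (by norm_num), ⟨hR.table, hR.colors, hR.out⟩, hV, hS,
      ?_, ?_, ?_, ?_, hF, ?_, hk⟩
    · simp [setReg_reg, h5]
    · simp [setReg_reg, h10]
    · simp [setReg_reg, h17]
    · simp [setReg_reg, Expr.eval]
    · simp [setReg_reg, h3]
  · rintro s' ⟨E, col, hb, hR, hV, hS, h5, h10, h17, h18, hF, h3, hk⟩
    refine (Det.block _ _).mono (by norm_num [colorLast]) ?_
    rintro _ rfl
    have a1 := hS.lt h le_rfl le_rfl
    have a2 := hS.inc h le_rfl le_rfl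
    obtain ⟨x1, x2, x3, x4, x5, x6, x7⟩ := exec_colorLast hW hN hb h5 h17 h10 h3 hkm
      (hF h le_rfl) a1 a2 hβ
    refine ⟨_, _, ⟨?_, ?_, ?_, ?_⟩, ⟨?_, ?_, ?_⟩,
      Valid.color hV a1 a2 hβ hS.zero hS.center hS.last, x3, ?_⟩
    · rw [x1]; exact hb.reg1
    · rw [x2]; exact hb.reg2
    · rw [x4 0 (by norm_num)]; exact hb.arr0
    · rw [x4 1 (by norm_num)]; exact hb.arr1
    · rw [x7]
      exact table_update (table_update hR.table hβ _) hβ _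
    · intro e he
      rw [x6]
      simp only [Function.update_apply]
      split_ifs <;> simp [hR.colors e he]
    · intro e he
      rw [x5]
      simp only [Function.update_apply]
      split_ifs
      · exact fun _ => rfl
      · exact hR.out e he
    · have := card_uncolored_update_ne (c := β) a1 hS.zero
      omega

/-- Flip the alternating walk, and color the fan up to one of the two leaves that miss the final
color. -/
def augment : Cmd :=
  .seq flipWalk
    (.seq (.ite (.op .eq (.reg 12) (oth (.reg 5) (.load 5 (.reg 11))))
      (.assign 17 (.reg 7)) (.assign 17 (.reg 11))) shiftFan)

theorem det_augment (hW : Sizes W n m q) (hN : Net n m D eu ev) (hb : Base m q eu ev s)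
    (hR : Rep n m q E col s) (hV : Valid n m q eu ev E col) {x α β i j k : ℕ} {F : ℕ → ℕ}
    (hF : Fan m eu ev E col x F j) (hα : α < q) (hβ : β < q) (hαx : E x α = 0) (hij : i ≤ j)
    (hi : E (other eu ev x (F i)) β = 0) (hj : E (other eu ev x (F j)) β = 0)
    (hlt : ∀ i' < i, E (other eu ev x (F i')) β ≠ 0) (hends : i < j ∨ E x β = 0)
    (h5 : s.reg 5 = x) (h6 : s.reg 6 = α) (h10 : s.reg 10 = β) (h7 : s.reg 7 = j)
    (h11 : s.reg 11 = i) (ha : ∀ l ≤ j, s.arr 5 l = F l) (h3 : s.reg 3 = k)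
    (hk : (uncolored m col).card = k) :
    Det W B augment s (22 * walkLen eu ev E x α β + 26 * j + 39)
      (Ready n m q eu ev (k - 1)) := by
  have hx := hN.lt_of_inc (hF.lt 0 (by omega)) (hF.inc 0 (by omega))
  have hjm := hF.lt_card
  refine (Det.seq (K' := 2 + (26 * (j : ℝ) + 20) + 1) (by positivity) (by positivity)
    (det_flipWalk hW hN hb hR hV hx hα hβ hαx h5 h6 h10) ?_).mono (by linarith) (fun _ h => h)
  rintro s1 ⟨hs, h12, hR1⟩
  have hb1 := hb.sameLow hs
  set L := walkLen eu ev E x α β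
  have hV1 := Valid.flip hN hV hx hα hβ hαx
  have hunc : uncolored m (flipCol eu ev E col x α β L) = uncolored m col := by
    ext e
    rw [mem_uncolored, mem_uncolored, flipCol_eq_zero_iff hN hV hx hα hβ le_rfl]
  have ha1 : ∀ l ≤ j, s1.arr 5 l = F l := by rw [hs.2 5 (by norm_num)]; exact ha
  let h := if walkVertex eu ev E x α β L = other eu ev x (F i) then j else i
  have hSh := hF.flip hN hV hα hβ hαx hij hi hj hlt hends (h := h) rfl
  have hhj : h ≤ j := by simp only [h]; split_ifs <;> omega
  refine Det.seq (by norm_num) (by positivity) (Q := fun s' => s' = s1.setReg 17 h)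
    ?_ ?_
  · have hev : (oth (.reg 5) (.load 5 (.reg 11))).eval W s1 = other eu ev x (F i) := by
      refine eval_oth hW hN hb1 ?_ ?_ (hF.lt i hij)
      · simp only [Expr.eval]; rw [hs.1 5 (by norm_num), h5]
      · simp only [Expr.eval]; rw [hs.1 11 (by norm_num), h11, ha1 i hij]
    have hcond : (Expr.op .eq (.reg 12) (oth (.reg 5) (.load 5 (.reg 11)))).eval W s1 =
        if walkVertex eu ev E x α β L = other eu ev x (F i) then 1 else 0 := by
      rw [Expr.eval, hev]
      simp only [Op.apply, Expr.eval, h12]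
      split_ifs
      · exact Nat.mod_eq_of_lt hW.one
      · simp
    refine (Det.ite (K := 1) zero_le_one ?_ ?_).mono (by norm_num) (fun _ h => h)
    · intro hne
      rw [hcond] at hne
      have hw : walkVertex eu ev E x α β L = other eu ev x (F i) := by
        by_contra hw; simp [hw] at hne
      refine (Det.assign _ _ _).mono le_rfl ?_
      rintro _ rfl
      simp only [Expr.eval, h, if_pos hw]
      rw [hs.1 7 (by norm_num), h7]
    · intro heq
      rw [hcond] at heq
      have hw : walkVertex eu ev E x α β L ≠ other eu ev x (F i) := by
        intro hw; simp [hw] at heq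
      refine (Det.assign _ _ _).mono le_rfl ?_
      rintro _ rfl
      simp only [Expr.eval, h, if_neg hw]
      rw [hs.1 11 (by norm_num), h11]
  · rintro _ rfl
    have hhj' : (h : ℝ) ≤ j := by exact_mod_cast hhj
    refine (det_shiftFan hW hN (hb1.setReg (by norm_num) (by norm_num))
      ⟨hR1.table, hR1.colors, hR1.out⟩ hV1 hβ (by omega) hSh ?_ ?_ ?_
      (fun l hl => ha1 l (by omega)) ?_ (by rw [hunc]; exact hk)).mono (by linarith) (fun _ h => h)
    · rw [setReg_reg, if_neg (by norm_num), hs.1 5 (by norm_num), h5]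
    · rw [setReg_reg, if_neg (by norm_num), hs.1 10 (by norm_num), h10]
    · rw [setReg_reg, if_pos rfl]
    · rw [setReg_reg, if_neg (by norm_num), hs.1 3 (by norm_num), h3]

end
end EdgeColoringProblem

/-! ### Expected cost of growing a fan -/

namespace EdgeColoringProblem
open Finset WordRAM

section
variable {W n m q D : ℕ} {eu ev : ℕ → ℕ} {E : ℕ → ℕ → ℕ} {col : ℕ → ℕ} {s : Store} {B : ℝ}
variable {x α k : ℕ} {ρ κ G H : ℝ}

/-- The state during the construction of a fan at `x`. -/
structure FanState (n m q : ℕ) (eu ev : ℕ → ℕ) (E : ℕ → ℕ → ℕ) (col : ℕ → ℕ) (x α k : ℕ)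
    (s : Store) : Prop where
  base : Base m q eu ev s
  rep : Rep n m q E col s
  reg3 : s.reg 3 = k
  reg5 : s.reg 5 = x
  reg6 : s.reg 6 = α
  fan : Fan m eu ev E col x (s.arr 5) (s.reg 7)

/-- The state after the construction of a fan at `x`. -/
structure FanDone (n m q : ℕ) (eu ev : ℕ → ℕ) (E : ℕ → ℕ → ℕ) (col : ℕ → ℕ) (x α k : ℕ)
    (s : Store) : Prop where
  state : FanState n m q eu ev E col x α k s
  lt : s.reg 10 < q
  le : s.reg 11 ≤ s.reg 7
  inner : E (other eu ev x (s.arr 5 (s.reg 11))) (s.reg 10) = 0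
  last : E (other eu ev x (s.arr 5 (s.reg 7))) (s.reg 10) = 0
  first : ∀ i < s.reg 11, E (other eu ev x (s.arr 5 i)) (s.reg 10) ≠ 0
  ends : s.reg 11 < s.reg 7 ∨ E x (s.reg 10) = 0

/-- The colors that are missing at one of the first `j` leaves. -/
def leafColors (q : ℕ) (eu ev : ℕ → ℕ) (E : ℕ → ℕ → ℕ) (x : ℕ) (F : ℕ → ℕ) (j : ℕ) : Finset ℕ :=
  (range j).biUnion fun i => miss q E (other eu ev x (F i))

theorem leafColors_succ (x : ℕ) (F : ℕ → ℕ) (j : ℕ) :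
    leafColors q eu ev E x F (j + 1) =
      leafColors q eu ev E x F j ∪ miss q E (other eu ev x (F j)) := by
  rw [leafColors, range_add_one, biUnion_insert, union_comm]
  rfl

theorem leafColors_congr {x j : ℕ} {F F' : ℕ → ℕ} (h : ∀ i < j, F i = F' i) :
    leafColors q eu ev E x F j = leafColors q eu ev E x F' j :=
  biUnion_congr rfl fun i hi => by rw [h i (mem_range.1 hi)]

theorem card_leafColors_le (x : ℕ) (F : ℕ → ℕ) (j : ℕ) :
    (leafColors q eu ev E x F j).card ≤ q := by
  have : leafColors q eu ev E x F j ⊆ range q := by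
    intro c hc
    obtain ⟨i, -, hi⟩ := mem_biUnion.1 hc
    exact mem_range.2 (mem_miss.1 hi).1
  simpa using card_le_card this

/-- Bound on the expected number of the remaining leaves, if `u` colors have been seen. -/
noncomputable def fanSteps (q : ℕ) (κ u : ℝ) : ℝ := 2 * (q - u) / κ + 2

/-- Bound on the expected time for the rest of a fan, where `G` is the expected time for a walk. -/
noncomputable def fanValue (q : ℕ) (ρ κ G j u : ℝ) : ℝ :=
  fanSteps q κ u * (2 * ρ + 60 + G) + 28 * (j * fanSteps q κ u + fanSteps q κ u ^ 2)

theorem two_le_fanSteps {u : ℝ} (hκ : 0 < κ) (hu : u ≤ q) : 2 ≤ fanSteps q κ u := by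
  have : 0 ≤ 2 * (q - u) / κ := div_nonneg (by linarith) hκ.le
  unfold fanSteps; linarith

theorem fanSteps_le {u : ℝ} (hκ : 0 < κ) (hu : 0 ≤ u) : fanSteps q κ u ≤ 2 * (q / κ) + 2 := by
  have : 2 * (q - u) / κ ≤ 2 * q / κ := div_le_div_of_nonneg_right (by linarith) hκ.le
  unfold fanSteps
  rw [mul_div_assoc] at this ⊢
  rw [mul_div_assoc] at this
  linarith

theorem fanValue_nonneg {j u : ℝ} (hκ : 0 < κ) (hu : u ≤ q) (hρ : 0 ≤ ρ) (hG : 0 ≤ G)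
    (hj : 0 ≤ j) : 0 ≤ fanValue q ρ κ G j u := by
  have := two_le_fanSteps hκ hu
  unfold fanValue
  positivity

/-- Here `g` colors are missing at the new leaf, `w` of them are new, and `c` of the new ones
continue the fan. If `c / g ≤ 1 / 2`, then `c / g * V' ≤ V / 2 ≤ V - 1` as `V ≥ 2`. Otherwise `w ≥ κ
/ 2`, so `V' ≤ V - 1`. The quadratic part of `fanValue` lets this drop in the number of steps also
pay the cost `28 * j` that grows with the fan. -/
theorem fanValue_drift {j u w g c : ℝ} (hκ : 0 < κ) (hg : κ ≤ g) (hw : w ≤ g) (hc : 0 ≤ c)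
    (hcw : c ≤ w) (huw : u + w ≤ q) (hρ : 0 ≤ ρ) (hG : 0 ≤ G) (hj : 0 ≤ j) :
    c / g * fanValue q ρ κ G (j + 1) (u + w) ≤
      fanValue q ρ κ G j u - (2 * ρ + 60 + G) - 28 * j - 28 := by
  have hg0 : 0 < g := hκ.trans_le hg
  have hV2 := two_le_fanSteps (q := q) hκ (by linarith : u ≤ q)
  have hV2' := two_le_fanSteps (q := q) hκ huw
  have hVV : fanSteps q κ (u + w) = fanSteps q κ u - 2 * w / κ := by
    unfold fanSteps; ring
  set V := fanSteps q κ u with hV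
  set V' := fanSteps q κ (u + w) with hV'
  have hw0 : 0 ≤ w := hc.trans hcw
  have hle : V' ≤ V := by rw [hVV]; have : 0 ≤ 2 * w / κ := by positivity
                          linarith
  have ht0 : 0 ≤ c / g := by positivity
  have ht1 : c / g ≤ 1 := by rw [div_le_one hg0]; linarith
  have key : c / g * V' ≤ V - 1 := by
    rcases le_total (c / g) (1 / 2) with h | h
    · nlinarith
    · have h1 : g ≤ 2 * w := by
        rw [div_le_div_iff₀ (by norm_num) hg0] at h; linarith
      have h2 : 1 ≤ 2 * w / κ := by rw [le_div_iff₀ hκ]; linarith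
      nlinarith
  have e1 : c / g * V' * (2 * ρ + 60 + G) ≤ (V - 1) * (2 * ρ + 60 + G) :=
    mul_le_mul_of_nonneg_right key (by positivity)
  have e2 : c / g * V' * (j + 1) ≤ (V - 1) * (j + 1) :=
    mul_le_mul_of_nonneg_right key (by positivity)
  have e3 : c / g * V' * V' ≤ (V - 1) * V :=
    mul_le_mul key hle (by linarith) (by linarith)
  unfold fanValue
  rw [← hV, ← hV']
  nlinarith

/-- Add a leaf to the fan, or end its construction by setting register `8` to `0`. -/
def fanBody : Cmd :=
  .seq (.assign 9 (oth (.reg 5) (.load 5 (.reg 7))))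
    (.seq (sample 10 (.reg 2) (tab (.reg 9) (.reg 10)))
      (.seq search
        (.ite (.op .add (.op .lt (.reg 11) (.reg 7))
            (.op .eq (tab (.reg 5) (.reg 10)) (.const 0)))
          (.assign 8 (.const 0))
          (block [.store 5 (.op .add (.reg 7) (.const 1))
              (.op .sub (tab (.reg 5) (.reg 10)) (.const 1)),
            .assign 7 (.op .add (.reg 7) (.const 1))]))))

theorem FanState.setReg (h : FanState n m q eu ev E col x α k s) {r v : ℕ} (hr : 8 ≤ r) :
    FanState n m q eu ev E col x α k (s.setReg r v) := by
  refine ⟨h.base.setReg (by omega) (by omega), ⟨h.rep.table, h.rep.colors, h.rep.out⟩, ?_, ?_, ?_,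
    ?_⟩
  · rw [setReg_reg, if_neg (by omega)]; exact h.reg3
  · rw [setReg_reg, if_neg (by omega)]; exact h.reg5
  · rw [setReg_reg, if_neg (by omega)]; exact h.reg6
  · rw [setReg_reg, if_neg (by omega)]; exact h.fan

/-- The bound on the expected remaining time during the construction of a fan. -/
noncomputable def fanPot (q : ℕ) (eu ev : ℕ → ℕ) (E : ℕ → ℕ → ℕ) (x α : ℕ) (ρ κ G H : ℝ)
    (s : Store) : ℝ :=
  if s.reg 8 = 0 then 22 * walkLen eu ev E x α (s.reg 10) + 26 * s.reg 7 + 40 + H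
  else fanValue q ρ κ G (s.reg 7) (leafColors q eu ev E x (s.arr 5) (s.reg 7)).card + H

theorem det_fanDecision (hW : Sizes W n m q) (hN : Net n m D eu ev)
    (hV : Valid n m q eu ev E col) (hx : x < n) {i j β : ℕ}
    (hs : FanState n m q eu ev E col x α k s) (h7 : s.reg 7 = j) (h8 : s.reg 8 ≠ 0)
    (h10 : s.reg 10 = β)
    (h11 : s.reg 11 = i) (hβ : β < q) (hij : i ≤ j)
    (hi : E (other eu ev x (s.arr 5 i)) β = 0) (hj : E (other eu ev x (s.arr 5 j)) β = 0)
    (hlt : ∀ i' < i, E (other eu ev x (s.arr 5 i')) β ≠ 0) :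
    Det W B (.ite (.op .add (.op .lt (.reg 11) (.reg 7))
            (.op .eq (tab (.reg 5) (.reg 10)) (.const 0)))
          (.assign 8 (.const 0))
          (block [.store 5 (.op .add (.reg 7) (.const 1))
              (.op .sub (tab (.reg 5) (.reg 10)) (.const 1)),
            .assign 7 (.op .add (.reg 7) (.const 1))])) s 6 fun s' =>
      ((i < j ∨ E x β = 0) ∧ s'.reg 8 = 0 ∧ s'.reg 7 = j ∧ s'.reg 10 = β ∧
        FanDone n m q eu ev E col x α k s') ∨
      (¬ (i < j ∨ E x β = 0) ∧ s'.reg 8 ≠ 0 ∧ s'.reg 7 = j + 1 ∧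
        (∀ l ≤ j, s'.arr 5 l = s.arr 5 l) ∧ FanState n m q eu ev E col x α k s') := by
  have htab : (tab (.reg 5) (.reg 10)).eval W s = E x β := by
    rw [eval_tab hW hs.base.reg2 (v := .reg 5) (c := .reg 10) hs.reg5 h10 hx hβ,
      hs.rep.table x hx β hβ]
  have hcond : (Expr.op .add (.op .lt (.reg 11) (.reg 7))
      (.op .eq (tab (.reg 5) (.reg 10)) (.const 0))).eval W s = 0 ↔
        ¬ (i < j ∨ E x β = 0) := by
    simp only [Op.apply, Expr.eval, htab, h7, h11, Nat.zero_mod]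
    have h1 : 1 % W = 1 := Nat.mod_eq_of_lt hW.one
    -- The sum of the two tests may be `2`, which must not wrap around to `0`.
    have h2 : 2 < W := by
      have := hW.vert; omega
    by_cases c1 : i < j <;> by_cases c2 : E x β = 0 <;>
      simp [c1, c2, h1, Nat.mod_eq_of_lt h2]
  have hfan := hs.fan
  rw [h7] at hfan
  have hjm := hfan.lt_card
  refine (Det.ite (K := 5) (by norm_num) ?_ ?_).mono (by norm_num) (fun _ h => h)
  · intro hne
    have hends : i < j ∨ E x β = 0 := by
      by_contra h; exact hne (hcond.2 h)
    refine (Det.assign _ _ _).mono (by norm_num) ?_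
    rintro _ rfl
    have e0 : (Expr.const 0).eval W s = 0 := by simp [Expr.eval]
    rw [e0]
    have r7 : (s.setReg 8 0).reg 7 = j := by rw [setReg_reg, if_neg (by norm_num), h7]
    have r10 : (s.setReg 8 0).reg 10 = β := by rw [setReg_reg, if_neg (by norm_num), h10]
    have r11 : (s.setReg 8 0).reg 11 = i := by rw [setReg_reg, if_neg (by norm_num), h11]
    refine Or.inl ⟨hends, by simp [setReg_reg], r7, r10, hs.setReg le_rfl, ?_, ?_, ?_, ?_, ?_, ?_⟩
      <;> simpa only [r7, r10, r11, setReg_arr]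
  · intro heq
    have hcont := hcond.1 heq
    refine (Det.block _ _).mono (by norm_num) ?_
    rintro _ rfl
    have hWm := hW.edge
    have i1 : 1 % W = 1 := Nat.mod_eq_of_lt hW.one
    have i2 : (j + 1) % W = j + 1 := Nat.mod_eq_of_lt (by omega)
    have hxβ : E x β ≠ 0 := fun h => hcont (Or.inr h)
    have hem := (Valid.spec hN hV hx hβ hxβ).1
    have i3 : (E x β - 1) % W = E x β - 1 := Nat.mod_eq_of_lt (by omega)
    -- The fan continues only if no earlier leaf misses `β` and `β` occurs at `x`, which is what
    -- `Fan.extend` requires.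
    have hij' : i = j := by
      by_contra hne
      exact hcont (Or.inl (by omega))
    subst hij'
    have hs' : execBlock W [.store 5 (.op .add (.reg 7) (.const 1))
        (.op .sub (tab (.reg 5) (.reg 10)) (.const 1)),
        .assign 7 (.op .add (.reg 7) (.const 1))] s =
        (s.setArr 5 (i + 1) (E x β - 1)).setReg 7 (i + 1) := by
      simp only [execBlock, Instr.exec, Op.apply, Expr.eval, htab, setArr_reg, h7, i1, i2, i3]
    rw [hs']
    have hext := hfan.extend hN hV hβ hj hlt hxβ
    refine Or.inr ⟨hcont, ?_, ?_, ?_, ⟨⟨?_, ?_, ?_, ?_⟩, ⟨?_, ?_, ?_⟩, ?_, ?_, ?_, ?_⟩⟩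
    · simp only [setReg_reg, setArr_reg]; rw [if_neg (by norm_num)]; exact h8
    · simp [setReg_reg]
    · intro l hl
      simp only [setReg_arr, setArr_arr, if_true]
      exact Function.update_of_ne (by omega) _ _
    · simp only [setReg_reg, setArr_reg]; rw [if_neg (by norm_num)]; exact hs.base.reg1
    · simp only [setReg_reg, setArr_reg]; rw [if_neg (by norm_num)]; exact hs.base.reg2
    · simpa [setReg_arr, setArr_arr] using hs.base.arr0
    · simpa [setReg_arr, setArr_arr] using hs.base.arr1
    · simpa [setReg_arr, setArr_arr] using hs.rep.table
    · simpa [setReg_arr, setArr_arr] using hs.rep.colors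
    · simpa [setReg_arr, setArr_arr] using hs.rep.out
    · simp only [setReg_reg, setArr_reg]; rw [if_neg (by norm_num)]; exact hs.reg3
    · simp only [setReg_reg, setArr_reg]; rw [if_neg (by norm_num)]; exact hs.reg5
    · simp only [setReg_reg, setArr_reg]; rw [if_neg (by norm_num)]; exact hs.reg6
    · simp only [setReg_arr, setReg_reg, setArr_arr, if_true]; exact hext

/-- From `fanSteps ≤ 2 * ρ + 2 ≤ 4 * ρ`: the coefficient of `ρ ^ 2` is `4 * 62 + 28 * 16 = 696`, and
that of `ρ * M` is `28 * 4`. -/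
theorem fanValue_le {j u M : ℝ} (hκ : 0 < κ) (hρ : ρ = q / κ) (hu : 0 ≤ u) (hu' : u ≤ q)
    (hj0 : 0 ≤ j) (hj : j ≤ M) (hG0 : 0 ≤ G) (hρ1 : 1 ≤ ρ) :
    fanValue q ρ κ G j u ≤ 700 * ρ ^ 2 + 4 * ρ * G + 112 * ρ * M := by
  have h1 := fanSteps_le (q := q) hκ hu
  rw [← hρ] at h1
  have h2 : fanSteps q κ u ≤ 4 * ρ := by linarith
  have h3 := two_le_fanSteps hκ hu'
  unfold fanValue
  set V := fanSteps q κ u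
  have e1 : V * (2 * ρ + 60 + G) ≤ 4 * ρ * (62 * ρ + G) :=
    mul_le_mul h2 (by linarith) (by linarith) (by linarith)
  have e2 : j * V ≤ M * (4 * ρ) := mul_le_mul hj h2 (by linarith) (by linarith)
  have e3 : V ^ 2 ≤ (4 * ρ) ^ 2 := pow_le_pow_left₀ (by linarith) h2 2
  nlinarith

/-- A given `β` is drawn with probability at most `1 / κ`, so `G` bounds the expected cost of a walk
started after any one draw. Each of the at most `4 * ρ` expected leaves is charged `G`, because its
draw may be the final one. -/
theorem wp_fanLoop_le (hW : Sizes W n m q) (hN : Net n m D eu ev)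
    (hV : Valid n m q eu ev E col) (hDq : D < q) (hκ : κ = q - D) (hρ : ρ = q / κ)
    (hx : x < n) (hα : α < q) (hαx : E x α = 0)
    (hG : G = 22 / κ * ∑ β ∈ range q, (walkLen eu ev E x α β : ℝ)) (hH : 0 ≤ H)
    (hB : 700 * ρ ^ 2 + 4 * ρ * G + 200 * ρ * m + H ≤ B)
    {f : Store → ENNReal} (hf : ∀ s', FanDone n m q eu ev E col x α k s' →
      f s' ≤ ENNReal.ofReal (22 * walkLen eu ev E x α (s'.reg 10) + 26 * s'.reg 7 + 39 + H))
    (hs : FanState n m q eu ev E col x α k s) (h7 : s.reg 7 = 0) (h8 : s.reg 8 ≠ 0) :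
    wp W B (.loop (.reg 8) fanBody) f s ≤
      ENNReal.ofReal (700 * ρ ^ 2 + 4 * ρ * G + H) := by
  classical
  have hκ0 : 0 < κ := by rw [hκ, sub_pos]; exact_mod_cast hDq
  have hκq : κ ≤ q := by rw [hκ]; linarith [(Nat.cast_nonneg D : (0 : ℝ) ≤ D)]
  have hρ1 : 1 ≤ ρ := by rw [hρ, le_div_iff₀ hκ0]; linarith
  have hG0 : 0 ≤ G := by rw [hG]; positivity
  have hm1 : 1 ≤ m := by have := hs.fan.lt_card; omega
  have hm1' : (1 : ℝ) ≤ m := by exact_mod_cast hm1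
  have hρm : (m : ℝ) ≤ ρ * m := by nlinarith
  have hρ2 : 1 ≤ ρ ^ 2 := by nlinarith
  have hρG : 0 ≤ ρ * G := by positivity
  let Inv : Store → Prop := fun s => FanState n m q eu ev E col x α k s ∧
    (s.reg 8 = 0 → FanDone n m q eu ev E col x α k s)
  let pot := fanPot q eu ev E x α ρ κ G H
  have hu : ∀ F j, ((leafColors q eu ev E x F j).card : ℝ) ≤ q := fun F j => by
    exact_mod_cast card_leafColors_le x F j
  have hval : ∀ j : ℕ, j ≤ m → ∀ F, fanValue q ρ κ G j (leafColors q eu ev E x F j).card ≤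
      700 * ρ ^ 2 + 4 * ρ * G + 112 * ρ * m := fun j hj F =>
    fanValue_le hκ0 hρ (Nat.cast_nonneg _) (hu F j) (Nat.cast_nonneg _) (by exact_mod_cast hj)
      hG0 hρ1
  have hval0 : ∀ (j : ℕ) F, 0 ≤ fanValue q ρ κ G j (leafColors q eu ev E x F j).card := fun j F =>
    fanValue_nonneg hκ0 (hu F j) (by linarith) hG0 (Nat.cast_nonneg _)
  have hlen : ∀ β < q, (walkLen eu ev E x α β : ℝ) ≤ m := fun β hβ => by
    exact_mod_cast walkLen_le hN hV hx hα hβ hαx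
  have hpotB : ∀ s, Inv s → pot s ≤ B := by
    rintro s ⟨h1, h2⟩
    have hj := h1.fan.lt_card
    have hj' : (s.reg 7 : ℝ) ≤ m := by exact_mod_cast hj.le
    simp only [pot, fanPot]
    split_ifs with h
    · have := hlen _ (h2 h).lt
      linarith
    · have := hval _ hj.le (s.arr 5)
      linarith
  have hpots : pot s ≤ 700 * ρ ^ 2 + 4 * ρ * G + H := by
    simp only [pot, fanPot]
    rw [if_neg h8, h7]
    have := fanValue_le (q := q) (j := 0) (u := 0) (M := 0) hκ0 hρ le_rfl (Nat.cast_nonneg _)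
      le_rfl le_rfl hG0 hρ1
    simp only [leafColors, range_zero, biUnion_empty, card_empty, Nat.cast_zero]
    linarith
  refine (wp_loop_le_of_potential Inv pot hpotB ?_ ?_ (s := s) ⟨hs, fun h => absurd h h8⟩).trans
    (ENNReal.ofReal_le_ofReal hpots)
  · rintro s ⟨hs, -⟩ (h8 : s.reg 8 ≠ 0) g hg
    obtain ⟨j, hj⟩ : ∃ j, s.reg 7 = j := ⟨_, rfl⟩
    obtain ⟨F, hF⟩ : ∃ F, s.arr 5 = F := ⟨_, rfl⟩
    have hfan := hs.fan
    rw [hj, hF] at hfan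
    have hjm := hfan.lt_card
    have hjm' : (j : ℝ) + 1 ≤ m := by exact_mod_cast hjm
    obtain ⟨y, hy⟩ : ∃ y, other eu ev x (F j) = y := ⟨_, rfl⟩
    have hyn : y < n := hy ▸ hN.other_lt (hfan.lt j le_rfl) (hfan.inc j le_rfl)
    have hMcard : κ ≤ (miss q E y).card := by
      have := Valid.le_card_miss hN hV hyn
      rw [hκ, sub_le_iff_le_add']
      exact_mod_cast this
    set U := leafColors q eu ev E x F j with hU
    set M := miss q E y with hM
    have hg0 : (0 : ℝ) < M.card := hκ0.trans_le hMcard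
    have hpot_s : pot s = fanValue q ρ κ G j U.card + H := by
      simp only [pot, fanPot]
      rw [if_neg h8, hj, hF]
    have hval1 : ∀ F', (∀ l ≤ j, F' l = F l) →
        leafColors q eu ev E x F' (j + 1) = U ∪ M := by
      intro F' hF'
      rw [leafColors_congr (F' := F) fun i hi => hF' i (by omega), leafColors_succ, hy]
    set P' := fanValue q ρ κ G (j + 1) (U ∪ M).card with hP'
    have hP'0 : 0 ≤ P' := by
      have := hval0 (j + 1) F
      rw [hval1 F fun _ _ => rfl] at this
      push_cast at this
      exact this
    have hP'B : P' ≤ 700 * ρ ^ 2 + 4 * ρ * G + 112 * ρ * m := by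
      have := hval (j + 1) hjm F
      rw [hval1 F fun _ _ => rfl] at this
      push_cast at this
      exact this
    -- The two reasons to stop: `β` was missing at an earlier leaf, or it is missing at `x`.
    let ends : ℕ → Prop := fun β => β ∈ U ∨ E x β = 0
    let X : ℕ → ℝ := fun β => 28 * j + 53 + H +
      (if ends β then 22 * (walkLen eu ev E x α β : ℝ) else P')
    have hX0 : ∀ β, 0 ≤ X β := by
      intro β
      simp only [X]
      split_ifs <;> positivity
    have hsum : (∑ β ∈ M, X β) / M.card + (2 * ρ + 10) ≤ pot s := by
      -- The walks of the stopping colors are bounded by those of all colors; dividing by `M.card ≥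
      -- κ` then gives at most `G`.
      have e1 : ∑ β ∈ M, X β ≤ M.card * (28 * j + 53 + H) +
          22 * ∑ β ∈ range q, (walkLen eu ev E x α β : ℝ) +
            (M.filter fun β => ¬ ends β).card * P' := by
        simp only [X, sum_add_distrib, sum_const, nsmul_eq_mul]
        rw [sum_ite, sum_const, nsmul_eq_mul, ← mul_sum]
        have : ∑ β ∈ M.filter ends, (walkLen eu ev E x α β : ℝ) ≤
            ∑ β ∈ range q, (walkLen eu ev E x α β : ℝ) :=
          sum_le_sum_of_subset_of_nonneg
            ((filter_subset _ _).trans (filter_subset _ _)) fun _ _ _ => Nat.cast_nonneg _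
        linarith
      have hcard : U.card + (M \ U).card = (U ∪ M).card := by
        rw [← card_union_of_disjoint disjoint_sdiff, union_sdiff_self_eq_union]
      have hcard' : ((U ∪ M).card : ℝ) = U.card + (M \ U).card := by exact_mod_cast hcard.symm
      have hUM : ((U ∪ M).card : ℝ) ≤ q := by
        have := hu F (j + 1)
        rwa [hval1 F fun _ _ => rfl] at this
      have e2 := fanValue_drift (q := q) (j := j) (u := U.card) (w := (M \ U).card)
        (g := M.card) (c := (M.filter fun β => ¬ ends β).card) (ρ := ρ) (G := G) hκ0 hMcard
        (by exact_mod_cast card_le_card sdiff_subset) (Nat.cast_nonneg _)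
        (by
          have : (M.filter fun β => ¬ ends β) ⊆ M \ U := by
            intro β hβ
            rw [mem_filter] at hβ
            exact mem_sdiff.2 ⟨hβ.1, fun h => hβ.2 (Or.inl h)⟩
          exact_mod_cast card_le_card this)
        (by rw [← hcard']; exact hUM) (by linarith) hG0 (Nat.cast_nonneg _)
      rw [← hcard', ← hP'] at e2
      have e3 : 22 * ∑ β ∈ range q, (walkLen eu ev E x α β : ℝ) / M.card ≤ G := by
        rw [hG, ← sum_div, div_mul_eq_mul_div, mul_div_assoc]
        exact mul_le_mul_of_nonneg_left (div_le_div_of_nonneg_left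
          (sum_nonneg fun _ _ => Nat.cast_nonneg _) hκ0 hMcard) (by norm_num)
      have e4 : (∑ β ∈ M, X β) / M.card ≤ (28 * j + 53 + H) +
          22 * ∑ β ∈ range q, (walkLen eu ev E x α β : ℝ) / M.card +
            (M.filter fun β => ¬ ends β).card / M.card * P' := by
        rw [div_le_iff₀ hg0, ← sum_div]
        refine e1.trans (le_of_eq ?_)
        field_simp
      rw [hpot_s]
      linarith
    have hpotsB : pot s ≤ B := hpotB s ⟨hs, fun h => absurd h h8⟩
    have hSnonneg : 0 ≤ (∑ β ∈ M, X β) / M.card :=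
      div_nonneg (sum_nonneg fun β _ => hX0 β) hg0.le
    refine ⟨pot s - 1, by linarith, by linarith, ?_⟩
    have hev : (oth (.reg 5) (.load 5 (.reg 7))).eval W s = y := by
      rw [← hy]
      refine eval_oth hW hN hs.base hs.reg5 ?_ (hfan.lt j le_rfl)
      simp only [Expr.eval, hj, hF]
    suffices hmain : wp W B (.seq (sample 10 (.reg 2) (tab (.reg 9) (.reg 10)))
      (.seq search
        (.ite (.op .add (.op .lt (.reg 11) (.reg 7))
            (.op .eq (tab (.reg 5) (.reg 10)) (.const 0)))
          (.assign 8 (.const 0))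
          (block [.store 5 (.op .add (.reg 7) (.const 1))
              (.op .sub (tab (.reg 5) (.reg 10)) (.const 1)),
            .assign 7 (.op .add (.reg 7) (.const 1))])))) g (s.setReg 9 y) ≤
        ENNReal.ofReal (pot s - 4 + 1) by
      have h1 := (Det.assign (W := W) (B := B) 9 (oth (.reg 5) (.load 5 (.reg 7))) s) _
        (pot s - 4 + 1) (by linarith) (by rintro _ rfl; rw [hev]; exact hmain) (by linarith)
      refine (wp_seq_le (by linarith) h1 (by linarith)).trans (ENNReal.ofReal_le_ofReal ?_)
      linarith
    have hs1 := hs.setReg (r := 9) (v := y) (by norm_num)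
    refine wp_seq_le (by linarith) ?_ (by linarith)
    have hMq : M ⊆ range q := filter_subset _ _
    refine wp_sample_le (N := q) (S := M) ?_ ?_ (card_pos.1 (by exact_mod_cast hg0)) hMq ?_ X
      (fun β _ => hX0 β) ?_ ?_ (Y := pot s - 4) ?_ (by linarith)
    · intro v _
      exact (hs1.setReg (r := 10) (v := v) (by norm_num)).base.reg2
    · exact hs1.base.reg2
    · intro v hv
      have hs2 := hs1.setReg (r := 10) (v := v) (by norm_num)
      rw [eval_tab hW hs2.base.reg2 (v := .reg 9) (c := .reg 10) (a := y) (b := v)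
        (by simp [Expr.eval, setReg_reg]) (by simp [Expr.eval, setReg_reg]) hyn hv,
        hs2.rep.table y hyn v hv, hM, mem_miss]
      tauto
    · intro β hβ
      have hβq := (mem_miss.1 hβ).1
      have hyβ := (mem_miss.1 hβ).2
      have hs2 := hs1.setReg (r := 10) (v := β) (by norm_num)
      have hXB : X β + 10 ≤ B := by
        simp only [X]
        split_ifs
        · have := hlen β hβq; linarith
        · linarith
      have hrest : ∀ i, (i < j ∨ i = j) → E (other eu ev x (F i)) β = 0 →
          (∀ i' < i, E (other eu ev x (F i')) β ≠ 0) → Det W B (.ite (.op .add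
            (.op .lt (.reg 11) (.reg 7)) (.op .eq (tab (.reg 5) (.reg 10)) (.const 0)))
          (.assign 8 (.const 0))
          (block [.store 5 (.op .add (.reg 7) (.const 1))
              (.op .sub (tab (.reg 5) (.reg 10)) (.const 1)),
            .assign 7 (.op .add (.reg 7) (.const 1))]))
            (((s.setReg 9 y).setReg 10 β).setReg 11 i) 6 fun s' => Inv s' ∧
              pot s' ≤ X β - 2 * j - 13 := by
        intro i hij hi hlt
        have hs3 := hs2.setReg (r := 11) (v := i) (by norm_num)
        refine (det_fanDecision hW hN hV hx hs3 (i := i) (j := j) (β := β) ?_ ?_ ?_ ?_ hβq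
          (by omega) ?_ ?_ ?_).mono le_rfl ?_
        · simp [setReg_reg, hj]
        · simpa [setReg_reg] using h8
        · simp [setReg_reg]
        · simp [setReg_reg]
        · simp only [setReg_arr, hF]; exact hi
        · simp only [setReg_arr, hF, hy]; exact hyβ
        · simp only [setReg_arr, hF]; exact hlt
        · have hiff : ends β ↔ (i < j ∨ E x β = 0) := by
            refine or_congr ?_ Iff.rfl
            rw [hU, leafColors, mem_biUnion]
            constructor
            · rintro ⟨i', hi', hm⟩
              have := mem_range.1 hi'
              by_contra hnot
              exact hlt i' (by omega) (mem_miss.1 hm).2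
            · intro h
              exact ⟨i, mem_range.2 h, mem_miss.2 ⟨hβq, hi⟩⟩
          rintro s' (⟨hst, r8, r7, r10, hd⟩ | ⟨hst, r8, r7, hF', hst'⟩)
          · refine ⟨⟨hd.state, fun _ => hd⟩, ?_⟩
            simp only [pot, fanPot, X]
            rw [if_pos r8, if_pos (hiff.2 hst), r7, r10]
            linarith
          · refine ⟨⟨hst', fun h => absurd h r8⟩, ?_⟩
            simp only [pot, fanPot, X]
            rw [if_neg r8, if_neg (fun h => hst (hiff.1 h)), r7, hval1]
            · push_cast
              rw [← hP']
              have : (0 : ℝ) ≤ j := Nat.cast_nonneg _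
              linarith
            · intro l hl
              rw [hF' l hl]
              simp only [setReg_arr, hF]
      have hdet : Det W B (.seq search (.ite (.op .add
            (.op .lt (.reg 11) (.reg 7)) (.op .eq (tab (.reg 5) (.reg 10)) (.const 0)))
          (.assign 8 (.const 0))
          (block [.store 5 (.op .add (.reg 7) (.const 1))
              (.op .sub (tab (.reg 5) (.reg 10)) (.const 1)),
            .assign 7 (.op .add (.reg 7) (.const 1))])))
            ((s.setReg 9 y).setReg 10 β) (2 * j + 3 + 6 + 1) fun s' => Inv s' ∧
              pot s' ≤ X β - 2 * j - 13 := by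
        refine Det.seq (by positivity) (by norm_num)
          (det_search hW hN hs2.base hs2.rep (j := j) (F := F) hfan hs2.reg5 (β := β)
            (by simp [setReg_reg]) hβq (fun l _ => by simp only [setReg_arr, hF])
            (by rw [hy]; exact hyβ)) ?_
        rintro _ ⟨i, hij, hi, hlt, rfl⟩
        exact hrest i (by omega) hi hlt
      have hnn : 0 ≤ X β - 2 * j - 13 := by
        simp only [X]
        have : (0 : ℝ) ≤ j := Nat.cast_nonneg _
        split_ifs
        · have : (0 : ℝ) ≤ walkLen eu ev E x α β := Nat.cast_nonneg _
          linarith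
        · linarith
      refine (hdet g (X β - 2 * j - 13) hnn (fun s' hs' => (hg s' hs'.1).trans
        (ENNReal.ofReal_le_ofReal hs'.2)) (by linarith)).trans (ENNReal.ofReal_le_ofReal ?_)
      linarith
    · intro β hβ
      have hβq := (mem_miss.1 hβ).1
      simp only [X]
      split_ifs
      · have := hlen β hβq; linarith
      · linarith
    · have : 2 * (q : ℝ) / M.card ≤ 2 * ρ := by
        rw [hρ, mul_div_assoc]
        exact mul_le_mul_of_nonneg_left
          (div_le_div_of_nonneg_left (Nat.cast_nonneg _) hκ0 hMcard) (by norm_num)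
      linarith
  · rintro s ⟨hs, hd⟩ (h8 : s.reg 8 = 0)
    refine ⟨22 * walkLen eu ev E x α (s.reg 10) + 26 * s.reg 7 + 39 + H, by positivity, ?_,
      hf s (hd h8)⟩
    simp only [pot, fanPot]
    rw [if_pos h8]
    linarith

end
end EdgeColoringProblem

/-! ### Expected cost of one iteration and of the whole program -/

namespace EdgeColoringProblem
open Finset WordRAM

section
variable {W n m q D : ℕ} {eu ev : ℕ → ℕ} {s : Store} {B : ℝ} {ρ κ H : ℝ}

/-- Color one more edge. -/
def iteration : Cmd :=
  .seq (sample 4 (.reg 1) (.load 3 (.reg 4)))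
    (.seq (.assign 5 (.load 0 (.reg 4)))
      (.seq (sample 6 (.reg 2) (tab (.reg 5) (.reg 6)))
        (.seq (block [.assign 7 (.const 0), .store 5 (.const 0) (.reg 4), .assign 8 (.const 1)])
          (.seq (.loop (.reg 8) fanBody) augment))))

theorem Rep.setReg {E : ℕ → ℕ → ℕ} {col : ℕ → ℕ} (hR : Rep n m q E col s) (r v : ℕ) :
    Rep n m q E col (s.setReg r v) := ⟨hR.table, hR.colors, hR.out⟩

/-- The cap requires even the worst intermediate bounds to stay below `B`; for this the crude
estimate `G ≤ 22 * ρ * m` is enough. The conclusion keeps `G`, which is averaged afterwards. -/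
theorem wp_growAndAugment_le {E : ℕ → ℕ → ℕ} {col : ℕ → ℕ} {x α k e : ℕ} {G : ℝ}
    (hW : Sizes W n m q) (hN : Net n m D eu ev)
    (hV : Valid n m q eu ev E col) (hDq : D < q) (hκ : κ = q - D) (hρ : ρ = q / κ)
    (hα : α < q) (hαx : E x α = 0)
    (hG : G = 22 / κ * ∑ β ∈ range q, (walkLen eu ev E x α β : ℝ)) (hH : 0 ≤ H)
    (hB : H + 1100 * ρ ^ 3 * m ≤ B) {g : Store → ENNReal}
    (hg : ∀ s', Ready n m q eu ev (k - 1) s' → g s' ≤ ENNReal.ofReal H)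
    (hb : Base m q eu ev s) (hR : Rep n m q E col s) (h3 : s.reg 3 = k)
    (hk : (uncolored m col).card = k) (h4 : s.reg 4 = e) (h5 : s.reg 5 = x) (h6 : s.reg 6 = α)
    (hem : e < m) (hxe : Inc eu ev x e) (he : col e = 0) :
    wp W B (.seq (block [.assign 7 (.const 0), .store 5 (.const 0) (.reg 4),
      .assign 8 (.const 1)]) (.seq (.loop (.reg 8) fanBody) augment)) g s ≤
        ENNReal.ofReal (H + 9 + 700 * ρ ^ 2 + 4 * ρ * G) := by
  have hx := hN.lt_of_inc hem hxe
  have hκ0 : 0 < κ := by rw [hκ, sub_pos]; exact_mod_cast hDq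
  have hκq : κ ≤ q := by rw [hκ]; linarith [(Nat.cast_nonneg D : (0 : ℝ) ≤ D)]
  have hρ1 : 1 ≤ ρ := by rw [hρ, le_div_iff₀ hκ0]; linarith
  have hG0 : 0 ≤ G := by rw [hG]; positivity
  have hm1 : (1 : ℝ) ≤ m := by exact_mod_cast (by omega : 1 ≤ m)
  have hGm : G ≤ 22 * ρ * m := by
    have h1 : ∑ β ∈ range q, (walkLen eu ev E x α β : ℝ) ≤ q * m := by
      have := sum_le_card_nsmul (range q) (fun β => (walkLen eu ev E x α β : ℝ)) m
        (fun β hβ => by exact_mod_cast walkLen_le hN hV hx hα (mem_range.1 hβ) hαx)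
      simpa using this
    rw [hG, hρ]
    calc 22 / κ * ∑ β ∈ range q, (walkLen eu ev E x α β : ℝ) ≤ 22 / κ * (q * m) :=
          mul_le_mul_of_nonneg_left h1 (by positivity)
      _ = 22 * (q / κ) * m := by ring
  have hρ2 : ρ ≤ ρ ^ 2 := by nlinarith
  have hρ3 : ρ ^ 2 ≤ ρ ^ 3 := by nlinarith [sq_nonneg ρ]
  have hm0 : (0 : ℝ) ≤ m := by linarith
  have a1 : ρ * G ≤ 22 * ρ ^ 3 * m := by
    calc ρ * G ≤ ρ * (22 * ρ * m) := mul_le_mul_of_nonneg_left hGm (by linarith)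
      _ = 22 * (ρ ^ 2 * m) := by ring
      _ ≤ 22 * (ρ ^ 3 * m) := by gcongr
      _ = _ := by ring
  have a2 : ρ ^ 2 ≤ ρ ^ 3 * m := by nlinarith [pow_pos (by linarith : 0 < ρ) 3]
  have a3 : ρ * m ≤ ρ ^ 3 * m := by nlinarith
  have a4 : (m : ℝ) ≤ ρ ^ 3 * m := by nlinarith
  have a5 : (1 : ℝ) ≤ ρ ^ 3 * m := by nlinarith
  have hρG : 0 ≤ ρ * G := by positivity
  have i1 : 1 % W = 1 := Nat.mod_eq_of_lt hW.one
  have hexec : execBlock W [.assign 7 (.const 0), .store 5 (.const 0) (.reg 4),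
      .assign 8 (.const 1)] s = ((s.setReg 7 0).setArr 5 0 e).setReg 8 1 := by
    simp [execBlock, Instr.exec, Expr.eval, setReg_reg, h4, i1]
  have hstate : FanState n m q eu ev E col x α k (((s.setReg 7 0).setArr 5 0 e).setReg 8 1) := by
    refine ⟨⟨?_, ?_, ?_, ?_⟩, ⟨?_, ?_, ?_⟩, ?_, ?_, ?_, ?_⟩
    · simpa [setReg_reg, setArr_reg] using hb.reg1
    · simpa [setReg_reg, setArr_reg] using hb.reg2
    · simpa [setReg_arr, setArr_arr] using hb.arr0
    · simpa [setReg_arr, setArr_arr] using hb.arr1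
    · simpa [setReg_arr, setArr_arr] using hR.table
    · simpa [setReg_arr, setArr_arr] using hR.colors
    · simpa [setReg_arr, setArr_arr] using hR.out
    · simpa [setReg_reg, setArr_reg] using h3
    · simpa [setReg_reg, setArr_reg] using h5
    · simpa [setReg_reg, setArr_reg] using h6
    · have h0 : (((s.setReg 7 0).setArr 5 0 e).setReg 8 1).arr 5 0 = e := by
        simp [setReg_arr, setArr_arr]
      have h7 : (((s.setReg 7 0).setArr 5 0 e).setReg 8 1).reg 7 = 0 := by
        simp [setReg_reg, setArr_reg]
      rw [h7]
      refine ⟨fun l hl => ?_, fun l hl => ?_, ?_, fun l hl => absurd hl (by omega),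
        fun l hl => absurd hl (by omega), fun l hl => absurd hl (by omega)⟩
      · obtain rfl : l = 0 := by omega
        rw [h0]; exact hem
      · obtain rfl : l = 0 := by omega
        rw [h0]; exact hxe
      · rw [h0]; exact he
  have hloop := wp_fanLoop_le (B := B) (f := wp W B augment g) hW hN hV hDq hκ hρ hx hα hαx hG hH
    (by nlinarith) ?_ hstate (by simp [setReg_reg, setArr_reg]) (by simp [setReg_reg])
  · have h1 := (Det.block (W := W) (B := B) [.assign 7 (.const 0), .store 5 (.const 0) (.reg 4),
      .assign 8 (.const 1)] s) (wp W B (.seq (.loop (.reg 8) fanBody) augment) g)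
      (700 * ρ ^ 2 + 4 * ρ * G + H + 1) (by positivity) (by
        rintro _ rfl
        rw [hexec]
        exact wp_seq_le (by positivity) hloop (by nlinarith)) (by norm_num; nlinarith)
    refine (wp_seq_le (by positivity) h1 (by norm_num; nlinarith)).trans
      (ENNReal.ofReal_le_ofReal (by norm_num; linarith))
  · intro s' hd
    have hj := hd.state.fan.lt_card
    have hj' : (s'.reg 7 : ℝ) ≤ m := by exact_mod_cast hj.le
    have hl : (walkLen eu ev E x α (s'.reg 10) : ℝ) ≤ m := by
      exact_mod_cast walkLen_le hN hV hx hα hd.lt hαx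
    refine (det_augment hW hN hd.state.base hd.state.rep hV hd.state.fan hα hd.lt hαx hd.le
      hd.inner hd.last hd.first hd.ends hd.state.reg5 hd.state.reg6 rfl rfl rfl (fun _ _ => rfl)
      hd.state.reg3 hk g H hH hg (by nlinarith)).trans (ENNReal.ofReal_le_ofReal (by linarith))

theorem sum_walkLen_le_mul {E : ℕ → ℕ → ℕ} {col : ℕ → ℕ} {x α : ℕ} (hN : Net n m D eu ev)
    (hV : Valid n m q eu ev E col) (hx : x < n) (hα : α < q) (hαx : E x α = 0) :
    ∑ β ∈ range q, walkLen eu ev E x α β ≤ q * m := by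
  have := sum_le_card_nsmul (range q) (fun β => walkLen eu ev E x α β) m
    (fun β hβ => walkLen_le hN hV hx hα (mem_range.1 hβ) hαx)
  simpa using this

/-- Averaging over `α`, of which there are at least `κ`, supplies the second factor `1 / κ`; the
coefficient is `88 = 4 * 22`. -/
theorem wp_pickColor_le {E : ℕ → ℕ → ℕ} {col : ℕ → ℕ} {x k e : ℕ} {Y : ℝ}
    (hW : Sizes W n m q) (hN : Net n m D eu ev)
    (hV : Valid n m q eu ev E col) (hDq : D < q) (hκ : κ = q - D) (hρ : ρ = q / κ) (hH : 0 ≤ H)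
    (hB : H + 1100 * ρ ^ 3 * m ≤ B) {g : Store → ENNReal}
    (hg : ∀ s', Ready n m q eu ev (k - 1) s' → g s' ≤ ENNReal.ofReal H)
    (hb : Base m q eu ev s) (hR : Rep n m q E col s) (h3 : s.reg 3 = k)
    (hk : (uncolored m col).card = k) (h4 : s.reg 4 = e) (h5 : s.reg 5 = x)
    (hem : e < m) (hxe : Inc eu ev x e) (he : col e = 0)
    (hY : H + 712 * ρ ^ 2 + 88 * ρ / κ ^ 2 *
      (∑ α ∈ miss q E x, ∑ β ∈ range q, walkLen eu ev E x α β : ℕ) ≤ Y) (hYB : Y ≤ B) :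
    wp W B (sample 6 (.reg 2) (tab (.reg 5) (.reg 6)))
        (wp W B (.seq (block [.assign 7 (.const 0), .store 5 (.const 0) (.reg 4),
          .assign 8 (.const 1)]) (.seq (.loop (.reg 8) fanBody) augment)) g) s ≤
      ENNReal.ofReal Y := by
  have hκ0 : 0 < κ := by rw [hκ, sub_pos]; exact_mod_cast hDq
  have hκq : κ ≤ q := by rw [hκ]; linarith [(Nat.cast_nonneg D : (0 : ℝ) ≤ D)]
  have hρ1 : 1 ≤ ρ := by rw [hρ, le_div_iff₀ hκ0]; linarith
  have hm1 : (1 : ℝ) ≤ m := by exact_mod_cast (by omega : 1 ≤ m)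
  have hρ2 : ρ ≤ ρ ^ 2 := by nlinarith
  have hρ3 : ρ ^ 2 ≤ ρ ^ 3 := by nlinarith [sq_nonneg ρ]
  have hxn : x < n := hN.lt_of_inc hem hxe
  have hMcard : κ ≤ (miss q E x).card := by
    have := Valid.le_card_miss hN hV hxn
    rw [hκ, sub_le_iff_le_add']
    exact_mod_cast this
  have hM0 : (0 : ℝ) < (miss q E x).card := hκ0.trans_le hMcard
  let Ga : ℕ → ℝ := fun α => 22 / κ * ∑ β ∈ range q, (walkLen eu ev E x α β : ℝ)
  have hGa0 : ∀ α, 0 ≤ Ga α := fun α => by simp only [Ga]; positivity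
  have hGaM : ∑ α ∈ miss q E x, Ga α =
      22 / κ * (∑ α ∈ miss q E x, ∑ β ∈ range q, walkLen eu ev E x α β : ℕ) := by
    simp only [Ga, ← mul_sum]
    push_cast
    rfl
  refine wp_sample_le (N := q) (S := miss q E x) ?_ ?_
    (card_pos.1 (by exact_mod_cast hM0)) (filter_subset _ _) ?_
    (fun α => H + 9 + 700 * ρ ^ 2 + 4 * ρ * Ga α)
    (fun α _ => by have := hGa0 α; positivity) ?_ ?_ (le_trans ?_ hY) hYB
  · intro v _
    exact (hb.setReg (r := 6) (v := v) (by norm_num) (by norm_num)).reg2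
  · exact hb.reg2
  · intro v hv
    rw [eval_tab hW (hb.setReg (r := 6) (v := v) (by norm_num) (by norm_num)).reg2
      (v := .reg 5) (c := .reg 6) (a := x) (b := v) (by simp [Expr.eval, setReg_reg, h5])
      (by simp [Expr.eval, setReg_reg]) hxn hv]
    rw [(hR.setReg 6 v).table x hxn v hv, mem_miss]
    tauto
  · intro α hα
    refine wp_growAndAugment_le hW hN hV hDq hκ hρ (mem_miss.1 hα).1 (mem_miss.1 hα).2 rfl hH hB
      hg (hb.setReg (by norm_num) (by norm_num)) (hR.setReg _ _) ?_ hk ?_ ?_ ?_ hem hxe he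
    · simpa [setReg_reg] using h3
    · simpa [setReg_reg] using h4
    · simpa [setReg_reg] using h5
    · simp [setReg_reg]
  · intro α hα
    have h1 : Ga α ≤ 22 * ρ * m := by
      have h1 : ∑ β ∈ range q, (walkLen eu ev E x α β : ℝ) ≤ q * m := by
        exact_mod_cast sum_walkLen_le_mul hN hV hxn (mem_miss.1 hα).1 (mem_miss.1 hα).2
      simp only [Ga]
      rw [hρ]
      calc 22 / κ * ∑ β ∈ range q, (walkLen eu ev E x α β : ℝ) ≤ 22 / κ * (q * m) :=
            mul_le_mul_of_nonneg_left h1 (by positivity)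
        _ = 22 * (q / κ) * m := by ring
    have h2 : ρ * Ga α ≤ 22 * (ρ ^ 3 * m) := by
      calc ρ * Ga α ≤ ρ * (22 * ρ * m) := mul_le_mul_of_nonneg_left h1 (by linarith)
        _ = 22 * (ρ ^ 2 * m) := by ring
        _ ≤ 22 * (ρ ^ 3 * m) := by gcongr
    have h3 : ρ ^ 2 ≤ ρ ^ 3 * m := by nlinarith
    nlinarith
  · rw [sum_add_distrib, sum_const, nsmul_eq_mul, ← mul_sum, hGaM, add_div,
      mul_div_cancel_left₀ _ hM0.ne']
    set Ln : ℝ := ((∑ α ∈ miss q E x, ∑ β ∈ range q, walkLen eu ev E x α β : ℕ) : ℝ)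
    have hLn : 0 ≤ Ln := Nat.cast_nonneg _
    have h1 : 2 * (q : ℝ) / (miss q E x).card ≤ 2 * ρ := by
      rw [hρ, mul_div_assoc]
      exact mul_le_mul_of_nonneg_left
        (div_le_div_of_nonneg_left (Nat.cast_nonneg _) hκ0 hMcard) (by norm_num)
    have h2 : 4 * ρ * (22 / κ * Ln) / (miss q E x).card ≤ 88 * ρ / κ ^ 2 * Ln := by
      calc 4 * ρ * (22 / κ * Ln) / (miss q E x).card ≤ 4 * ρ * (22 / κ * Ln) / κ :=
            div_le_div_of_nonneg_left (by positivity) hκ0 hMcard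
        _ = _ := by field_simp; ring
    nlinarith

/-- The total length of the alternating walks from `x`. -/
noncomputable def walkSum (q : ℕ) (eu ev : ℕ → ℕ) (E : ℕ → ℕ → ℕ) (x : ℕ) : ℕ :=
  ∑ α ∈ miss q E x, ∑ β ∈ range q, walkLen eu ev E x α β

theorem walkSum_le {E : ℕ → ℕ → ℕ} {col : ℕ → ℕ} {x : ℕ} (hN : Net n m D eu ev)
    (hV : Valid n m q eu ev E col) (hx : x < n) : walkSum q eu ev E x ≤ q * (q * m) := by
  have h1 : ∀ α ∈ miss q E x, ∑ β ∈ range q, walkLen eu ev E x α β ≤ q * m := fun α hα =>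
    sum_walkLen_le_mul hN hV hx (mem_miss.1 hα).1 (mem_miss.1 hα).2
  refine (sum_le_card_nsmul _ _ _ h1).trans ?_
  rw [smul_eq_mul]
  refine Nat.mul_le_mul_right _ ?_
  exact (card_le_card (filter_subset _ _)).trans (by simp)

/-- The bound on the expected time of an iteration after the choice of the edge `e`. -/
noncomputable def edgeValue (q : ℕ) (eu ev : ℕ → ℕ) (E : ℕ → ℕ → ℕ) (ρ κ H : ℝ) (e : ℕ) : ℝ :=
  H + 715 * ρ ^ 2 + 88 * ρ / κ ^ 2 * walkSum q eu ev E (eu e)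

theorem edgeValue_le {E : ℕ → ℕ → ℕ} {col : ℕ → ℕ} {e : ℕ} (hN : Net n m D eu ev)
    (hV : Valid n m q eu ev E col) (hκ0 : 0 < κ) (hρκ : ρ * κ = q) (hρ1 : 1 ≤ ρ) (he : e < m) :
    edgeValue q eu ev E ρ κ H e + 10 ≤ H + 1100 * ρ ^ 3 * m := by
  have hm1 : (1 : ℝ) ≤ m := by exact_mod_cast (by omega : 1 ≤ m)
  have hL : (walkSum q eu ev E (eu e) : ℝ) ≤ q * (q * m) := by
    exact_mod_cast walkSum_le hN hV (hN.eu_lt e he)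
  have h1 : 88 * ρ / κ ^ 2 * walkSum q eu ev E (eu e) ≤ 88 * ρ / κ ^ 2 * (q * (q * m)) :=
    mul_le_mul_of_nonneg_left hL (by positivity)
  have h2 : 88 * ρ / κ ^ 2 * (q * (q * m)) = 88 * (ρ ^ 3 * m) := by
    rw [← hρκ]; field_simp
  have h4 : 1 ≤ ρ ^ 2 := one_le_pow₀ hρ1
  have h5 : ρ ^ 2 ≤ ρ ^ 3 := pow_le_pow_right₀ hρ1 (by norm_num)
  have h3 : ρ ^ 3 ≤ ρ ^ 3 * m := le_mul_of_one_le_right (by positivity) hm1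
  unfold edgeValue
  linarith

/-- Averaging over the `k` uncolored edges, where the bound on the total length of all walks enters:
`88 * 2 = 176`. The terms `715 * ρ ^ 2`, `2 * m / k` and the constants are absorbed into `900` by
means of `ρ ≥ 1` and `k ≤ m`. -/
theorem avg_edgeValue_le {E : ℕ → ℕ → ℕ} {col : ℕ → ℕ} {k : ℕ} (hN : Net n m D eu ev)
    (hV : Valid n m q eu ev E col) (hκ0 : 0 < κ) (hρκ : ρ * κ = q) (hρ1 : 1 ≤ ρ) (hDq : D < q)
    (hk0 : 0 < k) (hk : (uncolored m col).card = k) :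
    (∑ e ∈ uncolored m col, edgeValue q eu ev E ρ κ H e) / k + 2 * (m : ℝ) / k + 1 ≤
      H + 900 * ρ ^ 3 * m / k - 1 := by
  have hkm : k ≤ m := by
    rw [← hk]
    exact (card_le_card (filter_subset _ _)).trans (by simp)
  have hk0' : (0 : ℝ) < k := by exact_mod_cast hk0
  have hkm' : (k : ℝ) ≤ m := by exact_mod_cast hkm
  have hmk : 1 ≤ (m : ℝ) / k := by rw [le_div_iff₀ hk0']; linarith
  have hLsum : ∑ e ∈ uncolored m col, (walkSum q eu ev E (eu e) : ℝ) ≤ D * (2 * m * q) := by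
    have h1 := sum_uncolored_le (col := col) hN (walkSum q eu ev E)
    have h2 := Nat.mul_le_mul_left D (sum_walkLen_le hN hV)
    exact_mod_cast h1.trans h2
  have h1 : ∑ e ∈ uncolored m col, edgeValue q eu ev E ρ κ H e ≤
      k * (H + 715 * ρ ^ 2) + 88 * ρ / κ ^ 2 * (D * (2 * m * q)) := by
    simp only [edgeValue, sum_add_distrib, sum_const, nsmul_eq_mul, ← mul_sum, hk]
    have := mul_le_mul_of_nonneg_left hLsum (by positivity : 0 ≤ 88 * ρ / κ ^ 2)
    linarith
  have hDq' : (D : ℝ) ≤ q := by exact_mod_cast hDq.le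
  have h2 : 88 * ρ / κ ^ 2 * (D * (2 * m * q)) ≤ 176 * ρ ^ 3 * m := by
    calc 88 * ρ / κ ^ 2 * (D * (2 * m * q)) ≤ 88 * ρ / κ ^ 2 * (q * (2 * m * q)) := by gcongr
      _ = 176 * ρ ^ 3 * m := by rw [← hρκ]; field_simp; ring
  have h3 : (∑ e ∈ uncolored m col, edgeValue q eu ev E ρ κ H e) / k ≤
      H + 715 * ρ ^ 2 + 176 * (ρ ^ 3 * (m / k)) := by
    rw [div_le_iff₀ hk0']
    have : ρ ^ 3 * ((m : ℝ) / k) * k = ρ ^ 3 * m := by field_simp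
    linarith
  have h4 : 1 ≤ ρ ^ 2 := one_le_pow₀ hρ1
  have h5 : ρ ^ 2 ≤ ρ ^ 3 := pow_le_pow_right₀ hρ1 (by norm_num)
  have h6 : ρ ^ 3 ≤ ρ ^ 3 * (m / k) := le_mul_of_one_le_right (by positivity) hmk
  have h7 : (m : ℝ) / k ≤ ρ ^ 3 * (m / k) :=
    le_mul_of_one_le_left (by positivity) (h4.trans h5)
  rw [mul_div_assoc, mul_div_assoc]
  linarith

theorem wp_iteration_le {k : ℕ} (hW : Sizes W n m q) (hN : Net n m D eu ev) (hDq : D < q)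
    (hκ : κ = q - D) (hρ : ρ = q / κ) (hH : 0 ≤ H) (hB : H + 1100 * ρ ^ 3 * m ≤ B)
    {g : Store → ENNReal}
    (hg : ∀ s', Ready n m q eu ev (k - 1) s' → g s' ≤ ENNReal.ofReal H)
    (hk0 : 0 < k) (hs : Ready n m q eu ev k s) :
    wp W B iteration g s ≤ ENNReal.ofReal (H + 900 * ρ ^ 3 * m / k) := by
  obtain ⟨E, col, hb, hR, hV, h3, hk⟩ := hs
  have hκ0 : 0 < κ := by rw [hκ, sub_pos]; exact_mod_cast hDq
  have hκq : κ ≤ q := by rw [hκ]; linarith [(Nat.cast_nonneg D : (0 : ℝ) ≤ D)]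
  have hρ1 : 1 ≤ ρ := by rw [hρ, le_div_iff₀ hκ0]; linarith
  have hρκ : ρ * κ = q := by rw [hρ]; field_simp
  -- The gap between `712` and `715` pays for the assignment of `x` and the two surrounding `seq`
  -- steps.
  have hX3 : ∀ e, H + 712 * ρ ^ 2 + 88 * ρ / κ ^ 2 * walkSum q eu ev E (eu e) ≤
      edgeValue q eu ev E ρ κ H e - 3 ∧ 3 ≤ edgeValue q eu ev E ρ κ H e := by
    intro e
    have h4 : 1 ≤ ρ ^ 2 := one_le_pow₀ hρ1
    have : 0 ≤ 88 * ρ / κ ^ 2 * (walkSum q eu ev E (eu e) : ℝ) := by positivity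
    unfold edgeValue
    constructor <;> linarith
  have hXB : ∀ e < m, edgeValue q eu ev E ρ κ H e + 10 ≤ B := fun e he =>
    (edgeValue_le hN hV hκ0 hρκ hρ1 he).trans hB
  have havg := avg_edgeValue_le (H := H) hN hV hκ0 hρκ hρ1 hDq hk0 hk
  have hkB : 900 * ρ ^ 3 * m / k ≤ 900 * ρ ^ 3 * m := by
    apply div_le_self (by positivity)
    exact_mod_cast hk0
  have hρm : 0 ≤ ρ ^ 3 * m := by positivity
  have hY0 : 0 ≤ H + 900 * ρ ^ 3 * m / k - 1 := by
    refine le_trans ?_ havg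
    have : 0 ≤ ∑ e ∈ uncolored m col, edgeValue q eu ev E ρ κ H e :=
      sum_nonneg fun e _ => by have := (hX3 e).2; linarith
    positivity
  rw [← sub_add_cancel (H + 900 * ρ ^ 3 * m / k) 1]
  refine wp_seq_le hY0 ?_ (by linarith)
  refine wp_sample_le (N := m) (S := uncolored m col) ?_ ?_
    (card_pos.1 (by omega)) (filter_subset _ _) ?_ (edgeValue q eu ev E ρ κ H)
    (fun e _ => by have := (hX3 e).2; linarith) ?_
    (fun e he => by have := hXB e (mem_uncolored.1 he).1; linarith) (by rw [hk]; exact havg)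
    (by linarith)
  · intro v _
    simpa [Expr.eval, setReg_reg] using hb.reg1
  · exact hb.reg1
  · intro v hv
    simp only [Expr.eval, setReg_reg, setReg_arr, if_true, hR.colors v hv, mem_uncolored]
    tauto
  · intro e he
    obtain ⟨hem, he0⟩ := mem_uncolored.1 he
    have hev : (Expr.load 0 (.reg 4)).eval W (s.setReg 4 e) = eu e := by
      simp only [Expr.eval, setReg_reg, setReg_arr, if_true, hb.arr0 e hem]
    have hXe := hXB e hem
    obtain ⟨hX1, hX2⟩ := hX3 e
    have hmain := wp_pickColor_le (s := (s.setReg 4 e).setReg 5 (eu e)) hW hN hV hDq hκ hρ hH hB hg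
      ((hb.setReg (by norm_num) (by norm_num)).setReg (by norm_num) (by norm_num))
      ((hR.setReg _ _).setReg _ _) (by simpa [setReg_reg] using h3) hk
      (by simp only [setReg_reg]; norm_num) (by simp only [setReg_reg]; norm_num) hem
      (Or.inl rfl) he0 hX1 (by linarith)
    have h1 := (Det.assign (W := W) (B := B) 5 (.load 0 (.reg 4)) (s.setReg 4 e)) _
      (edgeValue q eu ev E ρ κ H e - 3 + 1) (by linarith)
      (by rintro _ rfl; rw [hev]; exact wp_seq_le (by linarith) hmain (by linarith))
      (by linarith)
    refine (wp_seq_le (by linarith) h1 (by linarith)).trans (ENNReal.ofReal_le_ofReal ?_)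
    linarith

/-- Color all edges. -/
def program : Cmd := .seq (.assign 3 (.reg 1)) (.loop (.reg 3) iteration)

theorem wp_program_le (hW : Sizes W n m q) (hN : Net n m D eu ev) (hDq : D < q)
    (hκ : κ = q - D) (hρ : ρ = q / κ) (hm : 1 ≤ m)
    (hB : B = 3 + ρ ^ 3 * m * (1000 * (harmonic m : ℝ) + 1100))
    (hb : Base m q eu ev s) (h4 : s.arr 4 = fun _ => 0) (h3 : s.arr 3 = fun _ => 0)
    {f : Store → ENNReal} (hf : ∀ s', Ready n m q eu ev 0 s' → f s' = 0) :
    wp W B program f s ≤ ENNReal.ofReal B := by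
  have hκ0 : 0 < κ := by rw [hκ, sub_pos]; exact_mod_cast hDq
  have hκq : κ ≤ q := by rw [hκ]; linarith [(Nat.cast_nonneg D : (0 : ℝ) ≤ D)]
  have hρ1 : 1 ≤ ρ := by rw [hρ, le_div_iff₀ hκ0]; linarith
  have hρ3 : 1 ≤ ρ ^ 3 := one_le_pow₀ hρ1
  have hm1 : (1 : ℝ) ≤ m := by exact_mod_cast hm
  have hc : 1 ≤ ρ ^ 3 * m := by nlinarith
  -- An iteration with `k` uncolored edges lowers this by `1000 * ρ ^ 3 * m / k`. Of this, `900`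
  -- parts pay for the iteration and the rest, at least `1` because `k ≤ m`, for the loop test. The
  -- summand with `1100` in `B` is headroom for the cap.
  let P : ℕ → ℝ := fun k => 1 + 1000 * ρ ^ 3 * m * (harmonic k : ℝ)
  have hharm : ∀ k, (0 : ℝ) ≤ (harmonic k : ℝ) := by
    intro k
    unfold harmonic
    push_cast
    positivity
  have hmono : ∀ k ≤ m, (harmonic k : ℝ) ≤ (harmonic m : ℝ) := by
    intro k hk
    unfold harmonic
    push_cast
    exact sum_le_sum_of_subset_of_nonneg (range_subset_range.2 hk) fun _ _ _ => by positivity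
  have hPmono : ∀ k ≤ m, P k ≤ P m := by
    intro k hk
    simp only [P]
    have := mul_le_mul_of_nonneg_left (hmono k hk) (by positivity : 0 ≤ 1000 * ρ ^ 3 * m)
    linarith
  have hPB : P m + 1100 * ρ ^ 3 * m + 2 ≤ B := by
    rw [hB]; simp only [P]; linarith
  have hP1 : ∀ k, 1 ≤ P k := by
    intro k
    have := hharm k
    have : 0 ≤ 1000 * ρ ^ 3 * m * (harmonic k : ℝ) := by positivity
    simp only [P]; linarith
  have hcard : ∀ {col : ℕ → ℕ}, (uncolored m col).card ≤ m := fun {col} =>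
    (card_le_card (filter_subset _ _)).trans (by simp)
  have hready : Ready n m q eu ev m (s.setReg 3 m) := by
    refine ⟨fun _ _ => 0, fun _ => 0, hb.setReg (by norm_num) (by norm_num), ⟨?_, ?_, ?_⟩,
      ⟨fun _ _ => Nat.zero_le _, ?_⟩, by simp [setReg_reg], by simp [uncolored]⟩
    · intro v _ c _; rw [setReg_arr, h4]
    · intro e _; rw [setReg_arr, h3]
    · intro e _ h; exact absurd rfl h
    · intro v _ c _ e
      constructor
      · intro h; omega
      · rintro ⟨-, -, h⟩; omega
  have hloop : wp W B (.loop (.reg 3) iteration) f (s.setReg 3 m) ≤ ENNReal.ofReal (P m) := by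
    have := wp_loop_le_of_potential (W := W) (B := B) (e := .reg 3) (p := iteration) (f := f)
      (fun s' => ∃ k ≤ m, Ready n m q eu ev k s') (fun s' => P (s'.reg 3)) ?_ ?_ ?_
      (s := s.setReg 3 m) ⟨m, le_rfl, hready⟩
    · simpa [setReg_reg] using this
    · rintro s' ⟨k, hk, hs'⟩
      obtain ⟨_, _, _, _, _, h, _⟩ := id hs'
      rw [h]
      have := hPmono k hk
      nlinarith
    · rintro s' ⟨k, hk, hs'⟩ (hne : s'.reg 3 ≠ 0) g hg
      obtain ⟨_, _, _, _, _, h, _⟩ := id hs'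
      rw [h] at hne ⊢
      obtain ⟨k, rfl⟩ : ∃ k', k = k' + 1 := ⟨k - 1, by omega⟩
      refine ⟨P k + 900 * ρ ^ 3 * m / (k + 1 : ℕ), ?_, ?_, wp_iteration_le hW hN hDq hκ hρ ?_ ?_ ?_
        (by omega) hs'⟩
      · have := hP1 k
        positivity
      · simp only [P, harmonic_succ]
        push_cast
        have hk1 : ((k : ℝ) + 1) ≤ m := by exact_mod_cast hk
        have h1 : 1 ≤ ρ ^ 3 * m * ((k : ℝ) + 1)⁻¹ := by
          have : 1 ≤ (m : ℝ) * ((k : ℝ) + 1)⁻¹ := by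
            rw [← div_eq_mul_inv, le_div_iff₀ (by positivity)]; linarith
          nlinarith
        rw [div_eq_mul_inv]
        nlinarith
      · have := hP1 k; linarith
      · have := hPmono k (by omega)
        linarith
      · intro s'' hs''
        obtain ⟨_, _, _, _, _, h', _⟩ := id hs''
        have := hg s'' ⟨_, by omega, hs''⟩
        rw [h'] at this
        exact this
    · rintro s' ⟨k, hk, hs'⟩ (h0 : s'.reg 3 = 0)
      obtain ⟨_, _, _, _, _, h, _⟩ := id hs'
      obtain rfl : k = 0 := by omega
      refine ⟨0, le_rfl, ?_, by rw [hf s' hs']; simp⟩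
      have := hP1 (s'.reg 3)
      linarith
  have hPm := hP1 m
  have h1 := (Det.assign (W := W) (B := B) 3 (.reg 1) s) (wp W B (.loop (.reg 3) iteration) f)
    (P m) (by linarith) (by
      rintro _ rfl
      simp only [Expr.eval, hb.reg1]
      exact hloop) (by nlinarith)
  refine (wp_seq_le (by linarith) h1 (by nlinarith)).trans (ENNReal.ofReal_le_ofReal ?_)
  nlinarith

end
end EdgeColoringProblem

/-! ### Input, output and success probability -/

namespace EdgeColoringProblem
open Finset WordRAM

section
variable {n m q : ℕ} {G : SimpleGraph (Fin n)} {es : Fin m → Fin n × Fin n}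

theorem IsEdgeList.adj (h : IsEdgeList G es) (i : Fin m) : G.Adj (es i).1 (es i).2 := by
  have : s((es i).1, (es i).2) ∈ G.edgeSet := h.2 ▸ Set.mem_range_self i
  simpa using this

theorem input_arr_zero (i : Fin m) : (input q es).arr 0 i = (es i).1 := by simp [input]

theorem input_arr_one (i : Fin m) : (input q es).arr 1 i = (es i).2 := by simp [input]

theorem inc_input_iff (i : Fin m) (v : Fin n) :
    Inc ((input q es).arr 0) ((input q es).arr 1) v i ↔ v ∈ s((es i).1, (es i).2) := by
  simp [Inc, input_arr_zero, input_arr_one, Fin.val_inj, eq_comm]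

theorem IsEdgeList.net [DecidableRel G.Adj] (h : IsEdgeList G es) :
    Net n m G.maxDegree ((input q es).arr 0) ((input q es).arr 1) where
  eu_lt e he := by rw [input_arr_zero ⟨e, he⟩]; exact Fin.is_lt _
  ev_lt e he := by rw [input_arr_one ⟨e, he⟩]; exact Fin.is_lt _
  ne e he := by
    rw [input_arr_zero ⟨e, he⟩, input_arr_one ⟨e, he⟩, Ne, Fin.val_inj]
    exact (h.adj _).ne
  simple e he f hf hef := by
    rw [input_arr_zero ⟨e, he⟩, input_arr_one ⟨e, he⟩, input_arr_zero ⟨f, hf⟩,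
      input_arr_one ⟨f, hf⟩] at hef
    simp only [Fin.val_inj] at hef
    have := @h.1 ⟨e, he⟩ ⟨f, hf⟩ (Sym2.eq_iff.2 hef)
    simpa using this
  deg v hv S hS hinc := by
    refine le_trans ?_ (G.degree_le_maxDegree ⟨v, hv⟩)
    rw [← G.card_incidenceFinset_eq_degree]
    refine Finset.card_le_card_of_injOn
      (fun e => if he : e < m then s((es ⟨e, he⟩).1, (es ⟨e, he⟩).2) else s(⟨v, hv⟩, ⟨v, hv⟩)) ?_ ?_
    · intro e he
      have hem := mem_range.1 (hS he)
      have := (inc_input_iff (q := q) (es := es) ⟨e, hem⟩ ⟨v, hv⟩).1 (hinc e he)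
      simp only [hem, dif_pos, SimpleGraph.coe_incidenceFinset]
      exact ⟨h.adj _, this⟩
    · intro e he f hf hef
      have hem := mem_range.1 (hS he)
      have hfm := mem_range.1 (hS hf)
      simp only [hem, hfm, dif_pos] at hef
      simpa using h.1 hef

theorem IsEdgeList.isOutput [DecidableRel G.Adj] (h : IsEdgeList G es) {s : Store}
    (hs : Ready n m q ((input q es).arr 0) ((input q es).arr 1) 0 s) : IsOutput G q es s := by
  obtain ⟨E, col, -, hR, hV, -, hc⟩ := hs
  have h0 : ∀ e < m, col e ≠ 0 := fun e he h0 => by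
    have := mem_uncolored.2 ⟨he, h0⟩
    simp [Finset.card_eq_zero.1 hc] at this
  have hidx : ∀ e : G.edgeSet, ∃ i : Fin m, s((es i).1, (es i).2) = e := fun e => h.2.ge e.2
  choose g hg using hidx
  have hlt : ∀ i : Fin m, col i - 1 < q := fun i => by
    have := h0 i i.2
    have := hV.le i i.2
    omega
  refine ⟨fun e => ⟨col (g e) - 1, hlt _⟩, ?_, ?_⟩
  · rintro e f hef ⟨v, hve, hvf⟩ heq
    rw [← hg e, ← inc_input_iff (q := q)] at hve
    rw [← hg f, ← inc_input_iff (q := q)] at hvf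
    have hcol : col (g e) = col (g f) := by
      have := Fin.mk.inj heq
      have := h0 _ (g e).2
      have := h0 _ (g f).2
      omega
    have := hV.inj v.2 (g e).2 (g f).2 hve hvf (h0 _ (g e).2) hcol
    exact hef (Subtype.ext (by rw [← hg e, ← hg f, Fin.ext this]))
  · intro i e he
    have : g e = i := h.1 (by simp only [hg e, he])
    have := hR.out i i.2 (h0 i i.2)
    simp only [‹g e = i›]
    omega

theorem base_input : Base m q ((input q es).arr 0) ((input q es).arr 1) (input q es) where
  reg1 := by simp [input]
  reg2 := by simp [input]
  arr0 _ _ := rfl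
  arr1 _ _ := rfl

theorem sizes_wordBound (hn : 1 ≤ n) (hm : m ≤ n ^ 2) (hq : q ≤ 2 * n) :
    Sizes (wordBound 4 n) n m q := by
  have h : n + 1 ≤ 2 ^ (Nat.log 2 n + 1) := Nat.lt_pow_succ_log_self (by norm_num) n
  have hW : (n + 1) ^ 4 ≤ wordBound 4 n := by
    rw [wordBound, mul_comm, pow_mul]
    exact Nat.pow_le_pow_left h 4
  have h2 : (n + 1) ^ 4 = n ^ 4 + 4 * n ^ 3 + 6 * n ^ 2 + 4 * n + 1 := by ring
  have h3 := Nat.mul_le_mul_left n hq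
  have h4 : n * (2 * n) = 2 * n ^ 2 := by ring
  have h5 : 0 ≤ n ^ 4 := Nat.zero_le _
  have h6 : 0 ≤ n ^ 3 := Nat.zero_le _
  constructor <;> omega

end

/-- If the failure probability decays geometrically, then the success probability is large. -/
theorem le_toReal_of_compl_le {α : Type*} (p : PMF α) (S : Set α) {δ : ℝ} (hδ : 0 ≤ δ)
    (h : p.toOuterMeasure Sᶜ ≤ ENNReal.ofReal δ) : 1 - δ ≤ (p.toOuterMeasure S).toReal := by
  have h1 : p.toOuterMeasure Set.univ = 1 :=
    (PMF.toOuterMeasure_apply_eq_one_iff p _).2 (Set.subset_univ _)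
  have hS : p.toOuterMeasure S ≠ ⊤ :=
    ne_top_of_le_ne_top ENNReal.one_ne_top
      ((p.toOuterMeasure.mono (Set.subset_univ S)).trans h1.le)
  have h2 : (1 : ENNReal) ≤ p.toOuterMeasure S + ENNReal.ofReal δ := by
    rw [← h1, ← Set.union_compl_self S]
    exact (MeasureTheory.measure_union_le _ _).trans (add_le_add le_rfl h)
  have h3 := ENNReal.toReal_mono (ENNReal.add_ne_top.2 ⟨hS, ENNReal.ofReal_ne_top⟩) h2
  rw [ENNReal.toReal_add hS ENNReal.ofReal_ne_top, ENNReal.toReal_ofReal hδ,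
    ENNReal.toReal_one] at h3
  linarith

/-- By `1 - 1 / y ≤ log y`, the logarithm of the base is at least `1 / (2 * B + 1) ≥ 1 / (3 * B)`.
Aiming at `n ^ (a + 1)` instead of `n ^ a` gains the factor `2`, which compensates for `1 + wp / B ≤
2` in the tail bound. -/
theorem two_mul_pow_le_pow {n t : ℕ} {B : ℝ} (a : ℕ) (hB : 1 ≤ B) (hn : 2 ≤ n)
    (ht : 3 * B * ((a + 1) * Real.log n) ≤ t) :
    2 * (n : ℝ) ^ a ≤ (1 + 1 / (2 * B)) ^ t := by
  have hn2 : (2 : ℝ) ≤ n := by exact_mod_cast hn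
  have hx : 0 < 1 + 1 / (2 * B) := by positivity
  have hlog : 1 / (3 * B) ≤ Real.log (1 + 1 / (2 * B)) := by
    refine le_trans ?_ (Real.one_sub_inv_le_log_of_pos hx)
    have h2 : 1 - (1 + 1 / (2 * B))⁻¹ = 1 / (2 * B + 1) := by field_simp; ring
    rw [h2]
    exact one_div_le_one_div_of_le (by positivity) (by linarith)
  have h1 : (a + 1) * Real.log n ≤ t * Real.log (1 + 1 / (2 * B)) := by
    calc (a + 1) * Real.log n ≤ t * (1 / (3 * B)) := by
          rw [mul_one_div, le_div_iff₀ (by positivity)]; linarith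
      _ ≤ _ := by gcongr
  calc 2 * (n : ℝ) ^ a ≤ (n : ℝ) ^ (a + 1) := by
        rw [pow_succ']; gcongr
    _ ≤ _ := by
        rw [← Real.log_le_log_iff (by positivity) (by positivity), Real.log_pow, Real.log_pow]
        exact_mod_cast h1

theorem successProb_program_ge {n m q t : ℕ} {G : SimpleGraph (Fin n)} [DecidableRel G.Adj]
    {es : Fin m → Fin n × Fin n} (hes : IsEdgeList G es) {κ ρ B : ℝ} (a : ℕ) (hn : 2 ≤ n)
    (hW : Sizes (wordBound 4 n) n m q) (hDq : G.maxDegree < q)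
    (hκ : κ = q - G.maxDegree) (hρ : ρ = q / κ) (hm : 1 ≤ m)
    (hB : B = 3 + ρ ^ 3 * m * (1000 * (harmonic m : ℝ) + 1100)) (hB1 : 1 ≤ B)
    (ht : 3 * B * ((a + 1) * Real.log n) ≤ t) :
    1 - 1 / (n : ℝ) ^ a ≤ successProb program 4 G q es t := by
  classical
  have hn0 : (0 : ℝ) < n := by positivity
  -- Infinite cost for wrong outputs: a finite expected cost thus certifies correctness as well as
  -- termination.
  let f : Store → ENNReal := fun s => if IsOutput G q es s then 0 else ⊤
  have hwp := wp_program_le hW (hes.net (q := q)) hDq hκ hρ hm hB (base_input (q := q) (es := es))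
    (by funext i; simp [input]) (by funext i; simp [input]) (f := f)
    (fun s' hs' => if_pos (hes.isOutput hs'))
  have hmain := toOuterMeasure_run_mul_pow_le (W := wordBound 4 n) (B := B) (by linarith)
    (IsOutput G q es) f (fun s hs => if_neg hs) t ⟨[program], input q es⟩
  have hle2 : (1 : ENNReal) + wpList (wordBound 4 n) B f [program] (input q es) / ENNReal.ofReal B
      ≤ ENNReal.ofReal 2 := by
    have hB0 : ENNReal.ofReal B ≠ 0 := by simp; linarith
    have : wpList (wordBound 4 n) B f [program] (input q es) / ENNReal.ofReal B ≤ 1 := by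
      refine ENNReal.div_le_of_le_mul ?_
      rw [one_mul]
      exact hwp
    calc _ ≤ (1 : ENNReal) + 1 := by gcongr
      _ = ENNReal.ofReal 2 := by norm_num
  refine le_toReal_of_compl_le _ _ (by positivity) ?_
  have hpow := two_mul_pow_le_pow a hB1 hn ht
  rw [← ENNReal.ofReal_pow (by positivity)] at hmain
  have h1 : (run (wordBound 4 n) t ⟨[program], input q es⟩).toOuterMeasure
      {r | r.todo = [] ∧ IsOutput G q es r.mem}ᶜ * ENNReal.ofReal (2 * (n : ℝ) ^ a) ≤
      ENNReal.ofReal 2 :=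
    (mul_le_mul_right (ENNReal.ofReal_le_ofReal hpow) _).trans (hmain.trans hle2)
  have h2 : (1 : ℝ) / n ^ a = 2 / (2 * (n : ℝ) ^ a) := by field_simp
  rw [h2, ENNReal.ofReal_div_of_pos (by positivity)]
  refine (ENNReal.le_div_iff_mul_le (Or.inl ?_) (Or.inl ENNReal.ofReal_ne_top)).2 h1
  rw [Ne, ENNReal.ofReal_eq_zero, not_le]
  positivity

theorem card_edgeFinset_le_sq {n : ℕ} (G : SimpleGraph (Fin n)) [DecidableRel G.Adj] :
    G.edgeFinset.card ≤ n ^ 2 := by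
  refine G.card_edgeFinset_le_card_choose_two.trans ?_
  rw [Fintype.card_fin]
  exact Nat.choose_le_pow n 2

/-- The time bound of the theorem dominates the analysis of the program. -/
theorem time_bound_le {a m : ℕ} {ε L H ρ : ℝ} (hε : 0 < ε) (hε1 : ε < 1) (hm : 1 ≤ m)
    (hL : 0.69 ≤ L) (hH : H ≤ 1 + 2 * L) (hH0 : 0 ≤ H) (hρ0 : 0 ≤ ρ) (hρ : ρ ≤ 4 / ε) :
    3 * (3 + ρ ^ 3 * m * (1000 * H + 1100)) * ((a + 1) * L) ≤
      ⌊10 ^ 7 * ((a : ℝ) + 1) * m * L ^ 3 / ε ^ 3⌋₊ := by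
  have hm1 : (1 : ℝ) ≤ m := by exact_mod_cast hm
  have ha : (1 : ℝ) ≤ a + 1 := by have := Nat.cast_nonneg (α := ℝ) a; linarith
  set M : ℝ := m / ε ^ 3 with hM
  have hM1 : 1 ≤ M := by
    rw [hM, le_div_iff₀ (by positivity)]
    have := pow_le_one₀ (n := 3) hε.le hε1.le
    linarith
  have h1 : ρ ^ 3 * m ≤ 64 * M := by
    calc ρ ^ 3 * m ≤ (4 / ε) ^ 3 * m := by gcongr
      _ = 64 * M := by rw [hM]; ring
  -- Since `L ≥ 0.69`, one has `1000 * H + 1100 ≤ 2100 + 2000 * L ≤ 5100 * L`, and `64 * 5100 =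
  -- 326400` leaves room for the summand `3`.
  have h2 : 3 + ρ ^ 3 * m * (1000 * H + 1100) ≤ 331000 * (M * L) := by
    have h3 : ρ ^ 3 * m * (1000 * H + 1100) ≤ 64 * M * (5100 * L) := by
      gcongr
      linarith
    have h4 : 0.69 ≤ M * L := by nlinarith
    nlinarith
  have h3 : 3 * (3 + ρ ^ 3 * m * (1000 * H + 1100)) * ((a + 1) * L) ≤
      993000 * ((a + 1) * M * L ^ 2) := by
    calc _ ≤ 3 * (331000 * (M * L)) * ((a + 1) * L) := by gcongr
      _ = _ := by ring
  have h4 : (0.4 : ℝ) ≤ (a + 1) * M * L ^ 2 := by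
    have h5 : (1 : ℝ) ≤ (a + 1) * M := one_le_mul_of_one_le_of_one_le ha hM1
    have h6 : (0.4 : ℝ) ≤ L ^ 2 := by nlinarith
    nlinarith
  have h5 : 10 ^ 7 * ((a : ℝ) + 1) * m * L ^ 3 / ε ^ 3 = 10 ^ 7 * (((a + 1) * M * L ^ 2) * L) := by
    rw [hM]; ring
  have h6 := Nat.lt_floor_add_one (10 ^ 7 * ((a : ℝ) + 1) * m * L ^ 3 / ε ^ 3)
  -- The analysis yields only `L ^ 2`. The third factor `L` is replaced by `0.69`, and the surplus
  -- in `10 ^ 7` also covers the loss of less than one in the floor.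
  have h7 : ((a + 1) * M * L ^ 2) * 0.69 ≤ ((a + 1) * M * L ^ 2) * L := by gcongr
  rw [h5] at h6
  rw [h5]
  linarith

end EdgeColoringProblem

theorem theorem1 (a : ℕ) :
    ∃ (P : WordRAM.Cmd) (c : ℕ) (C : ℝ),
      ∀ (ε : ℝ), 0 < ε → ε < 1 →
      ∀ (n : ℕ), 0 < n →
      ∀ (G : SimpleGraph (Fin n)) [DecidableRel G.Adj],
        500 * Real.log n / ε ≤ (G.maxDegree : ℝ) →
      ∀ (es : Fin G.edgeFinset.card → Fin n × Fin n),
        EdgeColoringProblem.IsEdgeList G es →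
        1 - 1 / (n : ℝ) ^ a ≤
          EdgeColoringProblem.successProb P c G ⌊(1 + ε) * (G.maxDegree : ℝ)⌋₊ es
            ⌊C * (G.edgeFinset.card : ℝ) * Real.log n ^ 3 / ε ^ 3⌋₊ := by
  refine ⟨EdgeColoringProblem.program, 4, 10 ^ 7 * ((a : ℝ) + 1),
    fun ε hε hε1 n hn G _ hΔ es hes => ?_⟩
  obtain rfl | hn2 : n = 1 ∨ 2 ≤ n := by omega
  -- For `n = 1` the claimed probability is `0`.
  · simp [EdgeColoringProblem.successProb]
  have hn2' : (2 : ℝ) ≤ n := by exact_mod_cast hn2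
  have hL : 0.69 ≤ Real.log n :=
    (by linarith [Real.log_two_gt_d9] : 0.69 ≤ Real.log 2).trans
      (Real.log_le_log (by norm_num) hn2')
  rw [div_le_iff₀ hε] at hΔ
  set D := G.maxDegree with hD
  set q := ⌊(1 + ε) * (D : ℝ)⌋₊ with hq
  -- From `500 * 0.69`. The floor in `q` costs less than `1`, which is then at most half of `ε * D`.
  have hDε : 345 ≤ (D : ℝ) * ε := by linarith
  have hD0 : (0 : ℝ) ≤ D := Nat.cast_nonneg _
  have hq1 : (q : ℝ) ≤ (1 + ε) * D := Nat.floor_le (by positivity)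
  have hq2 : (1 + ε) * D < q + 1 := Nat.lt_floor_add_one _
  have hq3 : (q : ℝ) ≤ 2 * D := by nlinarith
  have hκ2 : ε * D / 2 ≤ q - D := by linarith
  have hDq : D < q := by
    have : (D : ℝ) < q := by linarith
    exact_mod_cast this
  have : Nonempty (Fin n) := ⟨⟨0, hn⟩⟩
  have hDn : D < n := by simpa using G.maxDegree_lt_card_verts
  have hD1 : 0 < D := by
    have : (0 : ℝ) < D := by nlinarith
    exact_mod_cast this
  have hm : 1 ≤ G.edgeFinset.card := by
    obtain ⟨v, hv⟩ := G.exists_maximal_degree_vertex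
    have := G.degree_le_card_edgeFinset v
    omega
  have hqn : q ≤ 2 * n := by
    have : q ≤ 2 * D := by exact_mod_cast hq3
    omega
  have hmn := EdgeColoringProblem.card_edgeFinset_le_sq G
  have hκ0 : 0 < (q : ℝ) - D := by linarith
  -- From `q ≤ 2 * D` and `q - D ≥ ε * D / 2`.
  have hρ : (q : ℝ) / (q - D) ≤ 4 / ε := by
    rw [div_le_div_iff₀ hκ0 hε]
    nlinarith
  have hρ0 : 0 ≤ (q : ℝ) / (q - D) := by positivity
  have hH0 : (0 : ℝ) ≤ (harmonic G.edgeFinset.card : ℝ) := by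
    exact_mod_cast (harmonic_pos (by omega)).le
  have hH : (harmonic G.edgeFinset.card : ℝ) ≤ 1 + 2 * Real.log n := by
    refine (harmonic_le_one_add_log _).trans ?_
    have h1 : Real.log (G.edgeFinset.card : ℝ) ≤ Real.log ((n : ℝ) ^ 2) :=
      Real.log_le_log (by exact_mod_cast hm) (by exact_mod_cast hmn)
    rw [Real.log_pow] at h1
    push_cast at h1
    linarith
  refine EdgeColoringProblem.successProb_program_ge hes a hn2
    (EdgeColoringProblem.sizes_wordBound (by omega) hmn hqn) hDq rfl rfl hm rfl
    ?_ (EdgeColoringProblem.time_bound_le hε hε1 hm hL hH hH0 hρ0 hρ)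
  have : 0 ≤ ((q : ℝ) / (q - D)) ^ 3 * G.edgeFinset.card *
      (1000 * (harmonic G.edgeFinset.card : ℝ) + 1100) := by positivity
  linarith
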